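/- Let $N\ge 2$ and let $P_1,\dots,P_N$ be distinct points on the unit circle in $\mathbb R^2$; write $d$ for the Euclidean distance. The \emph{chord graph} is the planar graph formed by all chords $P_iP_j$: its vertices are the points $P_i$ and the points common to two distinct chords, its edges are the pieces into which the vertices cut the chords. Fix $\delta>0$; an edge with end points $u,v$ gets the weight $w=\lfloor d(u,v)/\delta\rfloor$. The \emph{network} is the dual graph: its vertices are the cells into which the chords cut the open disk, and each edge $e$ of the chord graph gives $w_e$ legs of dimension $D\ge2$ between the two cells on its sides. The cells that reach the circle along an arc carry no tensor; the legs ending there are the boundary legs. Every other cell $x$ carries the tensor $U_x|0\rangle$, the $U_x$ being independent Haar random unitaries, and contraction gives, after normalization, the boundary state. A cut for a set $A$ of boundary cells is a set of cells that contains, of all boundary cells, exactly those in $A$; it crosses the legs between cells inside and outside it. Let $|\gamma_A|$ be the least number of legs that a cut for $A$ crosses, and let $S(A)$ be the von Neumann entropy of the boundary state on $A$. For vertices $u,v$ of the chord graph let $L(u,v)=\log D\cdot\min_p\sum_{e\in p}w_e$, the minimum being over walks $p$ from $u$ to $v$ in the chord graph; a walk attaining it is called minimal. Let $f$ be the largest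 number of edges of the chord graph on a single chord $P_iP_j$. Then: 1. $f\le\left(\frac{N-2}{2}\right)^2+1$. 2. For all $\delta>0$ and $i\ne j$, if $A_{ij}$ is the set of boundary cells to the left of the chord from $P_i$ to $P_j$, then $|\gamma_{A_{ij}}|\log D=L(P_i,P_j)$. 3. For all $\delta>0$, $D\ge 2$, all vertices $u,v$ of the chord graph on a common chord (in particular all $u=P_i$, $v=P_j$) and every minimal walk from $u$ to $v$, with $k$ edges, say, $$\left|d(u,v)-\frac{\delta}{\log D}L(u,v)\right|\le k\,\delta .$$ 4. There is $\varepsilon_0>0$, depending only on the points, such that for every $\varepsilon>0$ and every $0<\delta\le\min(\varepsilon,\varepsilon_0)/f$ (so for $\delta=\varepsilon/f$ if $\varepsilon\le\varepsilon_0$): for all $i\neq j$ the minimal cut for $A_{ij}$ is unique, and for all vertices $u,v$ of the chord graph on a common chord, every minimal walk from $u$ to $v$ has at most $f$ edges and, for all $D\ge2$, $$\left|d(u,v)-\frac{\delta}{\log D}L(u,v)\right|\le\varepsilon .$$ 5. (Ryu--Takayanagi formula at large bond dimension.) For every $\delta>0$, every set $A$ of boundary cells and every $\eta>0$ there is a constant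 $C$, independent of $D$, such that $\big|S(A)-|\gamma_A|\log D\big|\le C$ with probability at least $1-\eta$ for all $D\ge2$. If the minimal cut for $A$ is unique, then for every $\eta>0$ and all large enough $D$, $\big|S(A)-|\gamma_A|\log D\big|\le\eta$ with probability at least $1-\eta$. -/

import Mathlib

open scoped BigOperators

noncomputable section

namespace FlatNetwork

/-! ### Tensor network states on an arbitrary finite graph

A network is given by a finite set `V` of vertices, a finite set `E` of edges, an incidence relation
`inc`, a number `w e` of parallel legs on every edge `e` (each leg has dimension `D`), and a set `out`
of outer vertices, which carry no tensor: the legs that end there are the uncontracted boundary legs. -/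

section TensorNetwork

variable {V E : Type} (inc : V → E → Prop) (w : E → ℕ) (D : ℕ)

/-- Labels of the product basis of the Hilbert space of all legs that meet the vertex `x`. -/
def LegIndex (x : V) : Type := (e : {e : E // inc x e}) → Fin (w e.1) → Fin D

open Classical in
instance [Fintype E] (x : V) : Fintype (LegIndex inc w D x) :=
  inferInstanceAs (Fintype ((e : {e : E // inc x e}) → Fin (w e.1) → Fin D))

open Classical in
instance (x : V) : DecidableEq (LegIndex inc w D x) := Classical.decEq _

/-- The labels at `x` of a simultaneous labelling of all legs of the network. -/
def legsAt (x : V) (a : (e : E) → Fin (w e) → Fin D) : LegIndex inc w D x := fun e => a e.1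

variable (out : Set V)

/-- A choice of a tensor at every vertex that is not an outer one. -/
abbrev Tensors : Type := (x : {x : V // x ∉ out}) → LegIndex inc w D x.1 → ℂ

/-- Labels of the product basis of the Hilbert space of the boundary legs at the vertices `b`
with `p b`. -/
abbrev BoundaryIndex (p : out → Prop) : Type := (b : {b : out // p b}) → LegIndex inc w D b.1.1

open Classical in
/-- The (unnormalized) boundary state: all tensors, contracted along the inner legs with the
unnormalized maximally entangled pairs `∑ m, |m⟩|m⟩`. -/
def boundaryState [Fintype V] [Fintype E] (T : Tensors inc w D out)
    (β : (b : out) → LegIndex inc w D b.1) : ℂ :=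
  ∑ a : (e : E) → Fin (w e) → Fin D,
    if ∀ b : out, legsAt inc w D b.1 a = β b then
      ∏ x : {x : V // x ∉ out}, T x (legsAt inc w D x.1 a) else 0

variable (A : Set out)

open Classical in
/-- The boundary state as a matrix, rows for the boundary region `A`, columns for the rest. -/
def boundaryMatrix [Fintype V] [Fintype E] (T : Tensors inc w D out) :
    Matrix (BoundaryIndex inc w D out (· ∈ A)) (BoundaryIndex inc w D out (· ∉ A)) ℂ :=
  fun α α' => boundaryState inc w D out T
    fun b => if h : b ∈ A then α ⟨b, h⟩ else α' ⟨b, h⟩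

open Classical in
/-- The reduced density matrix of the normalized boundary state on the region `A`. -/
def reducedDensity [Fintype V] [Fintype E] (T : Tensors inc w D out) :
    Matrix (BoundaryIndex inc w D out (· ∈ A)) (BoundaryIndex inc w D out (· ∈ A)) ℂ :=
  ((∑ β : (b : out) → LegIndex inc w D b.1, ‖boundaryState inc w D out T β‖ ^ 2)⁻¹ : ℝ) •
    (boundaryMatrix inc w D out A T * (boundaryMatrix inc w D out A T).conjTranspose)

open Classical in
theorem reducedDensity_isHermitian [Fintype V] [Fintype E] (T : Tensors inc w D out) :
    (reducedDensity inc w D out A T).IsHermitian := by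
  unfold reducedDensity Matrix.IsHermitian
  rw [Matrix.conjTranspose_smul, Matrix.isHermitian_mul_conjTranspose_self]
  simp

open Classical in
/-- The von Neumann entropy `- tr (ρ log ρ)` of the region `A`. -/
def entropy [Fintype V] [Fintype E] (T : Tensors inc w D out) : ℝ :=
  ∑ i, Real.negMulLog ((reducedDensity_isHermitian inc w D out A T).eigenvalues i)

/-- `X` is (the inside of) a cut that separates the boundary region `A` from the rest. -/
def IsCut (X : Set V) : Prop := ∀ b : out, b.1 ∈ X ↔ b ∈ A

open Classical in
/-- The number of legs that a cut crosses. -/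
def cutLegs [Fintype E] (X : Set V) : ℕ :=
  ∑ e : E, if (∃ x ∈ X, inc x e) ∧ (∃ y ∉ X, inc y e) then w e else 0

/-- `X` is a cut for `A` that crosses as few legs as possible. -/
def IsMinCut [Fintype E] (X : Set V) : Prop :=
  IsCut out A X ∧ ∀ Y, IsCut out A Y → cutLegs inc w X ≤ cutLegs inc w Y

/-- The number of legs that a minimal cut for `A` crosses. -/
def minCutLegs [Fintype E] : ℕ := sInf {n | ∃ X : Set V, IsCut out A X ∧ cutLegs inc w X = n}

end TensorNetwork

/-! ### Random tensors -/

section Haar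

variable (n : Type) [Fintype n] [DecidableEq n]

instance : CompactSpace (Matrix.unitaryGroup n ℂ) := by
  have hK : IsCompact (Set.pi Set.univ fun _ : n => Set.pi Set.univ fun _ : n =>
      Metric.closedBall (0 : ℂ) 1) :=
    isCompact_univ_pi fun _ => isCompact_univ_pi fun _ => isCompact_closedBall 0 1
  have hc : IsCompact (Matrix.unitaryGroup n ℂ : Set (Matrix n n ℂ)) := by
    refine IsCompact.of_isClosed_subset (X := Matrix n n ℂ) hK isClosed_unitary ?_
    intro U hU i _ j _
    simpa using entry_norm_bound_of_unitary hU i j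
  exact isCompact_iff_compactSpace.mp hc

instance : MeasurableSpace (Matrix.unitaryGroup n ℂ) := borel _

instance : BorelSpace (Matrix.unitaryGroup n ℂ) := ⟨rfl⟩

/-- The Haar probability measure on the unitary group. -/
def haarUnitary : MeasureTheory.Measure (Matrix.unitaryGroup n ℂ) :=
  MeasureTheory.Measure.haarMeasure (⊤ : TopologicalSpace.PositiveCompacts _)

end Haar

section RandomTensors

variable {V E : Type} [Fintype V] [Fintype E] (inc : V → E → Prop) (w : E → ℕ) (D : ℕ) (out : Set V)

/-- One unitary for every vertex that carries a tensor. -/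
abbrev Unitaries : Type :=
  (x : {x : V // x ∉ out}) → Matrix.unitaryGroup (LegIndex inc w D x.1) ℂ

open Classical in
/-- Independent Haar random unitaries. -/
def randomLaw : MeasureTheory.Measure (Unitaries inc w D out) :=
  MeasureTheory.Measure.pi fun _ => haarUnitary _

/-- The tensors `U x |0⟩`, where `|0⟩` is the reference basis state in which all labels are zero. -/
def tensorsOf [NeZero D] (U : Unitaries inc w D out) : Tensors inc w D out :=
  fun x k => (U x).1 k fun _ _ => 0

end RandomTensors

/-! ### The chord graph and its dual -/

/-- The Euclidean plane. -/
abbrev Plane : Type := EuclideanSpace ℝ (Fin 2)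

/-- `N` distinct points on the unit circle. -/
structure BoundaryPoints (N : ℕ) where
  pt : Fin N → Plane
  norm_pt : ∀ i, ‖pt i‖ = 1
  injective : Function.Injective pt

section Geometry

variable {N : ℕ} (P : BoundaryPoints N)

/-- The chord (minimal geodesic) between two of the points. -/
def chord (i j : Fin N) : Set Plane := segment ℝ (P.pt i) (P.pt j)

/-- Vertices of the chord graph: the chosen points and the points common to two distinct chords. -/
def vertices : Set Plane :=
  Set.range P.pt ∪
    {p | ∃ i j k l, i ≠ j ∧ k ≠ l ∧ s(i, j) ≠ s(k, l) ∧ p ∈ chord P i j ∧ p ∈ chord P k l}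

/-- The planar graph formed by all chords: its edges are the pieces into which the vertices cut the
chords. -/
def chordGraph : SimpleGraph Plane where
  Adj u v := u ≠ v ∧ u ∈ vertices P ∧ v ∈ vertices P ∧
    (∃ i j, i ≠ j ∧ u ∈ chord P i j ∧ v ∈ chord P i j) ∧ ∀ p ∈ openSegment ℝ u v, p ∉ vertices P
  symm := ⟨by
    rintro u v ⟨h, hu, hv, ⟨i, j, hij, hi, hj⟩, ho⟩
    exact ⟨h.symm, hv, hu, ⟨i, j, hij, hj, hi⟩, by rwa [openSegment_symm]⟩⟩
  loopless := ⟨fun _ h => h.1 rfl⟩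

/-- The edges of the chord graph. -/
abbrev ChordEdge : Type := (chordGraph P).edgeSet

theorem not_collinear {i j k : Fin N} (hij : i ≠ j) (hki : k ≠ i) (hkj : k ≠ j) :
    ¬ Collinear ℝ {P.pt i, P.pt j, P.pt k} := by
  rw [← affineIndependent_iff_not_collinear_set]
  refine EuclideanGeometry.Cospherical.affineIndependent_of_ne ⟨0, 1, ?_⟩
    (P.injective.ne hij) (P.injective.ne hki.symm) (P.injective.ne hkj.symm)
  rintro p (rfl | rfl | rfl) <;> simp [P.norm_pt]

theorem chord_inter_subsingleton {i j k l : Fin N} (hij : i ≠ j)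
    (hki : k ≠ i) (hkj : k ≠ j) : (chord P i j ∩ chord P k l).Subsingleton := by
  rintro x ⟨hx, hx'⟩ y ⟨hy, hy'⟩
  by_contra hxy
  have hsub : ∀ {a b z : Plane}, z ∈ segment ℝ a b → z ∈ line[ℝ, a, b] := by
    intro a b z hz
    exact (mem_segment_iff_wbtw.mp hz).mem_affineSpan
  have h1 := hsub hx
  have h2 := hsub hy
  have h3 := hsub hx'
  have h4 := hsub hy'
  have hline : line[ℝ, P.pt i, P.pt j] = line[ℝ, P.pt k, P.pt l] :=
    (affineSpan_pair_eq_of_mem_of_mem_of_ne h1 h2 hxy).symm.trans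
      (affineSpan_pair_eq_of_mem_of_mem_of_ne h3 h4 hxy)
  have hk : P.pt k ∈ line[ℝ, P.pt i, P.pt j] := hline ▸ left_mem_affineSpan_pair _ _ _
  apply not_collinear P hij hki hkj
  have hc := collinear_insert_of_mem_affineSpan_pair hk
  rwa [Set.insert_comm, Set.pair_comm (P.pt k) (P.pt j)] at hc

theorem vertices_finite : (vertices P).Finite := by
  refine (Set.finite_range _).union ?_
  have hfin : (⋃ q : Fin N × Fin N × Fin N × Fin N,
      {p | q.1 ≠ q.2.1 ∧ q.2.2.1 ≠ q.1 ∧ q.2.2.1 ≠ q.2.1 ∧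
        p ∈ chord P q.1 q.2.1 ∩ chord P q.2.2.1 q.2.2.2}).Finite := by
    refine Set.finite_iUnion fun q => Set.Subsingleton.finite ?_
    rintro x ⟨h1, h2, h3, hx⟩ y ⟨_, _, _, hy⟩
    exact chord_inter_subsingleton P h1 h2 h3 hx hy
  refine hfin.subset ?_
  rintro p ⟨i, j, k, l, hij, hkl, hne, hp, hp'⟩
  rw [Set.mem_iUnion]
  by_cases hk : k ≠ i ∧ k ≠ j
  · exact ⟨(i, j, k, l), hij, hk.1, hk.2, hp, hp'⟩
  · refine ⟨(i, j, l, k), hij, ?_, ?_, hp, by rwa [chord, segment_symm]⟩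
    · intro (hl : l = i)
      apply hne
      have : k = j := by grind
      rw [this, hl, Sym2.eq_swap]
    · intro (hl : l = j)
      apply hne
      have : k = i := by grind
      rw [this, hl]

instance : Finite (ChordEdge P) := by
  refine Set.Finite.to_subtype ?_
  refine (((vertices_finite P).prod (vertices_finite P)).image fun q => s(q.1, q.2)).subset ?_
  intro e he
  induction e with
  | _ u v => exact ⟨(u, v), ⟨he.2.1, he.2.2.1⟩, rfl⟩

instance : Fintype (ChordEdge P) := Fintype.ofFinite _

/-- The Euclidean length of an edge. -/
def edgeLength (e : Sym2 Plane) : ℝ := Sym2.lift ⟨fun u v => dist u v, dist_comm⟩ e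

/-- The closed segment that an edge occupies in the plane. -/
def edgeSegment (e : Sym2 Plane) : Set Plane :=
  Sym2.lift ⟨fun u v => segment ℝ u v, segment_symm ℝ⟩ e

/-- The weight of an edge at resolution parameter `δ`: the number of legs that cross it. -/
def legs (δ : ℝ) (e : Sym2 Plane) : ℕ := ⌊edgeLength e / δ⌋₊

/-- The number of legs that a walk in the chord graph crosses. -/
def walkLegs (δ : ℝ) {u v : Plane} (p : (chordGraph P).Walk u v) : ℕ :=
  (p.edges.map (legs δ)).sum

/-- A minimal cut between `u` and `v`, as a path in the chord graph: it crosses as few legs as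
possible. -/
def IsMinWalk (δ : ℝ) {u v : Plane} (p : (chordGraph P).Walk u v) : Prop :=
  ∀ q : (chordGraph P).Walk u v, walkLegs P δ p ≤ walkLegs P δ q

/-- The least number of legs crossed by a walk in the chord graph from `u` to `v`. -/
def pathLegs (δ : ℝ) (u v : Plane) : ℕ :=
  sInf {n | ∃ p : (chordGraph P).Walk u v, walkLegs P δ p = n}

/-- The graph length `L(u, v)`: the logarithm of the dimension of a minimal cut from `u` to `v`. -/
def graphLength (δ : ℝ) (D : ℕ) (u v : Plane) : ℝ := pathLegs P δ u v * Real.log D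

/-- The number of segments into which the other chords cut the chord between two points. -/
def chordSegments (i j : Fin N) : ℕ :=
  (vertices P ∩ openSegment ℝ (P.pt i) (P.pt j)).ncard + 1

/-- The largest number of segments on a chord. -/
def maxSegments : ℕ :=
  (Finset.univ : Finset (Fin N)).offDiag.sup fun q => chordSegments P q.1 q.2

/-- The side of the directed line from the `i`-th to the `j`-th point on which `q` lies: `1` on the
left, `-1` on the right, `0` on the line. -/
def side (q : Plane) (i j : Fin N) : SignType :=
  SignType.sign ((P.pt j 0 - P.pt i 0) * (q 1 - P.pt i 1) -
    (P.pt j 1 - P.pt i 1) * (q 0 - P.pt i 0))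

/-- The open unit disk without the chords. -/
def offChords : Set Plane :=
  {q | ‖q‖ < 1 ∧ ∀ i j, i ≠ j → q ∉ chord P i j}

/-- The cells (connected components) of the open disk without the chords. Two points are in the same
cell if and only if no chord separates them, so a cell is given by the sides on which its points
lie. -/
def Cell : Type := {s : Fin N → Fin N → SignType // ∃ q ∈ offChords P, side P q = s}

open Classical in
instance : Fintype (Cell P) :=
  inferInstanceAs (Fintype {s : Fin N → Fin N → SignType // ∃ q ∈ offChords P, side P q = s})

/-- The open region of the disk that a cell occupies. -/
def region (c : Cell P) : Set Plane := {q ∈ offChords P | side P q = c.1}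

/-- The cells that reach the unit circle along an arc between two of the points; the boundary legs of
the network end there. All other cells carry a tensor. -/
def outerCells : Set (Cell P) :=
  {c | ∃ q ∈ closure (region P c), ‖q‖ = 1 ∧ q ∉ Set.range P.pt}

/-- In the dual graph, an edge of the chord graph joins the two cells on its two sides. -/
def incident (c : Cell P) (e : ChordEdge P) : Prop := edgeSegment e.1 ⊆ closure (region P c)

/-- The number of legs on an edge of the network. -/
def netLegs (δ : ℝ) (e : ChordEdge P) : ℕ := legs δ e.1

/-- The boundary interval from the `i`-th to the `j`-th point, as the set of boundary legs to the left
of the chord from `i` to `j`. -/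
def interval (i j : Fin N) : Set (outerCells P) := {c | c.1.1 i j = 1}

/-- The number of legs in a minimal cut of the network for the boundary region `A`. -/
def netMinCut (δ : ℝ) (A : Set (outerCells P)) : ℕ :=
  minCutLegs (incident P) (netLegs P δ) (outerCells P) A

/-- The minimal cut of the network for the boundary region `A` is unique. -/
def HasUniqueMinCut (δ : ℝ) (A : Set (outerCells P)) : Prop :=
  ∃! X, IsMinCut (incident P) (netLegs P δ) (outerCells P) A X

/-- The unitaries that define the tensors of the network. -/
abbrev NetUnitaries (δ : ℝ) (D : ℕ) : Type :=
  Unitaries (incident P) (netLegs P δ) D (outerCells P)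

/-- The law of independent Haar random unitaries at the vertices of the network. -/
def netLaw (δ : ℝ) (D : ℕ) : MeasureTheory.Measure (NetUnitaries P δ D) :=
  randomLaw (incident P) (netLegs P δ) D (outerCells P)

/-- The entropy of the boundary region `A` in the network with the tensors given by `U`. -/
def netEntropy (δ : ℝ) (D : ℕ) [NeZero D] (A : Set (outerCells P)) (U : NetUnitaries P δ D) : ℝ :=
  entropy (incident P) (netLegs P δ) D (outerCells P) A
    (tensorsOf (incident P) (netLegs P δ) D (outerCells P) U)

end Geometry

end FlatNetwork

end

/-! A vertex inside the chord from P_i to P_j lies on a chord that joins a point on its left to a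
point on its right. With a points on one side and b on the other there are at most ab such vertices,
and a + b ≤ N - 2 (`openSegment_vertices_ncard_le`).

Minimal cuts are minimal walks by planar duality, obtained without the Jordan curve theorem. Given a
cut, the crossed edges at a vertex are counted modulo two by turning around it (`half_parity`):
their number is odd at P_i and even at every vertex other than P_i and P_j, so by the handshake
lemma the crossed edges connect P_i to P_j (`cutGraph_reachable`). Given a walk, take the angle that
it describes as seen from a point q of the disk, minus a continuous branch of the angle between its
end points. This is an odd multiple of π, hence constant on connected sets off the walk, and on the
circle it is π or -π according to the side of the chord. The cells with value π form a cut that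
crosses only edges of the walk (`exists_cut_of_walk`).

Rounding down loses less than δ per edge. The walk along the chord bounds the weight of a minimal
walk from above, the triangle inequality bounds it from below, and the two differ by at most kδ.
There are finitely many sets of edges, so a total length that exceeds the distance of two vertices
exceeds it by some fixed g > 0. Once δ times the number of edges plus one is at most g, a minimal
walk is as short as the distance and runs along the chord (`IsFine.walkLength_eq`). A minimal cut
then crosses only edges on the chord; cells on the same side of it are joined through edges of the
other chords (`mem_iff_mem_of_same_side`), so the cut is one side of the chord.

For random tensors, the entropy lies between minus the logarithm of the normalized purity and the
logarithm of the rank, and the rank is at most D^γ for a minimal cut of γ legs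
(`rank_boundaryMatrix_le`). The fourth moments of a Haar column are a sum over two ways of pairing
indices (`moment4_eq`). Averaging therefore turns the purity into a sum over assignments of a
pairing to each vertex, that is over cuts for A, and a cut with c legs contributes at most n²
D^(-c), where n is the mean norm (`integral_purityM_le`). For A = ∅ the purity is the squared norm,
so the same estimate gives a variance of order n²/D. Chebyshev and Markov give a bounded deviation.
If the minimal cut is unique, the mean purity is at most n² D^(-γ) (1 + K/D); since the squared norm
never exceeds D^γ times the purity, the excess is small in probability.

One obstruction remains: legs may have weight zero, and a part of the network without legs to the
rest has a norm that need not concentrate. Such a part only contributes a scalar factor, which is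
almost surely non-zero (`ae_closedFactor_mixedTensors_ne_zero`). Its tensors are replaced by basis
states, which leaves the reduced density matrix unchanged. -/

noncomputable section

namespace FlatNetwork

open Filter Topology

section

/-! ### Lines, chords and the disk -/

/-- The cross product of two vectors of the plane. -/
def cr (a b : Plane) : ℝ := a 0 * b 1 - a 1 * b 0

theorem cr_self (a : Plane) : cr a a = 0 := by simp [cr]; ring

theorem cr_zero_left (a : Plane) : cr 0 a = 0 := by simp [cr]

theorem cr_add_right (a b c : Plane) : cr a (b + c) = cr a b + cr a c := by simp [cr]; ring

theorem cr_smul_right (a b : Plane) (t : ℝ) : cr a (t • b) = t * cr a b := by simp [cr]; ring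

theorem cr_neg_right (a b : Plane) : cr a (-b) = -cr a b := by simp [cr]; ring

theorem plane_norm_sq (q : Plane) : ‖q‖ ^ 2 = q 0 ^ 2 + q 1 ^ 2 := by
  rw [EuclideanSpace.real_norm_sq_eq, Fin.sum_univ_two]

theorem plane_ext {a b : Plane} (h0 : a 0 = b 0) (h1 : a 1 = b 1) : a = b := by
  ext i; fin_cases i <;> assumption

theorem plane_norm_le_one {q : Plane} : ‖q‖ ≤ 1 ↔ q 0 ^ 2 + q 1 ^ 2 ≤ 1 := by
  rw [← plane_norm_sq, sq_le_one_iff₀ (norm_nonneg q)]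

theorem plane_norm_lt_one {q : Plane} : ‖q‖ < 1 ↔ q 0 ^ 2 + q 1 ^ 2 < 1 := by
  rw [← plane_norm_sq, sq_lt_one_iff₀ (norm_nonneg q)]

theorem plane_norm_eq_one {q : Plane} : ‖q‖ = 1 ↔ q 0 ^ 2 + q 1 ^ 2 = 1 := by
  rw [← plane_norm_sq, pow_eq_one_iff_of_nonneg (norm_nonneg q) two_ne_zero]

variable {N : ℕ} (P : BoundaryPoints N)

/-- The affine function that vanishes on the line through two of the points and is positive on its
left. -/
def lf (i j : Fin N) (q : Plane) : ℝ := cr (P.pt j - P.pt i) (q - P.pt i)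

theorem side_eq (q : Plane) (i j : Fin N) : side P q i j = SignType.sign (lf P i j q) := rfl

theorem lf_add_smul (i j : Fin N) (v d : Plane) (t : ℝ) :
    lf P i j (v + t • d) = lf P i j v + t * cr (P.pt j - P.pt i) d := by
  simp [lf, cr]; ring

theorem lf_sub (i j : Fin N) (u v : Plane) :
    lf P i j u - lf P i j v = cr (P.pt j - P.pt i) (u - v) := by
  simp [lf, cr]; ring

theorem lf_combo (i j : Fin N) (u v : Plane) {a b : ℝ} (h : a + b = 1) :
    lf P i j (a • u + b • v) = a * lf P i j u + b * lf P i j v := by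
  obtain rfl : a = 1 - b := by linarith
  simp [lf, cr]; ring

theorem lf_lineMap (i j : Fin N) (u v : Plane) (t : ℝ) :
    lf P i j (u + t • (v - u)) = (1 - t) * lf P i j u + t * lf P i j v := by
  simp [lf, cr]; ring

theorem lf_swap (i j : Fin N) (q : Plane) : lf P j i q = -lf P i j q := by
  simp [lf, cr]; ring

theorem lf_left (i j : Fin N) : lf P i j (P.pt i) = 0 := by simp [lf, cr]

theorem lf_right (i j : Fin N) : lf P i j (P.pt j) = 0 := by simp [lf, cr]; ring

theorem lf_self (i : Fin N) (q : Plane) : lf P i i q = 0 := by simp [lf, cr]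

theorem lf_continuous (i j : Fin N) : Continuous (lf P i j) := by
  unfold lf cr; fun_prop

theorem pt_sq (i : Fin N) : P.pt i 0 ^ 2 + P.pt i 1 ^ 2 = 1 :=
  plane_norm_eq_one.1 (P.norm_pt i)

theorem mem_chord {i j : Fin N} {q : Plane} :
    q ∈ chord P i j ↔ ∃ t : ℝ, 0 ≤ t ∧ t ≤ 1 ∧ q = P.pt i + t • (P.pt j - P.pt i) := by
  rw [chord, segment_eq_image']
  constructor
  · rintro ⟨t, ht, rfl⟩; exact ⟨t, ht.1, ht.2, rfl⟩
  · rintro ⟨t, h0, h1, rfl⟩; exact ⟨t, ⟨h0, h1⟩, rfl⟩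

theorem chord_swap (i j : Fin N) : chord P i j = chord P j i := segment_symm ℝ _ _

theorem lf_eq_zero_of_mem_chord {i j : Fin N} {q : Plane} (h : q ∈ chord P i j) :
    lf P i j q = 0 := by
  obtain ⟨t, -, -, rfl⟩ := (mem_chord P).1 h
  rw [lf_add_smul, lf_left, cr_self]; ring

theorem eq_smul_of_cr_eq_zero {a b : Plane} (ha : a ≠ 0) (h : cr a b = 0) :
    ∃ t : ℝ, b = t • a := by
  have hpos : 0 < a 0 ^ 2 + a 1 ^ 2 := by
    rw [← plane_norm_sq]; have := norm_pos_iff.2 ha; positivity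
  refine ⟨(a 0 * b 0 + a 1 * b 1) / (a 0 ^ 2 + a 1 ^ 2), ?_⟩
  simp only [cr] at h
  apply plane_ext
  · simp; field_simp; linear_combination (-a 1) * h
  · simp; field_simp; linear_combination (a 0) * h

theorem line_param {i j : Fin N} (hij : i ≠ j) {q : Plane} (h : lf P i j q = 0) :
    ∃ t : ℝ, q = P.pt i + t • (P.pt j - P.pt i) := by
  obtain ⟨t, ht⟩ := eq_smul_of_cr_eq_zero (sub_ne_zero.2 (P.injective.ne hij.symm)) h
  exact ⟨t, by rw [← ht]; abel⟩

/-- The sign of `t * (t - 1)` decides whether a point of the line is in the closed disk, so inside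
the disk the line is exactly the chord. -/
theorem line_norm_sq (i j : Fin N) (t : ℝ) :
    ‖P.pt i + t • (P.pt j - P.pt i)‖ ^ 2 = 1 + t * (t - 1) * ‖P.pt j - P.pt i‖ ^ 2 := by
  rw [plane_norm_sq, plane_norm_sq]
  have h1 := pt_sq P i
  have h2 := pt_sq P j
  simp
  linear_combination (1 - t) * h1 + t * h2

theorem chord_len_pos {i j : Fin N} (hij : i ≠ j) : 0 < ‖P.pt j - P.pt i‖ ^ 2 := by
  have := norm_pos_iff.2 (sub_ne_zero.2 (P.injective.ne hij.symm)); positivity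

/-- This replaces membership in chords by linear equations, and later the sides of chords by linear
inequalities. -/
theorem mem_chord_iff {i j : Fin N} (hij : i ≠ j) {q : Plane} (hq : ‖q‖ ≤ 1) :
    q ∈ chord P i j ↔ lf P i j q = 0 := by
  refine ⟨lf_eq_zero_of_mem_chord P, fun h => ?_⟩
  obtain ⟨t, rfl⟩ := line_param P hij h
  have h2 : ‖P.pt i + t • (P.pt j - P.pt i)‖ ^ 2 ≤ 1 := by
    rwa [sq_le_one_iff₀ (norm_nonneg _)]
  rw [line_norm_sq] at h2
  have h3 : t * (t - 1) ≤ 0 := by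
    by_contra! h4
    have := mul_pos h4 (chord_len_pos P hij); linarith
  refine (mem_chord P).2 ⟨t, by nlinarith, by nlinarith, rfl⟩

theorem norm_le_one_of_mem_chord {i j : Fin N} {q : Plane} (h : q ∈ chord P i j) : ‖q‖ ≤ 1 := by
  obtain ⟨t, h0, h1, rfl⟩ := (mem_chord P).1 h
  rw [← sq_le_one_iff₀ (norm_nonneg _), line_norm_sq]
  have : 0 ≤ t * (1 - t) * ‖P.pt j - P.pt i‖ ^ 2 := by
    have : 0 ≤ 1 - t := by linarith
    positivity
  linarith

theorem eq_pt_of_mem_chord {i j : Fin N} {q : Plane} (h : q ∈ chord P i j) (hq : ‖q‖ = 1) :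
    q = P.pt i ∨ q = P.pt j := by
  by_cases hij : i = j
  · subst hij; simpa [chord] using h
  obtain ⟨t, h0, h1, rfl⟩ := (mem_chord P).1 h
  have h2 := line_norm_sq P i j t
  rw [hq] at h2
  have h3 := chord_len_pos P hij
  have h4 : t * (t - 1) = 0 := by
    have : t * (t - 1) * ‖P.pt j - P.pt i‖ ^ 2 = 0 := by linarith
    rcases mul_eq_zero.1 this with h | h
    · exact h
    · exact absurd h h3.ne'
  rcases mul_eq_zero.1 h4 with h | h
  · left; simp [h]
  · right; rw [sub_eq_zero.1 h]; simp

theorem lf_pt_ne {i j k : Fin N} (hij : i ≠ j) (hki : k ≠ i) (hkj : k ≠ j) :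
    lf P i j (P.pt k) ≠ 0 := by
  intro h
  rcases eq_pt_of_mem_chord P ((mem_chord_iff P hij (P.norm_pt k).le).2 h) (P.norm_pt k) with h | h
  · exact hki (P.injective h)
  · exact hkj (P.injective h)

theorem openSegment_norm_lt {u v x : Plane} (huv : u ≠ v) (hu : ‖u‖ ≤ 1) (hv : ‖v‖ ≤ 1)
    (hx : x ∈ openSegment ℝ u v) : ‖x‖ < 1 := by
  have := openSegment_subset_ball_of_ne (x := u) (y := v) (z := (0 : Plane)) (r := 1)
    (by simpa using hu) (by simpa using hv) huv hx
  simpa using this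

theorem pt_mem_vertices (i : Fin N) : P.pt i ∈ vertices P := Or.inl ⟨i, rfl⟩

theorem pt_mem_chord_left (i j : Fin N) : P.pt i ∈ chord P i j := left_mem_segment _ _ _

theorem pt_mem_chord_right (i j : Fin N) : P.pt j ∈ chord P i j := right_mem_segment _ _ _

theorem vertex_norm_le {v : Plane} (h : v ∈ vertices P) : ‖v‖ ≤ 1 := by
  rcases h with ⟨i, rfl⟩ | ⟨i, j, k, l, -, -, -, h, -⟩
  · exact (P.norm_pt i).le
  · exact norm_le_one_of_mem_chord P h

theorem vertex_eq_pt {v : Plane} (h : v ∈ vertices P) (hv : ‖v‖ = 1) : ∃ k, v = P.pt k := by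
  rcases h with ⟨i, rfl⟩ | ⟨i, j, k, l, -, -, -, h, -⟩
  · exact ⟨i, rfl⟩
  · rcases eq_pt_of_mem_chord P h hv with h | h
    exacts [⟨_, h⟩, ⟨_, h⟩]

theorem mem_vertices_of_lf {i j k l : Fin N} (hij : i ≠ j) (hkl : k ≠ l) (hne : s(i, j) ≠ s(k, l))
    {v : Plane} (hv : ‖v‖ ≤ 1) (h1 : lf P i j v = 0) (h2 : lf P k l v = 0) : v ∈ vertices P :=
  Or.inr ⟨i, j, k, l, hij, hkl, hne, (mem_chord_iff P hij hv).2 h1, (mem_chord_iff P hkl hv).2 h2⟩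

theorem lf_of_sym2_eq {i j k l : Fin N} (h : s(i, j) = s(k, l)) (q : Plane) :
    (i = k ∧ j = l ∧ lf P i j q = lf P k l q) ∨ (i = l ∧ j = k ∧ lf P i j q = -lf P k l q) := by
  rcases Sym2.eq_iff.1 h with ⟨rfl, rfl⟩ | ⟨rfl, rfl⟩
  · exact Or.inl ⟨rfl, rfl, rfl⟩
  · exact Or.inr ⟨rfl, rfl, lf_swap P _ _ q⟩

/-- Two different points lie on at most one of the lines. -/
theorem sym2_eq_of_lf {i j k l : Fin N} (hij : i ≠ j) (hkl : k ≠ l) {u v : Plane} (huv : u ≠ v)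
    (hu1 : lf P i j u = 0) (hv1 : lf P i j v = 0) (hu2 : lf P k l u = 0) (hv2 : lf P k l v = 0) :
    s(i, j) = s(k, l) := by
  obtain ⟨s, hs⟩ := line_param P hkl hu2
  obtain ⟨t, ht⟩ := line_param P hkl hv2
  have hst : s ≠ t := by rintro rfl; exact huv (hs.trans ht.symm)
  rw [hs, lf_add_smul] at hu1
  rw [ht, lf_add_smul] at hv1
  -- Two common points make the lines parallel, hence equal; a line contains at most two of the
  -- points on the circle.
  have h1 : cr (P.pt j - P.pt i) (P.pt l - P.pt k) = 0 := by
    have h : (s - t) * cr (P.pt j - P.pt i) (P.pt l - P.pt k) = 0 := by linarith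
    exact (mul_eq_zero.1 h).resolve_left (sub_ne_zero.2 hst)
  have h2 : lf P i j (P.pt k) = 0 := by rw [h1] at hu1; linarith
  have h3 : lf P i j (P.pt l) = 0 := by
    have := lf_sub P i j (P.pt l) (P.pt k); rw [h1] at this; linarith
  have hk : k = i ∨ k = j := by
    by_contra! h; exact lf_pt_ne P hij h.1 h.2 h2
  have hl : l = i ∨ l = j := by
    by_contra! h; exact lf_pt_ne P hij h.1 h.2 h3
  rcases hk with rfl | rfl <;> rcases hl with rfl | rfl
  · exact absurd rfl hkl
  · rfl
  · exact Sym2.eq_swap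
  · exact absurd rfl hkl

/-- A line that separates two points strictly meets the open segment between them. -/
theorem exists_lf_eq_zero {i j : Fin N} {u v : Plane} (h : lf P i j u * lf P i j v < 0) :
    ∃ x ∈ openSegment ℝ u v, lf P i j x = 0 := by
  have hne : lf P i j u - lf P i j v ≠ 0 := by
    intro h0; rw [sub_eq_zero.1 h0] at h; nlinarith [mul_self_nonneg (lf P i j v)]
  have key : ∀ a b : ℝ, a * b < 0 → a - b ≠ 0 → 0 < a / (a - b) ∧ 0 < -b / (a - b) := by
    intro a b hab h0
    rcases lt_or_gt_of_ne h0 with h1 | h1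
    · have : a < 0 := by
        by_contra! h2; nlinarith
      have : 0 < b := by
        by_contra! h2; nlinarith
      exact ⟨div_pos_of_neg_of_neg ‹_› h1, div_pos_of_neg_of_neg (by linarith) h1⟩
    · have : 0 < a := by
        by_contra! h2; nlinarith
      have : b < 0 := by
        by_contra! h2; nlinarith
      exact ⟨div_pos ‹_› h1, div_pos (by linarith) h1⟩
  obtain ⟨h1, h2⟩ := key _ _ h hne
  have hsum : -lf P i j v / (lf P i j u - lf P i j v) + lf P i j u / (lf P i j u - lf P i j v) = 1 := by
    field_simp; ring
  refine ⟨_, ⟨_, _, h2, h1, hsum, rfl⟩, ?_⟩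
  rw [lf_combo P i j u v hsum]
  field_simp; ring

/-- The first point of a finite set that one meets on the way from `x` to `y`. -/
theorem exists_nearest {V : Set Plane} (hV : V.Finite) {x y : Plane} (hy : y ∈ V) (hxy : x ≠ y) :
    ∃ t : ℝ, 0 < t ∧ t ≤ 1 ∧ x + t • (y - x) ∈ V ∧
      ∀ p ∈ openSegment ℝ x (x + t • (y - x)), p ∉ V := by
  have hfin : {t : ℝ | 0 < t ∧ t ≤ 1 ∧ x + t • (y - x) ∈ V}.Finite := by
    refine Set.Finite.subset (hV.preimage (f := fun t : ℝ => x + t • (y - x)) ?_)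
      (fun t ht => ht.2.2)
    intro a _ b _ hab
    have h1 : (a - b) • (y - x) = 0 := by
      rw [sub_smul, sub_eq_zero]; exact add_left_cancel hab
    rcases smul_eq_zero.1 h1 with h | h
    · exact sub_eq_zero.1 h
    · exact absurd (sub_eq_zero.1 h).symm hxy
  -- The least admissible parameter; `t = 1` is admissible because `y` itself belongs to `V`.
  obtain ⟨t, ⟨h0, h1, h2⟩, hmin⟩ := hfin.exists_minimal ⟨1, one_pos, le_rfl, by simpa using hy⟩
  refine ⟨t, h0, h1, h2, ?_⟩
  intro p hp hpV
  rw [openSegment_eq_image'] at hp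
  obtain ⟨s, ⟨hs0, hs1⟩, rfl⟩ := hp
  have h3 : x + s • (x + t • (y - x) - x) = x + (s * t) • (y - x) := by
    rw [add_sub_cancel_left, smul_smul]
  simp only [h3] at hpV
  have hlt : s * t < t := by nlinarith
  have h4 := hmin (y := s * t) ⟨by positivity, by linarith, hpV⟩ hlt.le
  exact absurd h4 (not_le.2 hlt)

end

section

/-! ### Lengths of walks in the chord graph -/

variable {N : ℕ} (P : BoundaryPoints N)

/-- The Euclidean length of a walk. -/
def walkLength {u v : Plane} (p : (chordGraph P).Walk u v) : ℝ := (p.edges.map edgeLength).sum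

theorem edgeLength_mk (u v : Plane) : edgeLength s(u, v) = dist u v := rfl

theorem edgeLength_nonneg (e : Sym2 Plane) : 0 ≤ edgeLength e := by
  induction e with | _ u v => exact (dist_nonneg : 0 ≤ dist u v)

theorem dist_le_walkLength {u v : Plane} (p : (chordGraph P).Walk u v) :
    dist u v ≤ walkLength P p := by
  induction p with
  | nil => simp [walkLength]
  | @cons u w v h p ih =>
    have : walkLength P (.cons h p) = dist u w + walkLength P p := by
      simp [walkLength, edgeLength_mk]
    rw [this]
    linarith [dist_triangle u w v]

theorem legs_mul_le {δ : ℝ} (hδ : 0 < δ) (e : Sym2 Plane) : δ * legs δ e ≤ edgeLength e := by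
  have := Nat.floor_le (div_nonneg (edgeLength_nonneg e) hδ.le)
  rw [le_div_iff₀ hδ] at this
  rw [mul_comm]; exact this

theorem lt_legs_mul {δ : ℝ} (hδ : 0 < δ) (e : Sym2 Plane) : edgeLength e < δ * legs δ e + δ := by
  have := Nat.lt_floor_add_one (edgeLength e / δ)
  rw [div_lt_iff₀ hδ] at this
  have h2 : (legs δ e : ℝ) = ⌊edgeLength e / δ⌋₊ := rfl
  rw [h2]; linarith

theorem walkLegs_mul_le {δ : ℝ} (hδ : 0 < δ) {u v : Plane} (p : (chordGraph P).Walk u v) :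
    δ * walkLegs P δ p ≤ walkLength P p := by
  unfold walkLegs walkLength
  induction p.edges with
  | nil => simp
  | cons e l ih =>
    rw [List.map_cons, List.map_cons, List.sum_cons, List.sum_cons, Nat.cast_add]
    linarith [legs_mul_le hδ e]

theorem walkLength_le {δ : ℝ} (hδ : 0 < δ) {u v : Plane} (p : (chordGraph P).Walk u v) :
    walkLength P p ≤ δ * walkLegs P δ p + p.length * δ := by
  rw [← SimpleGraph.Walk.length_edges]
  unfold walkLegs walkLength
  induction p.edges with
  | nil => simp
  | cons e l ih =>
    rw [List.map_cons, List.map_cons, List.sum_cons, List.sum_cons, List.length_cons, Nat.cast_add,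
      Nat.cast_succ]
    linarith [lt_legs_mul hδ e]

theorem mem_chord_lineMap {i j : Fin N} {u v : Plane} (hu : u ∈ chord P i j) (hv : v ∈ chord P i j)
    {t : ℝ} (h0 : 0 ≤ t) (h1 : t ≤ 1) : u + t • (v - u) ∈ chord P i j := by
  apply (convex_segment _ _).segment_subset hu hv
  rw [segment_eq_image']
  exact ⟨t, ⟨h0, h1⟩, rfl⟩

/-- Any two vertices on a chord are joined by a walk along the chord. -/
theorem exists_straight_walk {i j : Fin N} (hij : i ≠ j) {u v : Plane}
    (hu : u ∈ vertices P ∩ chord P i j) (hv : v ∈ vertices P ∩ chord P i j) :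
    ∃ p : (chordGraph P).Walk u v, walkLength P p = dist u v := by
  -- The first edge goes to the vertex nearest to `u` on the way to `v`; that vertex leaves the open
  -- segment, so the number of vertices in between drops.
  induction hn : (vertices P ∩ openSegment ℝ u v).ncard using Nat.strong_induction_on
    generalizing u with
  | _ n ih =>
    by_cases huv : u = v
    · subst huv; exact ⟨.nil, by simp [walkLength]⟩
    obtain ⟨t, h0, h1, hw, hno⟩ := exists_nearest (vertices_finite P) hv.1 huv
    set w := u + t • (v - u) with hwdef
    have hwc : w ∈ chord P i j := mem_chord_lineMap P hu.2 hv.2 h0.le h1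
    have huw : u ≠ w := by
      intro h
      have : t • (v - u) = 0 := by rw [hwdef] at h; simpa using h.symm
      rcases smul_eq_zero.1 this with h | h
      · exact h0.ne' h
      · exact huv (sub_eq_zero.1 h).symm
    have hadj : (chordGraph P).Adj u w := ⟨huw, hu.1, hw, ⟨i, j, hij, hu.2, hwc⟩, hno⟩
    rcases h1.eq_or_lt with h1 | h1
    · have hwv : w = v := by rw [hwdef, h1]; simp
      rw [hwv] at hadj
      exact ⟨.cons hadj .nil, by simp [walkLength, edgeLength_mk]⟩
    have hwo : w ∈ openSegment ℝ u v := by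
      rw [openSegment_eq_image']; exact ⟨t, ⟨h0, h1⟩, rfl⟩
    have hsub : openSegment ℝ w v ⊆ openSegment ℝ u v := by
      rw [openSegment_eq_image', openSegment_eq_image']
      rintro _ ⟨s, ⟨hs0, hs1⟩, rfl⟩
      refine ⟨t + s * (1 - t), ⟨by nlinarith, by nlinarith⟩, ?_⟩
      simp only [hwdef]
      module
    have hwn : w ∉ openSegment ℝ w v := by
      intro h
      have : w = v := by
        rw [openSegment_eq_image'] at h
        obtain ⟨s, ⟨hs0, hs1⟩, h⟩ := h
        have h : s • (v - w) = 0 := by simpa using h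
        rcases smul_eq_zero.1 h with h | h
        · exact absurd h hs0.ne'
        · exact (sub_eq_zero.1 h).symm
      have h2 : (1 - t) • (v - u) = 0 := by
        have : v - w = 0 := sub_eq_zero.2 this.symm
        rw [← this, hwdef]; module
      rcases smul_eq_zero.1 h2 with h | h
      · linarith
      · exact huv (sub_eq_zero.1 h).symm
    have hlt : (vertices P ∩ openSegment ℝ w v).ncard < n := by
      rw [← hn]
      refine Set.ncard_lt_ncard ⟨fun x hx => ⟨hx.1, hsub hx.2⟩, fun h => hwn (h ⟨hw, hwo⟩).2⟩
        ((vertices_finite P).subset Set.inter_subset_left)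
    obtain ⟨p, hp⟩ := ih _ hlt (u := w) ⟨hw, hwc⟩ rfl
    refine ⟨.cons hadj p, ?_⟩
    have h2 : walkLength P (.cons hadj p) = dist u w + walkLength P p := by
      simp [walkLength, edgeLength_mk]
    rw [h2, hp]
    have h3 : dist u w = t * dist u v := by
      rw [dist_eq_norm, dist_eq_norm, hwdef, show u - (u + t • (v - u)) = t • (u - v) by module,
        norm_smul, Real.norm_of_nonneg h0.le]
    have h4 : dist w v = (1 - t) * dist u v := by
      rw [dist_eq_norm, dist_eq_norm, hwdef, show u + t • (v - u) - v = (1 - t) • (u - v) by module,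
        norm_smul, Real.norm_of_nonneg (by linarith)]
    rw [h3, h4]; ring

theorem pathLegs_eq {δ : ℝ} {u v : Plane} {p : (chordGraph P).Walk u v} (hp : IsMinWalk P δ p) :
    pathLegs P δ u v = walkLegs P δ p := by
  apply le_antisymm
  · exact Nat.sInf_le ⟨p, rfl⟩
  · refine le_csInf ⟨_, p, rfl⟩ ?_
    rintro n ⟨q, rfl⟩
    exact hp q

theorem exists_isMinWalk (δ : ℝ) {u v : Plane} (p : (chordGraph P).Walk u v) :
    ∃ q : (chordGraph P).Walk u v, IsMinWalk P δ q := by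
  obtain ⟨q, hq⟩ := Nat.sInf_mem (s := {n | ∃ p : (chordGraph P).Walk u v, walkLegs P δ p = n})
    ⟨_, p, rfl⟩
  exact ⟨q, fun r => hq ▸ Nat.sInf_le ⟨r, rfl⟩⟩

/-- The walk along the chord competes with `p`, and its legs cannot exceed its length divided by
`δ`. -/
theorem minWalk_legs_le {i j : Fin N} (hij : i ≠ j) {δ : ℝ} (hδ : 0 < δ) {u v : Plane}
    (hu : u ∈ vertices P ∩ chord P i j) (hv : v ∈ vertices P ∩ chord P i j)
    {p : (chordGraph P).Walk u v} (hp : IsMinWalk P δ p) : δ * walkLegs P δ p ≤ dist u v := by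
  obtain ⟨q, hq⟩ := exists_straight_walk P hij hu hv
  rw [← hq]
  refine le_trans ?_ (walkLegs_mul_le P hδ q)
  have : (walkLegs P δ p : ℝ) ≤ walkLegs P δ q := by exact_mod_cast hp q
  exact mul_le_mul_of_nonneg_left this hδ.le

/-- The comparison with the straight walk gives one inequality. The other is the triangle inequality
along `p`, whose length exceeds `δ` times its legs by at most `δ` per edge. -/
theorem abs_dist_sub_graphLength_le {i j : Fin N} (hij : i ≠ j) {δ : ℝ} (hδ : 0 < δ) {D : ℕ}
    (hD : 2 ≤ D) {u v : Plane} (hu : u ∈ vertices P ∩ chord P i j)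
    (hv : v ∈ vertices P ∩ chord P i j) {p : (chordGraph P).Walk u v} (hp : IsMinWalk P δ p) :
    |dist u v - δ / Real.log D * graphLength P δ D u v| ≤ p.length * δ := by
  have hlog : Real.log D ≠ 0 := by
    have : (1 : ℝ) < D := by exact_mod_cast hD
    exact (Real.log_pos this).ne'
  have h1 : δ / Real.log D * graphLength P δ D u v = δ * walkLegs P δ p := by
    rw [graphLength, pathLegs_eq P hp]; field_simp
  have h2 := minWalk_legs_le P hij hδ hu hv hp
  have h3 := (dist_le_walkLength P p).trans (walkLength_le P hδ p)
  rw [h1, abs_le]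
  constructor <;> linarith [mul_nonneg (Nat.cast_nonneg (α := ℝ) p.length) hδ.le]

/-! ### The number of segments on a chord -/

/-- Another chord through an inner point of this one has its ends strictly on opposite sides. Each
pair of one left and one right point accounts for at most one vertex, and the product of two numbers
with sum at most N - 2 is at most ((N - 2)/2)². -/
theorem openSegment_vertices_ncard_le {i j : Fin N} (hij : i ≠ j) :
    ((vertices P ∩ openSegment ℝ (P.pt i) (P.pt j)).ncard : ℝ) ≤ (((N : ℝ) - 2) / 2) ^ 2 := by
  classical
  set A : Finset (Fin N) := {k | 0 < lf P i j (P.pt k)} with hA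
  set B : Finset (Fin N) := {k | lf P i j (P.pt k) < 0} with hB
  have hAB : Disjoint A B := by
    rw [Finset.disjoint_left]; intro k; simp [hA, hB]; intro h; exact h.le
  have hcard : A.card + B.card + 2 ≤ N := by
    have hd : Disjoint (A ∪ B) {i, j} := by
      rw [Finset.disjoint_left]; intro k hk hk'
      simp only [Finset.mem_insert, Finset.mem_singleton] at hk'
      rcases hk' with rfl | rfl <;> simp [hA, hB, lf_left, lf_right] at hk
    have := Finset.card_le_univ ((A ∪ B) ∪ {i, j})
    rw [Finset.card_union_of_disjoint hd, Finset.card_union_of_disjoint hAB,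
      Finset.card_pair hij, Fintype.card_fin] at this
    exact this
  have hfin : ∀ q : Fin N × Fin N, q ∈ A ×ˢ B →
      (chord P i j ∩ chord P q.1 q.2).Subsingleton := by
    intro q hq
    refine chord_inter_subsingleton P hij ?_ ?_
    · intro h; rw [Finset.mem_product] at hq; simp [hA, h, lf_left] at hq
    · intro h; rw [Finset.mem_product] at hq; simp [hA, h, lf_right] at hq
  have hcov : ∀ p ∈ vertices P ∩ openSegment ℝ (P.pt i) (P.pt j),
      ∃ q ∈ A ×ˢ B, p ∈ chord P i j ∩ chord P q.1 q.2 := by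
    rintro p ⟨hp, ho⟩
    have hpij : p ∈ chord P i j := openSegment_subset_segment _ _ _ ho
    have hlt := openSegment_norm_lt (P.injective.ne hij) (P.norm_pt i).le (P.norm_pt j).le ho
    have hkl : ∃ k l, k ≠ l ∧ s(i, j) ≠ s(k, l) ∧ p ∈ chord P k l := by
      rcases hp with ⟨k, rfl⟩ | ⟨a, b, c, d, hab, hcd, hne, h1, h2⟩
      · rw [P.norm_pt] at hlt; exact absurd hlt (lt_irrefl _)
      · by_cases h : s(i, j) = s(a, b)
        · exact ⟨c, d, hcd, h ▸ hne, h2⟩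
        · exact ⟨a, b, hab, h, h1⟩
    obtain ⟨k, l, hkl, hne, hpk⟩ := hkl
    obtain ⟨a, b, ha, hb, hab, rfl⟩ := hpk
    have h0 := lf_eq_zero_of_mem_chord P hpij
    rw [lf_combo P i j _ _ hab] at h0
    have hnz : lf P i j (P.pt k) ≠ 0 ∨ lf P i j (P.pt l) ≠ 0 := by
      by_contra! h
      exact hne (sym2_eq_of_lf P hij hkl (P.injective.ne hkl) h.1 h.2 (lf_left P k l)
        (lf_right P k l))
    -- The vertex is strictly inside the disk, so it is no end of the other chord and both weights
    -- are positive; a vanishing combination then forces opposite signs.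
    have ha' : a ≠ 0 := by
      rintro rfl
      have : b = 1 := by linarith
      subst this
      simp [P.norm_pt] at hlt
    have hb' : b ≠ 0 := by
      rintro rfl
      have : a = 1 := by linarith
      subst this
      simp [P.norm_pt] at hlt
    have ha1 := lt_of_le_of_ne ha ha'.symm
    have hb1 := lt_of_le_of_ne hb hb'.symm
    rcases lt_trichotomy (lf P i j (P.pt k)) 0 with h | h | h
    · have h2 : 0 < lf P i j (P.pt l) := by
        by_contra! h3; nlinarith
      refine ⟨(l, k), by simp [hA, hB, h, h2], hpij, ?_⟩
      rw [chord_swap]; exact ⟨a, b, ha, hb, hab, rfl⟩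
    · rw [h, mul_zero, zero_add, mul_eq_zero] at h0
      rcases hnz with h1 | h1
      · exact absurd h h1
      · rcases h0 with h0 | h0
        exacts [absurd h0 hb', absurd h0 h1]
    · have h2 : lf P i j (P.pt l) < 0 := by
        by_contra! h3; nlinarith
      exact ⟨(k, l), by simp [hA, hB, h, h2], hpij, a, b, ha, hb, hab, rfl⟩
  have : Nonempty (Fin N × Fin N) := ⟨(i, j)⟩
  choose! g hg1 hg2 using hcov
  have hle : (vertices P ∩ openSegment ℝ (P.pt i) (P.pt j)).ncard ≤ A.card * B.card := by
    rw [← Finset.card_product, ← Set.ncard_coe_finset]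
    refine Set.ncard_le_ncard_of_injOn g (fun p hp => hg1 p hp) ?_ (Finset.finite_toSet _)
    intro p hp p' hp' h
    have h1 := hg2 p hp
    have h2 := hg2 p' hp'
    rw [← h] at h2
    exact hfin _ (hg1 p hp) h1 h2
  have h1 : ((vertices P ∩ openSegment ℝ (P.pt i) (P.pt j)).ncard : ℝ) ≤ A.card * B.card := by
    exact_mod_cast hle
  have h2 : (A.card : ℝ) + B.card ≤ N - 2 := by
    have : (A.card : ℝ) + B.card + 2 ≤ N := by exact_mod_cast hcard
    linarith
  have h3 : (0 : ℝ) ≤ A.card := Nat.cast_nonneg _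
  have h4 : (0 : ℝ) ≤ B.card := Nat.cast_nonneg _
  nlinarith [sq_nonneg ((A.card : ℝ) - B.card)]

theorem maxSegments_le (hN : 2 ≤ N) : (maxSegments P : ℝ) ≤ (((N : ℝ) - 2) / 2) ^ 2 + 1 := by
  have hne : (Finset.univ : Finset (Fin N)).offDiag.Nonempty :=
    ⟨(⟨0, by omega⟩, ⟨1, by omega⟩), by simp⟩
  obtain ⟨q, hq, h⟩ := Finset.exists_mem_eq_sup _ hne fun q => chordSegments P q.1 q.2
  rw [maxSegments, h, chordSegments]
  push_cast
  have := openSegment_vertices_ncard_le P (Finset.mem_offDiag.1 hq).2.2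
  linarith

theorem chordSegments_le {i j : Fin N} (hij : i ≠ j) : chordSegments P i j ≤ maxSegments P :=
  Finset.le_sup (f := fun q : Fin N × Fin N => chordSegments P q.1 q.2) (b := (i, j))
    (by simpa using hij)

end

section

/-! ### Cells and the two sides of an edge -/

theorem sign_mul_pos_iff {s : SignType} (hs : s ≠ 0) {x : ℝ} :
    0 < (s : ℝ) * x ↔ SignType.sign x = s := by
  cases s with
  | zero => exact absurd rfl hs
  | neg =>
    have : ((SignType.neg : SignType) : ℝ) = -1 := rfl
    rw [this]
    constructor
    · intro h; exact sign_neg (by linarith)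
    · intro h; have : x < 0 := sign_eq_neg_one_iff.1 h
      linarith
  | pos =>
    have : ((SignType.pos : SignType) : ℝ) = 1 := rfl
    rw [this]
    constructor
    · intro h; exact sign_pos (by linarith)
    · intro h; have : 0 < x := sign_eq_one_iff.1 h
      linarith

theorem sign_mul_nonneg_iff {s : SignType} {x : ℝ} (hs : s ≠ 0) (hx : x ≠ 0) :
    0 ≤ (s : ℝ) * x ↔ SignType.sign x = s := by
  rw [← sign_mul_pos_iff hs]
  refine ⟨fun h => lt_of_le_of_ne h (Ne.symm (mul_ne_zero ?_ hx)), le_of_lt⟩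
  cases s with
  | zero => exact absurd rfl hs
  | neg => exact neg_ne_zero.2 one_ne_zero
  | pos => exact one_ne_zero

theorem sign_mul_nonneg {x y : ℝ} (h : 0 ≤ x * y) : 0 ≤ ((SignType.sign x : SignType) : ℝ) * y := by
  rcases lt_trichotomy x 0 with hx | hx | hx
  · rw [sign_neg hx]; simp; nlinarith
  · simp [hx]
  · rw [sign_pos hx]; simp; nlinarith

variable {N : ℕ} (P : BoundaryPoints N)

theorem mem_offChords {q : Plane} :
    q ∈ offChords P ↔ ‖q‖ < 1 ∧ ∀ i j, i ≠ j → lf P i j q ≠ 0 := by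
  refine and_congr_right fun h => forall₃_congr fun i j hij => ?_
  rw [mem_chord_iff P hij h.le]

theorem side_self (q : Plane) (i : Fin N) : side P q i i = 0 := by simp [side_eq, lf_self]

theorem side_swap (q : Plane) (i j : Fin N) : side P q j i = -side P q i j := by
  rw [side_eq, side_eq, lf_swap, Left.sign_neg]

variable {P} in
theorem Cell.swap (c : Cell P) (i j : Fin N) : c.1 j i = -c.1 i j := by
  obtain ⟨q, -, h⟩ := c.2; rw [← h, side_swap]

variable {P} in
theorem Cell.ne_zero (c : Cell P) {i j : Fin N} (hij : i ≠ j) : c.1 i j ≠ 0 := by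
  obtain ⟨q, hq, h⟩ := c.2
  rw [← h, side_eq, Ne, sign_eq_zero_iff]
  exact ((mem_offChords P).1 hq).2 i j hij

variable {P} in
theorem Cell.eq_one_or (c : Cell P) {i j : Fin N} (hij : i ≠ j) :
    c.1 i j = 1 ∨ c.1 i j = -1 := by
  have := c.ne_zero hij
  cases h : c.1 i j with
  | zero => exact absurd h this
  | neg => exact Or.inr rfl
  | pos => exact Or.inl rfl

variable {P} in
theorem Cell.ext' {c c' : Cell P} (h : ∀ i j, i ≠ j → c.1 i j = c'.1 i j) : c = c' := by
  apply Subtype.ext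
  funext i j
  by_cases hij : i = j
  · subst hij
    obtain ⟨q, -, h⟩ := c.2
    obtain ⟨q', -, h'⟩ := c'.2
    rw [← h, ← h', side_self, side_self]
  · exact h i j hij

/-- In this form a cell is an intersection of the open disk with open half-planes, which gives its
convexity, its openness and its closure. -/
theorem mem_region {c : Cell P} {q : Plane} :
    q ∈ region P c ↔ ‖q‖ < 1 ∧ ∀ i j, i ≠ j → 0 < (c.1 i j : ℝ) * lf P i j q := by
  constructor
  · rintro ⟨h1, h2⟩
    refine ⟨h1.1, fun i j hij => ?_⟩
    rw [sign_mul_pos_iff (c.ne_zero hij), ← h2, side_eq]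
  · rintro ⟨h1, h2⟩
    have hs : ∀ i j, i ≠ j → side P q i j = c.1 i j := fun i j hij => by
      rw [side_eq, ← sign_mul_pos_iff (c.ne_zero hij)]; exact h2 i j hij
    have hoff : q ∈ offChords P := by
      refine (mem_offChords P).2 ⟨h1, fun i j hij h => ?_⟩
      have := h2 i j hij
      rw [h, mul_zero] at this
      exact lt_irrefl _ this
    refine ⟨hoff, ?_⟩
    exact congrArg Subtype.val (Cell.ext' (c := ⟨side P q, q, hoff, rfl⟩) (c' := c) hs)

theorem region_nonempty (c : Cell P) : (region P c).Nonempty := by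
  obtain ⟨q, hq, h⟩ := c.2; exact ⟨q, hq, h⟩

theorem region_convex (c : Cell P) : Convex ℝ (region P c) := by
  intro x hx y hy a b ha hb hab
  rw [mem_region] at hx hy ⊢
  constructor
  · have := convex_ball (0 : Plane) 1 (mem_ball_zero_iff.2 hx.1) (mem_ball_zero_iff.2 hy.1) ha hb hab
    exact mem_ball_zero_iff.1 this
  · intro i j hij
    have h1 := hx.2 i j hij
    have h2 := hy.2 i j hij
    rw [lf_combo P i j x y hab]
    rcases ha.eq_or_lt with rfl | ha
    · obtain rfl : b = 1 := by linarith
      simpa using h2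
    · nlinarith [mul_pos ha h1, mul_nonneg hb h2.le]

theorem region_isOpen (c : Cell P) : IsOpen (region P c) := by
  have : region P c = {q | ‖q‖ < 1} ∩ ⋂ i, ⋂ j, {q | i ≠ j → 0 < (c.1 i j : ℝ) * lf P i j q} := by
    ext q; rw [mem_region]; simp
  rw [this]
  refine (isOpen_lt continuous_norm continuous_const).inter ?_
  refine isOpen_iInter_of_finite fun i => isOpen_iInter_of_finite fun j => ?_
  by_cases hij : i = j
  · simp [hij]
  · simp only [ne_eq, hij, not_false_eq_true, forall_const]
    exact isOpen_lt continuous_const (continuous_const.mul (lf_continuous P i j))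

/-- Moving from `q` towards a fixed point of the region makes every weak inequality strict at once,
so the closure only relaxes the inequalities. -/
theorem mem_closure_region {c : Cell P} {q : Plane} :
    q ∈ closure (region P c) ↔ ‖q‖ ≤ 1 ∧ ∀ i j, i ≠ j → 0 ≤ (c.1 i j : ℝ) * lf P i j q := by
  constructor
  · intro h
    have hcl : IsClosed {q | ‖q‖ ≤ 1 ∧ ∀ i j, i ≠ j → 0 ≤ (c.1 i j : ℝ) * lf P i j q} := by
      have : {q | ‖q‖ ≤ 1 ∧ ∀ i j, i ≠ j → 0 ≤ (c.1 i j : ℝ) * lf P i j q} =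
          {q | ‖q‖ ≤ 1} ∩ ⋂ i, ⋂ j, ⋂ (_ : i ≠ j), {q | 0 ≤ (c.1 i j : ℝ) * lf P i j q} := by
        ext q; simp
      rw [this]
      refine (isClosed_le continuous_norm continuous_const).inter ?_
      refine isClosed_iInter fun i => isClosed_iInter fun j => isClosed_iInter fun _ => ?_
      exact isClosed_le continuous_const (continuous_const.mul (lf_continuous P i j))
    refine closure_minimal ?_ hcl h
    intro x hx
    rw [mem_region] at hx
    exact ⟨hx.1.le, fun i j hij => (hx.2 i j hij).le⟩
  · rintro ⟨h1, h2⟩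
    obtain ⟨q0, hq0⟩ := region_nonempty P c
    rw [mem_region] at hq0
    have ht : Tendsto (fun t : ℝ => q + t • (q0 - q)) (𝓝[>] 0) (𝓝 q) := by
      have : Tendsto (fun t : ℝ => q + t • (q0 - q)) (𝓝 0) (𝓝 (q + (0 : ℝ) • (q0 - q))) :=
        (by fun_prop : Continuous fun t : ℝ => q + t • (q0 - q)).tendsto 0
      simp only [zero_smul, add_zero] at this
      exact this.mono_left nhdsWithin_le_nhds
    refine mem_closure_of_tendsto ht ?_
    filter_upwards [Ioo_mem_nhdsGT (zero_lt_one' ℝ)] with t ht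
    rw [mem_region]
    constructor
    · have : q + t • (q0 - q) = (1 - t) • q + t • q0 := by module
      rw [this]
      have hle := norm_add_le ((1 - t) • q) (t • q0)
      rw [norm_smul, norm_smul, Real.norm_of_nonneg ht.1.le,
        Real.norm_of_nonneg (by linarith [ht.2])] at hle
      nlinarith [ht.1, ht.2, hq0.1]
    · intro i j hij
      rw [lf_lineMap]
      have h3 := h2 i j hij
      have h4 := hq0.2 i j hij
      have h5 : 0 ≤ (1 - t) * ((c.1 i j : ℝ) * lf P i j q) := mul_nonneg (by linarith [ht.2]) h3
      have h6 := mul_pos ht.1 h4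
      nlinarith

/-- The closure of a cell is convex, so it contains an edge as soon as it contains both ends. -/
theorem incident_iff {u v : Plane} (h : s(u, v) ∈ (chordGraph P).edgeSet) (c : Cell P) :
    incident P c ⟨s(u, v), h⟩ ↔ u ∈ closure (region P c) ∧ v ∈ closure (region P c) := by
  change segment ℝ u v ⊆ _ ↔ _
  constructor
  · intro h; exact ⟨h (left_mem_segment _ _ _), h (right_mem_segment _ _ _)⟩
  · rintro ⟨h1, h2⟩; exact (region_convex P c).closure.segment_subset h1 h2

/-- The signs of the points close to `v` in direction `d`. -/
def sg (v d : Plane) (i j : Fin N) : SignType :=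
  if lf P i j v = 0 then SignType.sign (cr (P.pt j - P.pt i) d) else SignType.sign (lf P i j v)

/-- For small positive `ε` the sign of each affine function is that of its value at `v`, or of its
derivative along `d` if that value is zero. The second hypothesis keeps the ray off the lines
through `v`. -/
theorem cell_near {v d : Plane} (h1 : ∀ᶠ ε : ℝ in 𝓝[>] 0, ‖v + ε • d‖ < 1)
    (h2 : ∀ i j, i ≠ j → lf P i j v = 0 → cr (P.pt j - P.pt i) d ≠ 0) :
    ∃ c : Cell P, c.1 = sg P v d ∧ ∀ᶠ ε : ℝ in 𝓝[>] 0, v + ε • d ∈ region P c := by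
  have hsign : ∀ᶠ ε : ℝ in 𝓝[>] 0, ∀ i j, side P (v + ε • d) i j = sg P v d i j := by
    simp only [eventually_all]
    intro i j
    simp only [side_eq, sg]
    split_ifs with h
    · filter_upwards [self_mem_nhdsWithin] with ε hε
      rw [lf_add_smul, h, zero_add, sign_mul, sign_pos hε, one_mul]
    · have ht : Tendsto (fun ε : ℝ => lf P i j (v + ε • d)) (𝓝[>] 0) (𝓝 (lf P i j v)) := by
        have : Continuous fun ε : ℝ => lf P i j (v + ε • d) :=
          (lf_continuous P i j).comp (by fun_prop)
        have h0 := this.tendsto 0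
        simp only [zero_smul, add_zero] at h0
        exact h0.mono_left nhdsWithin_le_nhds
      rcases lt_or_gt_of_ne h with h | h
      · filter_upwards [ht.eventually_lt_const h] with ε hε
        rw [sign_neg hε, sign_neg h]
      · filter_upwards [ht.eventually_const_lt h] with ε hε
        rw [sign_pos hε, sign_pos h]
  have hreg : ∀ᶠ ε : ℝ in 𝓝[>] 0, v + ε • d ∈ offChords P ∧ side P (v + ε • d) = sg P v d := by
    filter_upwards [h1, hsign] with ε h3 h4
    refine ⟨(mem_offChords P).2 ⟨h3, fun i j hij h0 => ?_⟩, funext fun i => funext fun j => h4 i j⟩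
    have h5 := h4 i j
    rw [side_eq, h0, sign_zero, sg] at h5
    split_ifs at h5 with h6
    · exact h2 i j hij h6 (sign_eq_zero_iff.1 h5.symm)
    · exact h6 (sign_eq_zero_iff.1 h5.symm)
  obtain ⟨ε, h3, h4⟩ := hreg.exists
  exact ⟨⟨sg P v d, _, h3, h4⟩, rfl, hreg⟩

theorem mem_closure_of_sg {c : Cell P} {v d : Plane} (hv : ‖v‖ ≤ 1) (h : c.1 = sg P v d) :
    v ∈ closure (region P c) := by
  refine (mem_closure_region P).2 ⟨hv, fun i j _ => ?_⟩
  rw [h, sg]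
  split_ifs with h0
  · simp [h0]
  · exact sign_mul_nonneg (mul_self_nonneg _)

/-- No line separates the end points of an edge. -/
theorem same_side {u v : Plane} (h : (chordGraph P).Adj u v) {i j : Fin N} (hij : i ≠ j) :
    0 ≤ lf P i j u * lf P i j v := by
  by_contra! hlt
  obtain ⟨x, hx, h0⟩ := exists_lf_eq_zero P hlt
  obtain ⟨hne, hu, hv, ⟨k, l, hkl, hku, hkv⟩, hno⟩ := h
  have hxk : x ∈ chord P k l :=
    (convex_segment _ _).segment_subset hku hkv (openSegment_subset_segment _ _ _ hx)
  -- The crossing point would be a vertex inside the edge, unless the line is that of the edge,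
  -- where both values vanish.
  refine hno x hx (mem_vertices_of_lf P hij hkl ?_ (norm_le_one_of_mem_chord P hxk) h0
    (lf_eq_zero_of_mem_chord P hxk))
  intro hs
  have h1 := lf_eq_zero_of_mem_chord P hku
  rcases lf_of_sym2_eq P hs u with ⟨-, -, h2⟩ | ⟨-, -, h2⟩ <;>
  · rw [h2, h1] at hlt; simp at hlt

theorem lf_ne_zero_of_edge {u v : Plane} (huv : u ≠ v) {k l : Fin N} (hkl : k ≠ l)
    (hu : u ∈ chord P k l) (hv : v ∈ chord P k l) {i j : Fin N} (hij : i ≠ j)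
    (hne : s(i, j) ≠ s(k, l)) : lf P i j u ≠ 0 ∨ lf P i j v ≠ 0 := by
  by_contra! h
  exact hne (sym2_eq_of_lf P hij hkl huv h.1 h.2 (lf_eq_zero_of_mem_chord P hu)
    (lf_eq_zero_of_mem_chord P hv))

/-- A cell at an edge is determined by the side of the chord on which it lies. -/
theorem incident_unique {u v : Plane} (h : s(u, v) ∈ (chordGraph P).edgeSet) {k l : Fin N}
    (hkl : k ≠ l) (hu : u ∈ chord P k l) (hv : v ∈ chord P k l) {c c' : Cell P}
    (hc : incident P c ⟨s(u, v), h⟩) (hc' : incident P c' ⟨s(u, v), h⟩)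
    (he : c.1 k l = c'.1 k l) : c = c' := by
  rw [incident_iff, mem_closure_region, mem_closure_region] at hc hc'
  refine Cell.ext' fun i j hij => ?_
  by_cases hs : s(i, j) = s(k, l)
  · rcases Sym2.eq_iff.1 hs with ⟨rfl, rfl⟩ | ⟨rfl, rfl⟩
    · exact he
    · rw [Cell.swap, he, ← Cell.swap]
  -- Every other line misses an end of the edge, and the sign there is forced on both cells.
  · rcases lf_ne_zero_of_edge P h.1 hkl hu hv hij hs with h0 | h0
    · rw [← (sign_mul_nonneg_iff (c.ne_zero hij) h0).1 (hc.1.2 i j hij),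
        ← (sign_mul_nonneg_iff (c'.ne_zero hij) h0).1 (hc'.1.2 i j hij)]
    · rw [← (sign_mul_nonneg_iff (c.ne_zero hij) h0).1 (hc.2.2 i j hij),
        ← (sign_mul_nonneg_iff (c'.ne_zero hij) h0).1 (hc'.2.2 i j hij)]

/-- The cell on a given side of an inner point of an edge. -/
theorem edge_cell {u v : Plane} (h : s(u, v) ∈ (chordGraph P).edgeSet) {k l : Fin N}
    (hkl : k ≠ l) (hu : u ∈ chord P k l) (hv : v ∈ chord P k l) {x d : Plane}
    (hx : x ∈ openSegment ℝ u v) (hd : cr (P.pt l - P.pt k) d ≠ 0) :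
    ∃ c : Cell P, incident P c ⟨s(u, v), h⟩ ∧ c.1 = sg P x d ∧
      ∀ᶠ ε : ℝ in 𝓝[>] 0, x + ε • d ∈ region P c := by
  have hadj : (chordGraph P).Adj u v := h
  have hu1 := norm_le_one_of_mem_chord P hu
  have hv1 := norm_le_one_of_mem_chord P hv
  have hx1 : ‖x‖ < 1 := openSegment_norm_lt hadj.1 hu1 hv1 hx
  have hxk : x ∈ chord P k l :=
    (convex_segment _ _).segment_subset hu hv (openSegment_subset_segment _ _ _ hx)
  -- An inner point of an edge is no vertex, so no line but that of the edge passes through it.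
  have hx0 : ∀ i j, i ≠ j → lf P i j x = 0 → s(i, j) = s(k, l) := by
    intro i j hij h0
    by_contra hne
    exact hadj.2.2.2.2 x hx (mem_vertices_of_lf P hij hkl hne hx1.le h0
      (lf_eq_zero_of_mem_chord P hxk))
  obtain ⟨c, hc, hev⟩ := cell_near P (v := x) (d := d) (by
    have : Continuous fun ε : ℝ => ‖x + ε • d‖ := by fun_prop
    have h0 := this.tendsto 0
    simp only [zero_smul, add_zero] at h0
    exact (h0.mono_left nhdsWithin_le_nhds).eventually_lt_const hx1) (by
    intro i j hij h0
    rcases Sym2.eq_iff.1 (hx0 i j hij h0) with ⟨rfl, rfl⟩ | ⟨rfl, rfl⟩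
    · exact hd
    · intro h1; apply hd; simp only [cr] at h1 ⊢; simp at h1 ⊢; linarith)
  refine ⟨c, ?_, hc, hev⟩
  obtain ⟨a, b, ha, hb, hab, rfl⟩ := hx
  rw [incident_iff, mem_closure_region, mem_closure_region]
  have key : ∀ i j, i ≠ j → 0 ≤ (c.1 i j : ℝ) * lf P i j u ∧ 0 ≤ (c.1 i j : ℝ) * lf P i j v := by
    intro i j hij
    have hs := same_side P hadj hij
    rw [hc, sg]
    split_ifs with h0
    · have hul := lf_eq_zero_of_mem_chord P hu
      have hvl := lf_eq_zero_of_mem_chord P hv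
      have := hx0 i j hij h0
      have h1 : lf P i j u = 0 := by
        rcases lf_of_sym2_eq P this u with ⟨-, -, h2⟩ | ⟨-, -, h2⟩ <;> rw [h2, hul] <;> simp
      have h3 : lf P i j v = 0 := by
        rcases lf_of_sym2_eq P this v with ⟨-, -, h2⟩ | ⟨-, -, h2⟩ <;> rw [h2, hvl] <;> simp
      simp [h1, h3]
    · rw [lf_combo P i j u v hab]
      constructor <;> apply sign_mul_nonneg <;>
        nlinarith [mul_self_nonneg (lf P i j u), mul_self_nonneg (lf P i j v)]
  exact ⟨⟨hu1, fun i j hij => (key i j hij).1⟩, ⟨hv1, fun i j hij => (key i j hij).2⟩⟩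

theorem exists_chord_of_edge {u v : Plane} (h : s(u, v) ∈ (chordGraph P).edgeSet) :
    ∃ k l, k ≠ l ∧ u ∈ chord P k l ∧ v ∈ chord P k l := by
  obtain ⟨-, -, -, h, -⟩ := h; exact h

/-- Rotation by a right angle. -/
def rot (a : Plane) : Plane := !₂[-a 1, a 0]

theorem cr_rot (a : Plane) : cr a (rot a) = ‖a‖ ^ 2 := by
  rw [plane_norm_sq]; simp [cr, rot]; ring

theorem midpoint_mem_openSegment' {u v : Plane} : midpoint ℝ u v ∈ openSegment ℝ u v := by
  refine ⟨1 / 2, 1 / 2, by norm_num, by norm_num, by norm_num, ?_⟩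
  rw [midpoint_eq_smul_add]; simp [smul_add]

/-- Step off the midpoint of the edge along the normal of the chord, with the sign `s`. -/
theorem exists_incident_side {u v : Plane} (h : s(u, v) ∈ (chordGraph P).edgeSet) {k l : Fin N}
    (hkl : k ≠ l) (hu : u ∈ chord P k l) (hv : v ∈ chord P k l) {s : SignType} (hs : s ≠ 0) :
    ∃ c : Cell P, incident P c ⟨s(u, v), h⟩ ∧ c.1 k l = s := by
  have hpos := chord_len_pos P hkl
  have hmid : lf P k l (midpoint ℝ u v) = 0 := lf_eq_zero_of_mem_chord P
    ((convex_segment _ _).segment_subset hu hv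
      (openSegment_subset_segment _ _ _ midpoint_mem_openSegment'))
  have hsr : (s : ℝ) ≠ 0 := by
    cases s with
    | zero => exact absurd rfl hs
    | neg => exact neg_ne_zero.2 one_ne_zero
    | pos => exact one_ne_zero
  have hcr : cr (P.pt l - P.pt k) ((s : ℝ) • rot (P.pt l - P.pt k)) =
      s * ‖P.pt l - P.pt k‖ ^ 2 := by rw [cr_smul_right, cr_rot]
  obtain ⟨c, hc, h1, -⟩ := edge_cell P h hkl hu hv midpoint_mem_openSegment'
    (d := (s : ℝ) • rot (P.pt l - P.pt k)) (by rw [hcr]; exact mul_ne_zero hsr hpos.ne')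
  refine ⟨c, hc, ?_⟩
  rw [h1, sg, if_pos hmid, hcr, sign_mul, sign_pos hpos, mul_one]
  cases s <;> simp_all

/-- An edge has exactly two cells on its sides. -/
theorem incident_eq_or {e : ChordEdge P} {c₁ c₂ c : Cell P} (hne : c₁ ≠ c₂)
    (h1 : incident P c₁ e) (h2 : incident P c₂ e) (h : incident P c e) : c = c₁ ∨ c = c₂ := by
  obtain ⟨e, he⟩ := e
  induction e with | _ u v =>
  obtain ⟨k, l, hkl, hu, hv⟩ := exists_chord_of_edge P he
  by_contra! hcon
  -- The cells at an edge are told apart by their side of its chord, and there are only two sides.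
  have h3 : c₁.1 k l ≠ c₂.1 k l := fun h' => hne (incident_unique P he hkl hu hv h1 h2 h')
  have h4 : c.1 k l ≠ c₁.1 k l := fun h' => hcon.1 (incident_unique P he hkl hu hv h h1 h')
  have h5 : c.1 k l ≠ c₂.1 k l := fun h' => hcon.2 (incident_unique P he hkl hu hv h h2 h')
  rcases c.eq_one_or hkl with h | h <;> rcases c₁.eq_one_or hkl with h' | h' <;>
    rcases c₂.eq_one_or hkl with h'' | h'' <;> simp_all

theorem exists_incident (e : ChordEdge P) : ∃ c, incident P c e := by
  obtain ⟨e, he⟩ := e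
  induction e with | _ u v =>
  obtain ⟨k, l, hkl, hu, hv⟩ := exists_chord_of_edge P he
  obtain ⟨c, hc, -⟩ := exists_incident_side P he hkl hu hv (s := 1) (by decide)
  exact ⟨c, hc⟩

/-- An edge is crossed by a cut if it has a cell inside and a cell outside the cut. -/
def Crosses (X : Set (Cell P)) (e : ChordEdge P) : Prop :=
  (∃ x ∈ X, incident P x e) ∧ ∃ y ∉ X, incident P y e

/-- Since an edge has just two cells, being crossed is the exclusive or of their memberships. This
is what makes counting modulo two possible. -/
theorem crosses_iff {X : Set (Cell P)} {e : ChordEdge P} {c₁ c₂ : Cell P} (hne : c₁ ≠ c₂)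
    (h1 : incident P c₁ e) (h2 : incident P c₂ e) : Crosses P X e ↔ ¬(c₁ ∈ X ↔ c₂ ∈ X) := by
  constructor
  · rintro ⟨⟨x, hx, hxe⟩, ⟨y, hy, hye⟩⟩
    rcases incident_eq_or P hne h1 h2 hxe with rfl | rfl <;>
      rcases incident_eq_or P hne h1 h2 hye with rfl | rfl <;> tauto
  · intro h
    by_cases hc : c₁ ∈ X
    · exact ⟨⟨c₁, hc, h1⟩, ⟨c₂, by tauto, h2⟩⟩
    · exact ⟨⟨c₂, by tauto, h2⟩, ⟨c₁, hc, h1⟩⟩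

end

section

/-! ### Parity of the crossed edges at a vertex -/

/-- A function that is constant off a finite set and takes values in `ZMod 2` changes by the sum of
its jumps. -/
theorem sum_jumps (F : Finset ℝ) (f J : ℝ → ZMod 2)
    (hconst : ∀ x y, x < y → (∀ z ∈ F, x ≤ z → z ≤ y → False) → f x = f y)
    (hjump : ∀ x ∈ F, ∀ y z, y < x → x < z → (∀ w ∈ F, y ≤ w → w ≤ z → w = x) → J x = f y + f z)
    {y z : ℝ} (hyz : y < z) (hy : y ∉ F) (hz : z ∉ F) :
    ∑ x ∈ F with y < x ∧ x < z, J x = f y + f z := by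
  -- Induction on the number of jumps in the interval: the last one is split off, and the
  -- contributions of the separating point cancel modulo two.
  induction hn : (F.filter fun x => y < x ∧ x < z).card using Nat.strong_induction_on
    generalizing z with
  | _ n ih =>
    rcases (F.filter fun x => y < x ∧ x < z).eq_empty_or_nonempty with h | h
    · rw [h, Finset.sum_empty, hconst y z hyz, CharTwo.add_self_eq_zero]
      intro w hw h1 h2
      have h1' := lt_of_le_of_ne h1 (by rintro rfl; exact hy hw)
      have h2' := lt_of_le_of_ne h2 (by rintro rfl; exact hz hw)
      have : w ∈ F.filter fun x => y < x ∧ x < z := Finset.mem_filter.2 ⟨hw, h1', h2'⟩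
      rw [h] at this; simp at this
    · set x := (F.filter fun x => y < x ∧ x < z).max' h with hx
      have hxm := Finset.max'_mem _ h
      rw [← hx, Finset.mem_filter] at hxm
      have hmax : ∀ w ∈ F, y < w → w < z → w ≤ x := fun w hw h1 h2 =>
        Finset.le_max' _ w (Finset.mem_filter.2 ⟨hw, h1, h2⟩)
      -- A separating point just to the left of `x`, beyond `y` and beyond all smaller jumps.
      obtain ⟨z', hz'1, hz'2, hz'3⟩ : ∃ z', y < z' ∧ z' < x ∧ ∀ w ∈ F, w < x → w < z' := by
        rcases (F.filter fun w => w < x).eq_empty_or_nonempty with h0 | h0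
        · refine ⟨(y + x) / 2, by linarith [hxm.2.1], by linarith [hxm.2.1], fun w hw hwx => ?_⟩
          have : w ∈ F.filter fun w => w < x := Finset.mem_filter.2 ⟨hw, hwx⟩
          rw [h0] at this; simp at this
        · have hm := Finset.max'_mem _ h0
          set m := (F.filter fun w => w < x).max' h0 with hmdef
          rw [Finset.mem_filter] at hm
          refine ⟨(max m y + x) / 2, ?_, ?_, fun w hw hwx => ?_⟩
          · have := le_max_right m y; linarith [hxm.2.1]
          · have := max_lt hm.2 hxm.2.1; linarith
          · have h1 : w ≤ m := Finset.le_max' _ w (Finset.mem_filter.2 ⟨hw, hwx⟩)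
            have := le_max_left m y; linarith [hm.2, max_lt hm.2 hxm.2.1]
      have hz'F : z' ∉ F := fun h => lt_irrefl _ (hz'3 z' h hz'2)
      have hfil : (F.filter fun w => y < w ∧ w < z) =
          insert x (F.filter fun w => y < w ∧ w < z') := by
        ext w
        simp only [Finset.mem_filter, Finset.mem_insert]
        constructor
        · rintro ⟨h1, h2, h3⟩
          rcases (hmax w h1 h2 h3).eq_or_lt with h4 | h4
          · exact Or.inl h4
          · exact Or.inr ⟨h1, h2, hz'3 w h1 h4⟩
        · rintro (rfl | ⟨h1, h2, h3⟩)
          · exact hxm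
          · exact ⟨h1, h2, by linarith [hxm.2.2]⟩
      have hxn : x ∉ F.filter fun w => y < w ∧ w < z' := by
        rw [Finset.mem_filter]; rintro ⟨-, -, h⟩; linarith
      rw [hfil, Finset.sum_insert hxn, ih _ (by
        rw [← hn, hfil, Finset.card_insert_of_notMem hxn]; exact Nat.lt_succ_self _) hz'1 hz'F rfl,
        hjump x hxm.1 z' z hz'2 hxm.2.2]
      · have := CharTwo.add_self_eq_zero (f z')
        linear_combination this
      · intro w hw h1 h2
        have h2' := lt_of_le_of_ne h2 (by rintro rfl; exact hz hw)
        refine le_antisymm (hmax w hw (by linarith) h2') ?_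
        by_contra! h3
        linarith [hz'3 w hw h3]

/-- The dot product of two vectors of the plane. -/
def dt (a b : Plane) : ℝ := a 0 * b 0 + a 1 * b 1

theorem dt_smul_left (a b : Plane) (r : ℝ) : dt (r • a) b = r * dt a b := by simp [dt]; ring

theorem cr_rot_right (a b : Plane) : cr a (rot b) = dt a b := by simp [cr, dt, rot]

theorem dt_neg_right (a b : Plane) : dt a (-b) = -dt a b := by simp [dt]; ring

theorem dt_add_rot (n : Plane) (t : ℝ) : dt (n + t • rot n) n = ‖n‖ ^ 2 := by
  rw [plane_norm_sq]; simp [dt, rot]; ring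

theorem dt_add_rot' (n : Plane) (t : ℝ) : dt (n + t • rot n) (rot n) = t * ‖n‖ ^ 2 := by
  rw [plane_norm_sq]; simp [dt, rot]; ring

theorem rot_neg (n : Plane) : rot (-n) = -rot n := by apply plane_ext <;> simp [rot]

/-- The rays of an open half-plane are parametrized by a real number, the slope with respect to its
normal. Turning through the half-plane becomes moving along the real line. -/
theorem eq_smul_add_rot {x n : Plane} (h : 0 < dt x n) :
    ∃ r t : ℝ, 0 < r ∧ x = r • (n + t • rot n) := by
  have hn : 0 < n 0 ^ 2 + n 1 ^ 2 := by
    by_contra! h0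
    have h1 : n 0 = 0 := by nlinarith [sq_nonneg (n 0), sq_nonneg (n 1)]
    have h2 : n 1 = 0 := by nlinarith [sq_nonneg (n 0), sq_nonneg (n 1)]
    simp [dt, h1, h2] at h
  refine ⟨dt x n / (n 0 ^ 2 + n 1 ^ 2), dt x (rot n) / dt x n, by positivity, ?_⟩
  rw [smul_add, smul_smul]
  have h3 : dt x n / (n 0 ^ 2 + n 1 ^ 2) * (dt x (rot n) / dt x n) =
      dt x (rot n) / (n 0 ^ 2 + n 1 ^ 2) := by field_simp
  rw [h3]
  apply plane_ext <;> simp [rot, dt] <;> field_simp <;> ring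

theorem sign_eq_of_mul_pos {a b : ℝ} (h : 0 < a * b) : SignType.sign a = SignType.sign b := by
  rcases pos_and_pos_or_neg_and_neg_of_mul_pos h with ⟨h1, h2⟩ | ⟨h1, h2⟩
  · rw [sign_pos h1, sign_pos h2]
  · rw [sign_neg h1, sign_neg h2]

variable {N : ℕ} (P : BoundaryPoints N)

theorem sg_congr {v d d' : Plane} (h : ∀ i j, i ≠ j → lf P i j v = 0 →
    0 < cr (P.pt j - P.pt i) d * cr (P.pt j - P.pt i) d') : sg P v d = sg P v d' := by
  funext i j
  unfold sg
  split_ifs with h0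
  · by_cases hij : i = j
    · subst hij; simp [cr_zero_left]
    · exact sign_eq_of_mul_pos (h i j hij h0)
  · rfl

/-- The direction `n + z • m` tends to that of `m` as `z` grows, and no line through `v` runs along
`m`. -/
theorem sg_eventually {v : Plane} (n : Plane) {m : Plane}
    (hm : ∀ i j, i ≠ j → lf P i j v = 0 → cr (P.pt j - P.pt i) m ≠ 0) :
    ∀ᶠ z : ℝ in atTop, sg P v (n + z • m) = sg P v m := by
  have : ∀ᶠ z : ℝ in atTop, ∀ i j, i ≠ j → lf P i j v = 0 →
      0 < cr (P.pt j - P.pt i) (n + z • m) * cr (P.pt j - P.pt i) m := by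
    simp only [eventually_all]
    intro i j hij h0
    have hb := hm i j hij h0
    set a := cr (P.pt j - P.pt i) n
    set b := cr (P.pt j - P.pt i) m
    filter_upwards [eventually_gt_atTop (-a / b)] with z hz
    rw [cr_add_right, cr_smul_right]
    have h1 : 0 < b ^ 2 * (z - -a / b) := mul_pos (by positivity) (by linarith)
    have h2 : b ^ 2 * (z - -a / b) = (a + z * b) * b := by field_simp; ring
    linarith
  filter_upwards [this] with z hz
  exact sg_congr P hz

open Classical in
/-- Whether the cell at `v` in direction `d` belongs to `X`. -/
def ind (X : Set (Cell P)) (v d : Plane) : ZMod 2 := if ∃ c ∈ X, c.1 = sg P v d then 1 else 0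

open Classical in
theorem ind_eq {X : Set (Cell P)} {v d : Plane} {c : Cell P} (hc : c.1 = sg P v d) :
    ind P X v d = if c ∈ X then 1 else 0 := by
  have : (∃ c ∈ X, c.1 = sg P v d) ↔ c ∈ X := by
    constructor
    · rintro ⟨c', h1, h2⟩
      rwa [Subtype.ext (hc.trans h2.symm)]
    · intro h; exact ⟨c, h, hc⟩
  simp only [ind, this]

/-- The neighbours of `v` across which the cut passes. -/
def crossedNbrs (X : Set (Cell P)) (v : Plane) : Set Plane :=
  {u | ∃ h : (chordGraph P).Adj v u, Crosses P X ⟨s(v, u), h⟩}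

theorem crossedNbrs_finite (X : Set (Cell P)) (v : Plane) : (crossedNbrs P X v).Finite :=
  (vertices_finite P).subset fun _ hu => hu.1.2.2.1

/-- Of two neighbours on one ray, the nearer would be a vertex inside the edge to the farther. -/
theorem ray_unique {v u u' d : Plane} {r r' : ℝ} (h : (chordGraph P).Adj v u)
    (h' : (chordGraph P).Adj v u') (hr : 0 < r) (hr' : 0 < r') (hu : u - v = r • d)
    (hu' : u' - v = r' • d) : u = u' := by
  have key : ∀ {u u' : Plane} {r r' : ℝ}, (chordGraph P).Adj v u → (chordGraph P).Adj v u' →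
      0 < r → u - v = r • d → u' - v = r' • d → ¬ r < r' := by
    intro u u' r r' h h' hr hu hu' hlt
    refine h'.2.2.2.2 u ?_ h.2.2.1
    rw [openSegment_eq_image']
    have hr' : 0 < r' := hr.trans hlt
    refine ⟨r / r', ⟨by positivity, (div_lt_one hr').2 hlt⟩, ?_⟩
    simp only
    rw [hu', smul_smul, div_mul_cancel₀ _ hr'.ne', ← hu]; abel
  have : r = r' := le_antisymm (not_lt.1 (key h' h hr' hu' hu)) (not_lt.1 (key h h' hr hu hu'))
  subst this
  exact sub_left_injective (hu.trans hu'.symm)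

/-- In every direction along a chord, a vertex has a neighbour. -/
theorem exists_nbr {v d : Plane} (hv : v ∈ vertices P) (hd : d ≠ 0)
    (hdisc : ∀ᶠ ε : ℝ in 𝓝[>] 0, ‖v + ε • d‖ < 1) {i j : Fin N} (hij : i ≠ j)
    (h0 : lf P i j v = 0) (hcr : cr (P.pt j - P.pt i) d = 0) :
    ∃ u, (chordGraph P).Adj v u ∧ ∃ r : ℝ, 0 < r ∧ u - v = r • d := by
  obtain ⟨τ, hτ⟩ := eq_smul_of_cr_eq_zero (sub_ne_zero.2 (P.injective.ne hij.symm)) hcr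
  have hτ0 : τ ≠ 0 := by rintro rfl; simp at hτ; exact hd hτ
  -- The chord can be reversed, so that `d` points towards its end `P.pt j`.
  wlog hpos : 0 < τ generalizing i j τ
  · refine this hij.symm (by rw [lf_swap, h0, neg_zero]) ?_ (-τ) ?_ (neg_ne_zero.2 hτ0) ?_
    · simp only [cr] at hcr ⊢; simp at hcr ⊢; linarith
    · rw [hτ]; module
    · exact neg_pos.2 (lt_of_le_of_ne (not_lt.1 hpos) hτ0)
  have hvc : v ∈ chord P i j := (mem_chord_iff P hij (vertex_norm_le P hv)).2 h0
  obtain ⟨s, hs0, hs1, hs⟩ := (mem_chord P).1 hvc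
  -- At the end `P.pt j` the direction `d` would leave the disk, against `hdisc`.
  have hs1' : s ≠ 1 := by
    rintro rfl
    obtain ⟨ε, hε, hε0⟩ := (hdisc.and self_mem_nhdsWithin).exists
    have hε0 : 0 < ε := hε0
    have h1 : v + ε • d = P.pt i + (1 + ε * τ) • (P.pt j - P.pt i) := by
      rw [hs, hτ]; module
    have h2 := line_norm_sq P i j (1 + ε * τ)
    rw [← h1] at h2
    have h3 : ‖v + ε • d‖ ^ 2 < 1 := (sq_lt_one_iff₀ (norm_nonneg _)).2 hε
    have h4 : 0 < (1 + ε * τ) * (1 + ε * τ - 1) * ‖P.pt j - P.pt i‖ ^ 2 := by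
      have := chord_len_pos P hij
      have h5 : 0 < ε * τ := by positivity
      have : 1 + ε * τ - 1 = ε * τ := by ring
      rw [this]; positivity
    linarith
  have hs1'' : 0 < 1 - s := by linarith [lt_of_le_of_ne hs1 hs1']
  have hjv : P.pt j - v = ((1 - s) / τ) • d := by
    rw [hτ, smul_smul, div_mul_cancel₀ _ hτ0, hs]; module
  have hne : v ≠ P.pt j := by
    intro h
    rw [← h, sub_self] at hjv
    rcases smul_eq_zero.1 hjv.symm with h1 | h1
    · rw [div_eq_zero_iff] at h1
      rcases h1 with h1 | h1
      exacts [hs1''.ne' h1, hτ0 h1]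
    · exact hd h1
  obtain ⟨t, ht0, ht1, hw, hno⟩ := exists_nearest (vertices_finite P) (pt_mem_vertices P j) hne
  refine ⟨_, ⟨?_, hv, hw, ⟨i, j, hij, hvc,
    mem_chord_lineMap P hvc (pt_mem_chord_right P i j) ht0.le ht1⟩, hno⟩, t * ((1 - s) / τ),
    by positivity, by rw [add_sub_cancel_left, hjv, smul_smul]⟩
  intro h
  have h1 : t • (P.pt j - v) = 0 := by simpa using h.symm
  rcases smul_eq_zero.1 h1 with h1 | h1
  · exact ht0.ne' h1
  · exact hne (sub_eq_zero.1 h1).symm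

/-- By `hd` no line through `v` separates the direction of the cell from that of the edge, and the
other lines do not separate the ends of the edge. -/
theorem sg_cell_mem_closure {v u d d' : Plane} {r : ℝ} (hadj : (chordGraph P).Adj v u) (hr : 0 < r)
    (hu : u - v = r • d') {c : Cell P} (hc : c.1 = sg P v d)
    (hd : ∀ i j, i ≠ j → lf P i j v = 0 →
      0 ≤ cr (P.pt j - P.pt i) d * cr (P.pt j - P.pt i) d') :
    incident P c ⟨s(v, u), hadj⟩ := by
  refine (incident_iff P hadj c).2 ⟨mem_closure_of_sg P (vertex_norm_le P hadj.2.1) hc, ?_⟩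
  refine (mem_closure_region P).2 ⟨vertex_norm_le P hadj.2.2.1, fun i j hij => ?_⟩
  rw [hc, sg]
  split_ifs with h0
  · have h1 : lf P i j u = r * cr (P.pt j - P.pt i) d' := by
      rw [← cr_smul_right, ← hu, ← lf_sub, h0, sub_zero]
    rw [h1]
    have := sign_mul_nonneg (hd i j hij h0)
    have h2 := mul_nonneg hr.le this
    linarith
  · exact sign_mul_nonneg (same_side P hadj hij)

/-- The number of crossed edges on one side of a line through a vertex, modulo two. -/
theorem half_parity (X : Set (Cell P)) {v n : Plane} (hv : v ∈ vertices P) (hn : n ≠ 0)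
    (hdisc : ∀ t : ℝ, ∀ᶠ ε : ℝ in 𝓝[>] 0, ‖v + ε • (n + t • rot n)‖ < 1)
    (hm : ∀ i j, i ≠ j → lf P i j v = 0 → cr (P.pt j - P.pt i) (rot n) ≠ 0) :
    (((crossedNbrs P X v ∩ {u | 0 < dt (u - v) n}).ncard : ℕ) : ZMod 2) =
      ind P X v (rot n) + ind P X v (-rot n) := by
  classical
  set m := rot n with hmdef
  have hn2 : 0 < ‖n‖ ^ 2 := by have := norm_pos_iff.2 hn; positivity
  have hd0 : ∀ t : ℝ, n + t • m ≠ 0 := fun t h => by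
    have := dt_add_rot n t
    rw [← hmdef, h] at this
    simp [dt] at this
    exact hn2.ne (by simpa using this)
  -- The slopes of the lines through `v`. Each line gives one slope, because it does not run along
  -- `m`.
  have hFfin : {t : ℝ | ∃ i j, i ≠ j ∧ lf P i j v = 0 ∧
      cr (P.pt j - P.pt i) (n + t • m) = 0}.Finite := by
    refine (Set.finite_range fun q : Fin N × Fin N =>
      -cr (P.pt q.2 - P.pt q.1) n / cr (P.pt q.2 - P.pt q.1) m).subset ?_
    rintro t ⟨i, j, hij, h0, h1⟩
    refine ⟨(i, j), ?_⟩
    have := hm i j hij h0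
    rw [cr_add_right, cr_smul_right] at h1
    simp only
    field_simp
    linarith
  set F := hFfin.toFinset with hF
  have memF : ∀ t, t ∈ F ↔ ∃ i j, i ≠ j ∧ lf P i j v = 0 ∧
      cr (P.pt j - P.pt i) (n + t • m) = 0 := fun t => by rw [hF]; simp
  have hsame : ∀ (x y : ℝ) (i j : Fin N), x < y → i ≠ j → lf P i j v = 0 → (∀ z, x ≤ z → z ≤ y →
      cr (P.pt j - P.pt i) (n + z • m) ≠ 0) →
      0 < cr (P.pt j - P.pt i) (n + x • m) * cr (P.pt j - P.pt i) (n + y • m) := by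
    intro x y i j hxy hij h0 hz
    have hb := hm i j hij h0
    simp only [cr_add_right, cr_smul_right] at hz ⊢
    set a := cr (P.pt j - P.pt i) n
    set b := cr (P.pt j - P.pt i) m
    have hτ : a + (-a / b) * b = 0 := by field_simp; ring
    have h1 : (a + x * b) * (a + y * b) = b ^ 2 * ((x - -a / b) * (y - -a / b)) := by
      field_simp; ring
    rw [h1]
    refine mul_pos (by positivity) ?_
    by_contra! hle
    by_cases h2 : x ≤ -a / b
    · by_cases h3 : -a / b ≤ y
      · exact hz _ h2 h3 hτ
      · nlinarith
    · nlinarith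
  have hcell : ∀ t, t ∉ F → ∃ c : Cell P, c.1 = sg P v (n + t • m) := by
    intro t ht
    obtain ⟨c, hc, -⟩ := cell_near P (hdisc t) (fun i j hij h0 h1 =>
      ht ((memF t).2 ⟨i, j, hij, h0, h1⟩))
    exact ⟨c, hc⟩
  -- Here `f` records whether the cell seen at slope `t` belongs to `X`, and `J` whether the edge at
  -- slope `t` is crossed; modulo two, `J` is the jump of `f`.
  set f : ℝ → ZMod 2 := fun t => ind P X v (n + t • m) with hf
  set J : ℝ → ZMod 2 := fun t => if ∃ u ∈ crossedNbrs P X v, ∃ r : ℝ, 0 < r ∧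
    u - v = r • (n + t • m) then 1 else 0 with hJ
  have hconst : ∀ x y, x < y → (∀ z ∈ F, x ≤ z → z ≤ y → False) → f x = f y := by
    intro x y hxy hz
    simp only [hf, ind]
    rw [sg_congr P (d := n + x • m) (d' := n + y • m)]
    intro i j hij h0
    exact hsame x y i j hxy hij h0 fun z h1 h2 h3 => hz z ((memF z).2 ⟨i, j, hij, h0, h3⟩) h1 h2
  -- The cells seen just before and just after the slope of a line are the two cells at the edge in
  -- that direction, as they lie on different sides of the line.
  have hjump : ∀ x ∈ F, ∀ y z, y < x → x < z → (∀ w ∈ F, y ≤ w → w ≤ z → w = x) →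
      J x = f y + f z := by
    intro x hx y z hyx hxz hw
    obtain ⟨i, j, hij, h0, hcr⟩ := (memF x).1 hx
    obtain ⟨u, hadj, r, hr, hu⟩ := exists_nbr P hv (hd0 x) (hdisc x) hij h0 hcr
    have hyF : y ∉ F := fun h => hyx.ne (hw y h le_rfl (by linarith))
    have hzF : z ∉ F := fun h => hxz.ne' (hw z h (by linarith) le_rfl)
    obtain ⟨cy, hcy⟩ := hcell y hyF
    obtain ⟨cz, hcz⟩ := hcell z hzF
    have hiy : incident P cy ⟨s(v, u), hadj⟩ := by
      refine sg_cell_mem_closure P hadj hr hu hcy fun i j hij h0 => ?_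
      by_cases h1 : cr (P.pt j - P.pt i) (n + x • m) = 0
      · rw [h1, mul_zero]
      · refine (hsame y x i j hyx hij h0 fun w h2 h3 h4 => ?_).le
        have := hw w ((memF w).2 ⟨i, j, hij, h0, h4⟩) h2 (by linarith)
        exact h1 (this ▸ h4)
    have hiz : incident P cz ⟨s(v, u), hadj⟩ := by
      refine sg_cell_mem_closure P hadj hr hu hcz fun i j hij h0 => ?_
      by_cases h1 : cr (P.pt j - P.pt i) (n + x • m) = 0
      · rw [h1, mul_zero]
      · rw [mul_comm]
        refine (hsame x z i j hxz hij h0 fun w h2 h3 h4 => ?_).le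
        have := hw w ((memF w).2 ⟨i, j, hij, h0, h4⟩) (by linarith) h3
        exact h1 (this ▸ h4)
    have hne : cy ≠ cz := by
      intro h
      have h1 : sg P v (n + y • m) i j = sg P v (n + z • m) i j := by rw [← hcy, ← hcz, h]
      rw [sg, sg, if_pos h0, if_pos h0] at h1
      have hb := hm i j hij h0
      simp only [cr_add_right, cr_smul_right] at h1 hcr
      set a := cr (P.pt j - P.pt i) n
      set b := cr (P.pt j - P.pt i) m
      have e1 : a + y * b = (y - x) * b := by linarith
      have e2 : a + z * b = (z - x) * b := by linarith
      rw [e1, e2, sign_mul, sign_mul, sign_neg (sub_neg.2 hyx), sign_pos (sub_pos.2 hxz)] at h1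
      rcases lt_or_gt_of_ne hb with h2 | h2
      · rw [sign_neg h2] at h1; exact absurd h1 (by decide)
      · rw [sign_pos h2] at h1; exact absurd h1 (by decide)
    have hJx : (∃ u ∈ crossedNbrs P X v, ∃ r : ℝ, 0 < r ∧ u - v = r • (n + x • m)) ↔
        Crosses P X ⟨s(v, u), hadj⟩ := by
      constructor
      · rintro ⟨u', ⟨hadj', hcross⟩, r', hr', hu'⟩
        obtain rfl := ray_unique P hadj hadj' hr hr' hu hu'
        exact hcross
      · intro h; exact ⟨u, ⟨hadj, h⟩, r, hr, hu⟩
    simp only [hJ, hJx, hf, ind_eq P hcy, ind_eq P hcz, crosses_iff P hne hiy hiz]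
    by_cases h1 : cy ∈ X <;> by_cases h2 : cz ∈ X <;> simp [h1, h2, CharTwo.add_self_eq_zero]
  have hm' : ∀ i j, i ≠ j → lf P i j v = 0 → cr (P.pt j - P.pt i) (-m) ≠ 0 :=
    fun i j hij h0 => by rw [cr_neg_right]; exact neg_ne_zero.2 (hm i j hij h0)
  -- So large that all slopes lie between `-z` and `z`, and that the extreme directions see the
  -- cells in directions `m` and `-m`.
  obtain ⟨z, ⟨⟨hz1, hz2⟩, hz3⟩, hz0⟩ := ((((sg_eventually P n hm).and (sg_eventually P n hm')).and
    ((F.image fun x => |x|).eventually_all.2 fun x _ => eventually_gt_atTop x)).and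
    (eventually_gt_atTop 0)).exists
  have hFz : ∀ x ∈ F, -z < x ∧ x < z := fun x hx => by
    have := hz3 |x| (Finset.mem_image_of_mem _ hx)
    exact abs_lt.1 this
  have hsum := sum_jumps F f J hconst hjump (y := -z) (z := z) (by linarith)
    (fun h => lt_irrefl _ (hFz _ h).1) (fun h => lt_irrefl _ (hFz _ h).2)
  have e1 : f z = ind P X v m := by simp only [hf, ind, hz1]
  have e2 : f (-z) = ind P X v (-m) := by
    simp only [hf, ind]
    rw [show n + -z • m = n + z • -m by module, hz2]
  rw [e1, e2, Finset.filter_true_of_mem hFz] at hsum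
  rw [add_comm, ← hsum]
  simp only [hJ]
  rw [Finset.sum_boole]
  congr 1
  rw [← Set.ncard_coe_finset]
  -- The slope is a bijection from the crossed neighbours in the half-plane to the slopes at which
  -- `J` is one.
  refine Set.ncard_congr (fun u _ => dt (u - v) m / dt (u - v) n) ?_ ?_ ?_
  · rintro u ⟨hu, hpos⟩
    obtain ⟨r, t, hr, hx⟩ := eq_smul_add_rot hpos
    have ht : dt (u - v) m / dt (u - v) n = t := by
      rw [hx, dt_smul_left, dt_smul_left, dt_add_rot, hmdef, dt_add_rot']; field_simp
    simp only [ht, Finset.coe_filter, Set.mem_ofPred_eq]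
    refine ⟨?_, u, hu, r, hr, hx⟩
    obtain ⟨hadj, -⟩ := hu
    obtain ⟨k, l, hkl, h1, h2⟩ := hadj.2.2.2.1
    refine (memF t).2 ⟨k, l, hkl, lf_eq_zero_of_mem_chord P h1, ?_⟩
    have h3 := lf_sub P k l u v
    rw [lf_eq_zero_of_mem_chord P h1, lf_eq_zero_of_mem_chord P h2, hx, cr_smul_right] at h3
    rcases mul_eq_zero.1 (h3.symm.trans (sub_zero 0)) with h4 | h4
    · exact absurd h4 hr.ne'
    · exact h4
  · rintro u u' ⟨hu, hpos⟩ ⟨hu', hpos'⟩ h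
    obtain ⟨r, t, hr, hx⟩ := eq_smul_add_rot hpos
    obtain ⟨r', t', hr', hx'⟩ := eq_smul_add_rot hpos'
    have ht : dt (u - v) m / dt (u - v) n = t := by
      rw [hx, dt_smul_left, dt_smul_left, dt_add_rot, hmdef, dt_add_rot']; field_simp
    have ht' : dt (u' - v) m / dt (u' - v) n = t' := by
      rw [hx', dt_smul_left, dt_smul_left, dt_add_rot, hmdef, dt_add_rot']; field_simp
    rw [ht, ht'] at h
    subst h
    exact ray_unique P hu.1 hu'.1 hr hr' hx hx'
  · intro t ht
    simp only [Finset.coe_filter, Set.mem_ofPred_eq] at ht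
    obtain ⟨-, u, hu, r, hr, hx⟩ := ht
    have hpos : 0 < dt (u - v) n := by
      rw [hx, dt_smul_left, hmdef, dt_add_rot]; positivity
    refine ⟨u, ⟨hu, hpos⟩, ?_⟩
    rw [hx, dt_smul_left, dt_smul_left, dt_add_rot, hmdef, dt_add_rot']; field_simp

end

/-! ### Parity at inner vertices and at points of the circle -/

section

variable {N : ℕ} (P : BoundaryPoints N)

theorem disc_eventually {v : Plane} (hv : ‖v‖ < 1) (d : Plane) :
    ∀ᶠ ε : ℝ in 𝓝[>] 0, ‖v + ε • d‖ < 1 := by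
  have : Continuous fun ε : ℝ => ‖v + ε • d‖ := by fun_prop
  have h0 := this.tendsto 0
  simp only [zero_smul, add_zero] at h0
  exact (h0.mono_left nhdsWithin_le_nhds).eventually_lt_const hv

/-- A direction that is orthogonal to none of finitely many vectors. -/
theorem exists_dt_ne_zero {T : Set Plane} (hT : T.Finite) :
    ∃ n : Plane, ∀ a ∈ T, a ≠ 0 → dt a n ≠ 0 := by
  -- Among the candidates `(1, s)`, each non-zero vector excludes at most one.
  have hfin : {s : ℝ | ∃ a ∈ T, a ≠ 0 ∧ dt a !₂[1, s] = 0}.Finite := by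
    refine (hT.image fun a => -a 0 / a 1).subset ?_
    rintro s ⟨a, ha, hne, h⟩
    refine ⟨a, ha, ?_⟩
    have h' : a 0 + a 1 * s = 0 := by simpa [dt] using h
    have h1 : a 1 ≠ 0 := by
      intro h1
      rw [h1, zero_mul, add_zero] at h'
      exact hne (plane_ext (by simpa using h') (by simpa using h1))
    simp only
    rw [div_eq_iff h1]; linarith
  obtain ⟨s, hs⟩ := hfin.exists_notMem
  exact ⟨!₂[1, s], fun a ha hne h => hs ⟨a, ha, hne, h⟩⟩

/-- Choose `n` orthogonal to no chord, so that no neighbour lies on the line through `v` orthogonal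
to `n`. The two half-planes contribute the same two indicator values, which cancel modulo two. -/
theorem crossedNbrs_parity_interior (X : Set (Cell P)) {v : Plane} (hv : v ∈ vertices P)
    (hv1 : ‖v‖ < 1) : Even (crossedNbrs P X v).ncard := by
  obtain ⟨n, hn⟩ : ∃ n : Plane, ∀ i j, i ≠ j → dt (P.pt j - P.pt i) n ≠ 0 := by
    obtain ⟨n, hn⟩ := exists_dt_ne_zero (Set.finite_range
      fun q : Fin N × Fin N => P.pt q.2 - P.pt q.1)
    exact ⟨n, fun i j hij => hn _ ⟨(i, j), rfl⟩ (sub_ne_zero.2 (P.injective.ne hij.symm))⟩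
  have hm : ∀ i j, i ≠ j → lf P i j v = 0 → cr (P.pt j - P.pt i) (rot n) ≠ 0 :=
    fun i j hij _ => by rw [cr_rot_right]; exact hn i j hij
  have hm' : ∀ i j, i ≠ j → lf P i j v = 0 → cr (P.pt j - P.pt i) (rot (-n)) ≠ 0 :=
    fun i j hij _ => by rw [cr_rot_right, dt_neg_right]; exact neg_ne_zero.2 (hn i j hij)
  have hnb : ∀ u ∈ crossedNbrs P X v, dt (u - v) n ≠ 0 := by
    rintro u ⟨hadj, -⟩ h
    obtain ⟨k, l, hkl, h1, h2⟩ := hadj.2.2.2.1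
    have h3 := lf_sub P k l u v
    rw [lf_eq_zero_of_mem_chord P h1, lf_eq_zero_of_mem_chord P h2, sub_zero] at h3
    obtain ⟨τ, hτ⟩ := eq_smul_of_cr_eq_zero (sub_ne_zero.2 (P.injective.ne hkl.symm)) h3.symm
    rw [hτ, dt_smul_left] at h
    rcases mul_eq_zero.1 h with h | h
    · rw [h, zero_smul] at hτ; exact hadj.1 (sub_eq_zero.1 hτ).symm
    · exact hn k l hkl h
  by_cases hemp : crossedNbrs P X v = ∅
  · simp [hemp]
  obtain ⟨u, hu⟩ := Set.nonempty_iff_ne_empty.2 hemp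
  have hn0 : n ≠ 0 := by
    rintro rfl; exact hnb u hu (by simp [dt])
  have h1 := half_parity P X hv hn0 (fun t => disc_eventually hv1 _) hm
  have h2 := half_parity P X hv (neg_ne_zero.2 hn0) (fun t => disc_eventually hv1 _) hm'
  have hun : crossedNbrs P X v = (crossedNbrs P X v ∩ {u | 0 < dt (u - v) n}) ∪
      (crossedNbrs P X v ∩ {u | 0 < dt (u - v) (-n)}) := by
    ext w
    constructor
    · intro hw
      rcases lt_or_gt_of_ne (hnb w hw) with h | h
      · right; refine ⟨hw, ?_⟩; change 0 < dt (w - v) (-n); rw [dt_neg_right]; linarith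
      · left; exact ⟨hw, h⟩
    · rintro (h | h) <;> exact h.1
  have hdis : Disjoint (crossedNbrs P X v ∩ {u | 0 < dt (u - v) n})
      (crossedNbrs P X v ∩ {u | 0 < dt (u - v) (-n)}) := by
    rw [Set.disjoint_left]
    rintro w ⟨-, h⟩ ⟨-, h'⟩
    change 0 < dt (w - v) n at h
    change 0 < dt (w - v) (-n) at h'
    rw [dt_neg_right] at h'; linarith
  rw [← ZMod.natCast_eq_zero_iff_even, hun, Set.ncard_union_eq hdis
    ((crossedNbrs_finite P X v).inter_of_left _) ((crossedNbrs_finite P X v).inter_of_left _)]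
  push_cast
  rw [h1, h2, rot_neg, neg_neg]
  have e1 := CharTwo.add_self_eq_zero (ind P X v (rot n))
  have e2 := CharTwo.add_self_eq_zero (ind P X v (-rot n))
  linear_combination e1 + e2

/-- The point of the circle in direction `-v + t m` from `v`. -/
theorem circle_point {v m : Plane} (hv : ‖v‖ = 1) (hm : m = rot v ∨ m = -rot v) (t : ℝ) :
    ‖v + (2 / (1 + t ^ 2)) • (-v + t • m)‖ = 1 := by
  rw [plane_norm_eq_one] at hv ⊢
  have h1 : 1 + t ^ 2 ≠ 0 := by positivity
  rcases hm with rfl | rfl <;>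
  · simp [rot]
    field_simp
    linear_combination ((t ^ 2 + 1) ^ 2) * hv

/-- Close to one of the points, the cells next to the circle are outer cells. -/
theorem outer_of_sg {k : Fin N} {m : Plane} (hm : m = rot (P.pt k) ∨ m = -rot (P.pt k))
    {c : Cell P} (hc : c.1 = sg P (P.pt k) m) : c ∈ outerCells P := by
  set v := P.pt k with hv
  have hcr : ∀ i j, i ≠ j → lf P i j v = 0 → cr (P.pt j - P.pt i) m ≠ 0 := by
    intro i j hij h0 h1
    have h2 := c.ne_zero hij
    rw [hc, sg, if_pos h0, h1, sign_zero] at h2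
    exact h2 rfl
  -- These points of the circle tend to `v`, while their direction from `v` tends to the tangent
  -- direction `m`; for large `t` they therefore have the signs of the cell.
  have htend : Tendsto (fun t : ℝ => v + (2 / (1 + t ^ 2)) • (-v + t • m)) atTop (𝓝 v) := by
    have h1 : Tendsto (fun t : ℝ => 1 + t ^ 2) atTop atTop :=
      tendsto_atTop_add_const_left _ _ (tendsto_pow_atTop two_ne_zero)
    have h2 : Tendsto (fun t : ℝ => 2 / (1 + t ^ 2)) atTop (𝓝 0) := h1.const_div_atTop 2
    have h3 : Tendsto (fun t : ℝ => 2 / (1 + t ^ 2) * t) atTop (𝓝 0) := by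
      refine squeeze_zero' ?_ ?_ ((tendsto_const_nhds (x := (2 : ℝ))).div_atTop tendsto_id)
      · filter_upwards [eventually_gt_atTop 0] with t ht; positivity
      · filter_upwards [eventually_gt_atTop 0] with t ht
        simp only [id]
        rw [div_mul_eq_mul_div, div_le_div_iff₀ (by positivity) ht]
        nlinarith
    have h4 : Tendsto (fun t : ℝ => v + ((2 / (1 + t ^ 2)) • (-v) + (2 / (1 + t ^ 2) * t) • m)) atTop
        (𝓝 (v + ((0 : ℝ) • (-v) + (0 : ℝ) • m))) :=
      tendsto_const_nhds.add ((h2.smul_const _).add (h3.smul_const _))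
    simp only [zero_smul, add_zero] at h4
    refine h4.congr fun t => ?_
    rw [smul_add, smul_smul]
  have hsgn : ∀ᶠ t : ℝ in atTop, ∀ i j, i ≠ j →
      0 < (c.1 i j : ℝ) * lf P i j (v + (2 / (1 + t ^ 2)) • (-v + t • m)) := by
    simp only [eventually_all]
    intro i j hij
    simp only [sign_mul_pos_iff (c.ne_zero hij)]
    simp only [hc]
    by_cases h0 : lf P i j v = 0
    · filter_upwards [sg_eventually P (-v) hcr] with t ht
      rw [← ht, lf_add_smul, h0, zero_add, sign_mul, sign_pos (by positivity), one_mul, sg,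
        if_pos h0]
    · have h1 := ((lf_continuous P i j).tendsto v).comp htend
      simp only [sg, if_neg h0]
      rcases lt_or_gt_of_ne h0 with h | h
      · filter_upwards [h1.eventually_lt_const h] with ε hε
        rw [sign_neg h]; exact sign_neg hε
      · filter_upwards [h1.eventually_const_lt h] with ε hε
        rw [sign_pos h]; exact sign_pos hε
  obtain ⟨t, ht⟩ := hsgn.exists
  have hn1 := circle_point (P.norm_pt k) hm t
  refine ⟨_, (mem_closure_region P).2 ⟨hn1.le, fun i j hij => (ht i j hij).le⟩, hn1, ?_⟩
  rintro ⟨l, hl⟩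
  by_cases hlk : l = k
  · subst hlk
    have h1 : (2 / (1 + t ^ 2)) • (-v + t • m) = 0 := by rw [← hv] at hl; simpa using hl
    have h2 : dt (-v + t • m) v = -1 := by
      have := pt_sq P l
      rcases hm with rfl | rfl <;> simp [dt, rot] <;> linear_combination -this
    rcases smul_eq_zero.1 h1 with h | h
    · have : (0 : ℝ) < 2 / (1 + t ^ 2) := by positivity
      exact this.ne' h
    · rw [h] at h2; simp [dt] at h2
  -- If the point were another of the given points, the line through it and `P.pt k` would vanish
  -- there, but the signs are strict.
  · have h1 := ht k l (Ne.symm hlk)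
    rw [← hl, lf_right, mul_zero] at h1
    exact lt_irrefl _ h1

/-- A chord is never tangent to the circle at one of its ends. -/
theorem cr_rot_pt_ne {i j k : Fin N} (hij : i ≠ j) (h : lf P i j (P.pt k) = 0) :
    cr (P.pt j - P.pt i) (rot (P.pt k)) ≠ 0 := by
  rw [cr_rot_right]
  have hk : k = i ∨ k = j := by
    by_contra! h'; exact lf_pt_ne P hij h'.1 h'.2 h
  have h1 := chord_len_pos P hij
  rw [plane_norm_sq] at h1
  have h2 := pt_sq P i
  have h3 := pt_sq P j
  simp at h1
  rcases hk with rfl | rfl <;> simp only [dt] <;> simp <;> nlinarith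

/-- The disk lies on one side of the tangent at `P.pt k`, so a single application of `half_parity`,
with the inner normal, counts all neighbours. -/
theorem crossedNbrs_parity_boundary (X : Set (Cell P)) (k : Fin N) :
    (((crossedNbrs P X (P.pt k)).ncard : ℕ) : ZMod 2) =
      ind P X (P.pt k) (rot (P.pt k)) + ind P X (P.pt k) (-rot (P.pt k)) := by
  have hsq := pt_sq P k
  have h := half_parity P X (pt_mem_vertices P k) (n := -P.pt k)
    (by rw [Ne, neg_eq_zero, ← norm_eq_zero, P.norm_pt]; exact one_ne_zero) (by
      intro t
      filter_upwards [Ioo_mem_nhdsGT (show (0 : ℝ) < 2 / (1 + t ^ 2) by positivity)] with ε hε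
      rw [plane_norm_lt_one]
      have h1 : ε * (1 + t ^ 2) < 2 := (lt_div_iff₀ (by positivity)).1 hε.2
      have h2 : (P.pt k + ε • (-P.pt k + t • rot (-P.pt k))) 0 ^ 2 +
          (P.pt k + ε • (-P.pt k + t • rot (-P.pt k))) 1 ^ 2 =
          ((1 - ε) ^ 2 + ε ^ 2 * t ^ 2) * (P.pt k 0 ^ 2 + P.pt k 1 ^ 2) := by
        simp [rot]; ring
      rw [h2, hsq]
      nlinarith [hε.1]) (by
      intro i j hij h0
      rw [rot_neg, cr_neg_right]
      exact neg_ne_zero.2 (cr_rot_pt_ne P hij h0))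
  rw [rot_neg, neg_neg, add_comm] at h
  rw [← h]
  congr 2
  refine (Set.inter_eq_left.2 ?_).symm
  rintro u ⟨hadj, -⟩
  change 0 < dt (u - P.pt k) (-P.pt k)
  have h1 := plane_norm_le_one.1 (vertex_norm_le P hadj.2.2.1)
  have h2 : 0 < ‖u - P.pt k‖ ^ 2 := by
    have := norm_pos_iff.2 (sub_ne_zero.2 hadj.1.symm); positivity
  rw [plane_norm_sq] at h2
  simp [dt] at h2 ⊢
  nlinarith

/-- The tangent direction itself leaves the disk. A direction tilted slightly inwards enters it and
sees the same signs. -/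
theorem end_cell {k : Fin N} {m : Plane} (hm : m = rot (P.pt k) ∨ m = -rot (P.pt k)) :
    ∃ c : Cell P, c.1 = sg P (P.pt k) m := by
  have hcr : ∀ i j, i ≠ j → lf P i j (P.pt k) = 0 → cr (P.pt j - P.pt i) m ≠ 0 := by
    intro i j hij h0
    have := cr_rot_pt_ne P hij h0
    rcases hm with rfl | rfl
    · exact this
    · rw [cr_neg_right]; exact neg_ne_zero.2 this
  obtain ⟨t, ht⟩ := (sg_eventually P (-P.pt k) hcr).exists
  have hsq := pt_sq P k
  obtain ⟨c, hc, -⟩ := cell_near P (v := P.pt k) (d := -P.pt k + t • m) (by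
      filter_upwards [Ioo_mem_nhdsGT (show (0 : ℝ) < 2 / (1 + t ^ 2) by positivity)] with ε hε
      rw [plane_norm_lt_one]
      have h1 : ε * (1 + t ^ 2) < 2 := (lt_div_iff₀ (by positivity)).1 hε.2
      have h2 : (P.pt k + ε • (-P.pt k + t • m)) 0 ^ 2 +
          (P.pt k + ε • (-P.pt k + t • m)) 1 ^ 2 =
          ((1 - ε) ^ 2 + ε ^ 2 * t ^ 2) * (P.pt k 0 ^ 2 + P.pt k 1 ^ 2) := by
        rcases hm with rfl | rfl <;> simp [rot] <;> ring
      rw [h2, hsq]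
      nlinarith [hε.1]) (by
      intro i j hij h0 h1
      have h2 := congrFun (congrFun ht i) j
      rw [sg, sg, if_pos h0, if_pos h0, h1, sign_zero] at h2
      exact hcr i j hij h0 (sign_eq_zero_iff.1 h2.symm))
  exact ⟨c, hc.trans ht⟩

-- The cells next to the circle are outer cells, where the membership in a cut is prescribed.
open Classical in
theorem ind_boundary {i j : Fin N} {X : Set (Cell P)}
    (hX : IsCut (outerCells P) (interval P i j) X) {k : Fin N} {m : Plane}
    (hm : m = rot (P.pt k) ∨ m = -rot (P.pt k)) :
    ind P X (P.pt k) m = if sg P (P.pt k) m i j = 1 then 1 else 0 := by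
  obtain ⟨c, hc⟩ := end_cell P hm
  have hout := outer_of_sg P hm hc
  have h1 : c ∈ X ↔ c.1 i j = 1 := hX ⟨c, hout⟩
  rw [ind_eq P hc]
  simp only [h1, hc]

/-- At a point of the circle off the line through `P.pt i` and `P.pt j`, the cells in both tangent
directions are on the same side of it and their contributions cancel. -/
theorem crossedNbrs_even {i j : Fin N} (hij : i ≠ j) {X : Set (Cell P)}
    (hX : IsCut (outerCells P) (interval P i j) X) {v : Plane} (hv : v ∈ vertices P)
    (hvi : v ≠ P.pt i) (hvj : v ≠ P.pt j) : Even (crossedNbrs P X v).ncard := by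
  rcases (vertex_norm_le P hv).lt_or_eq with h | h
  · exact crossedNbrs_parity_interior P X hv h
  obtain ⟨k, rfl⟩ := vertex_eq_pt P hv h
  rw [← ZMod.natCast_eq_zero_iff_even, crossedNbrs_parity_boundary,
    ind_boundary P hX (Or.inl rfl), ind_boundary P hX (Or.inr rfl)]
  have h0 : lf P i j (P.pt k) ≠ 0 :=
    lf_pt_ne P hij (fun h => hvi (by rw [h])) (fun h => hvj (by rw [h]))
  simp only [sg, if_neg h0]
  exact CharTwo.add_self_eq_zero _

/-- At `P.pt i` the two tangent directions point to different sides of the chord, so exactly one of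
the two cells is in the cut. -/
theorem crossedNbrs_odd {i j : Fin N} (hij : i ≠ j) {X : Set (Cell P)}
    (hX : IsCut (outerCells P) (interval P i j) X) : Odd (crossedNbrs P X (P.pt i)).ncard := by
  rw [← ZMod.natCast_eq_one_iff_odd, crossedNbrs_parity_boundary,
    ind_boundary P hX (Or.inl rfl), ind_boundary P hX (Or.inr rfl)]
  have h0 := lf_left P i j
  have h1 := cr_rot_pt_ne P hij h0
  simp only [sg, if_pos h0, cr_neg_right, Left.sign_neg]
  rcases lt_or_gt_of_ne h1 with h | h
  · rw [sign_neg h]; simp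
  · rw [sign_pos h]; simp

/-! ### From a cut to a path -/

/-- The subgraph of the edges that a cut crosses. -/
def cutGraph (X : Set (Cell P)) : SimpleGraph Plane where
  Adj u v := ∃ h : (chordGraph P).Adj u v, Crosses P X ⟨s(u, v), h⟩
  symm := ⟨by
    rintro u v ⟨h, hc⟩
    refine ⟨h.symm, ?_⟩
    have : (⟨s(v, u), h.symm⟩ : ChordEdge P) = ⟨s(u, v), h⟩ := Subtype.ext Sym2.eq_swap
    rw [this]; exact hc⟩
  loopless := ⟨fun _ h => h.1.1 rfl⟩

/-- The edges that a cut crosses connect the end points of the interval. -/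
theorem cutGraph_reachable {i j : Fin N} (hij : i ≠ j) {X : Set (Cell P)}
    (hX : IsCut (outerCells P) (interval P i j) X) :
    (cutGraph P X).Reachable (P.pt i) (P.pt j) := by
  classical
  by_contra hno
  set H := cutGraph P X with hH
  have hsub : {w | H.Reachable (P.pt i) w} ⊆ vertices P := by
    rintro w ⟨p⟩
    have : ∀ {a b : Plane}, H.Walk a b → a ∈ vertices P → b ∈ vertices P := by
      intro a b p
      induction p with
      | nil => exact id
      | cons h p ih => exact fun _ => ih h.1.2.2.1
    exact this p (pt_mem_vertices P i)
  have hfin := (vertices_finite P).subset hsub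
  let S := {w | H.Reachable (P.pt i) w}
  have : Fintype S := hfin.fintype
  let G : SimpleGraph S := H.induce S
  -- A connected component contains all neighbours of its vertices, so restricting to it keeps the
  -- degrees.
  have hdeg : ∀ w : S, G.degree w = (crossedNbrs P X w.1).ncard := by
    intro w
    rw [← SimpleGraph.card_neighborFinset_eq_degree, ← Set.ncard_coe_finset,
      SimpleGraph.coe_neighborFinset]
    refine Set.ncard_congr (fun u _ => u.1) ?_ ?_ ?_
    · intro u hu; exact hu
    · intro u u' _ _ h; exact Subtype.ext h
    · intro u hu
      have hadj : H.Adj w.1 u := hu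
      exact ⟨⟨u, w.2.trans hadj.reachable⟩, hadj, rfl⟩
  have hodd : Odd (G.degree ⟨P.pt i, SimpleGraph.Reachable.refl _⟩) := by
    rw [hdeg]; exact crossedNbrs_odd P hij hX
  -- By the handshake lemma the component has a second vertex of odd degree, and only `P.pt j`
  -- qualifies.
  obtain ⟨w, hw, hwo⟩ := G.exists_ne_odd_degree_of_exists_odd_degree _ hodd
  rw [hdeg] at hwo
  refine (Nat.not_even_iff_odd.2 hwo) (crossedNbrs_even P hij hX (hsub w.2) ?_ ?_)
  · intro h; exact hw (Subtype.ext h)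
  · intro h; exact hno (h ▸ w.2)

/-- Passing to a path rules out repeated edges, so its legs are bounded by those of the cut. -/
theorem exists_crossed_path {i j : Fin N} (hij : i ≠ j) {X : Set (Cell P)}
    (hX : IsCut (outerCells P) (interval P i j) X) :
    ∃ p : (chordGraph P).Walk (P.pt i) (P.pt j), p.edges.Nodup ∧
      ∀ e ∈ p.edges, ∃ h : e ∈ (chordGraph P).edgeSet, Crosses P X ⟨e, h⟩ := by
  classical
  obtain ⟨p⟩ := cutGraph_reachable P hij hX
  have hle : cutGraph P X ≤ chordGraph P := fun u v h => h.1
  refine ⟨(p.toPath.1).mapLe hle, ?_, ?_⟩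
  · rw [SimpleGraph.Walk.edges_mapLe_eq_edges]
    exact p.toPath.2.isTrail.edges_nodup
  · intro e he
    rw [SimpleGraph.Walk.edges_mapLe_eq_edges] at he
    have := SimpleGraph.Walk.edges_subset_edgeSet _ he
    induction e with | _ u v => exact this

theorem cutLegs_eq (δ : ℝ) (X : Set (Cell P)) :
    cutLegs (incident P) (netLegs P δ) X =
      ∑ e : ChordEdge P, (by classical exact if Crosses P X e then legs δ e.1 else 0) := by
  unfold cutLegs Crosses netLegs
  refine Finset.sum_congr rfl fun e _ => ?_
  split_ifs <;> rfl

theorem sum_legs_le_cutLegs {δ : ℝ} {X : Set (Cell P)} {l : List (Sym2 Plane)} (hl : l.Nodup)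
    (h : ∀ e ∈ l, ∃ h : e ∈ (chordGraph P).edgeSet, Crosses P X ⟨e, h⟩) :
    (l.map (legs δ)).sum ≤ cutLegs (incident P) (netLegs P δ) X := by
  classical
  rw [cutLegs_eq, ← List.sum_toFinset _ hl, ← Finset.sum_filter]
  calc ∑ e ∈ l.toFinset, legs δ e
      ≤ ∑ e ∈ (Finset.univ.filter fun e : ChordEdge P => Crosses P X e).map
          (Function.Embedding.subtype _), legs δ e := by
        refine Finset.sum_le_sum_of_subset fun e he => ?_
        obtain ⟨h1, h2⟩ := h e (List.mem_toFinset.1 he)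
        exact Finset.mem_map.2 ⟨⟨e, h1⟩, Finset.mem_filter.2 ⟨Finset.mem_univ _, h2⟩, rfl⟩
    _ = _ := by rw [Finset.sum_map]; rfl

/-- Repetitions in the list only increase the right-hand side, so any walk may be used here. -/
theorem cutLegs_le_sum_legs {δ : ℝ} {X : Set (Cell P)} {l : List (Sym2 Plane)}
    (h : ∀ e : ChordEdge P, Crosses P X e → e.1 ∈ l) :
    cutLegs (incident P) (netLegs P δ) X ≤ (l.map (legs δ)).sum := by
  classical
  rw [cutLegs_eq, ← Finset.sum_filter]
  calc _ = ∑ e ∈ (Finset.univ.filter fun e : ChordEdge P => Crosses P X e).map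
          (Function.Embedding.subtype _), legs δ e := by rw [Finset.sum_map]; rfl
    _ ≤ ∑ e ∈ l.toFinset, legs δ e := by
        refine Finset.sum_le_sum_of_subset fun e he => ?_
        obtain ⟨e', he', rfl⟩ := Finset.mem_map.1 he
        exact List.mem_toFinset.2 (h e' (Finset.mem_filter.1 he').2)
    _ = (l.dedup.map (legs δ)).sum := by
        rw [← List.sum_toFinset _ l.nodup_dedup, List.toFinset_eq_of_perm _ _ (List.Perm.refl _)]
        congr 1; ext; simp
    _ ≤ (l.map (legs δ)).sum :=
        List.Sublist.sum_le_sum ((List.dedup_sublist l).map _) (fun _ _ => Nat.zero_le _)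

end

section

/-! ### A walk in the chord graph bounds a cut -/

/-- The plane as the complex numbers. -/
def toC (q : Plane) : ℂ := ⟨q 0, q 1⟩

theorem toC_sub (a b : Plane) : toC (a - b) = toC a - toC b := by
  apply Complex.ext <;> simp [toC]

theorem toC_smul (r : ℝ) (a : Plane) : toC (r • a) = r * toC a := by
  apply Complex.ext <;> simp [toC]

theorem toC_injective : Function.Injective toC := fun _ _ h =>
  plane_ext (congrArg Complex.re h) (congrArg Complex.im h)

theorem toC_continuous : Continuous toC := by
  have : toC = fun q => ((q 0 : ℝ) : ℂ) + (q 1 : ℝ) * Complex.I := by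
    funext q; apply Complex.ext <;> simp [toC]
  rw [this]; fun_prop

theorem toC_sub_ne {u q : Plane} (h : u ≠ q) : toC u - toC q ≠ 0 :=
  sub_ne_zero.2 (toC_injective.ne h)

/-- The quotient whose argument is the angle at which one sees `u` and `v` from `q`. -/
def view (u v q : Plane) : ℂ := (toC v - toC q) / (toC u - toC q)

theorem view_continuousAt {u v q : Plane} (h : u ≠ q) : ContinuousAt (view u v) q := by
  refine ContinuousAt.div ?_ ?_ (toC_sub_ne h)
  · exact (continuous_const.sub toC_continuous).continuousAt
  · exact (continuous_const.sub toC_continuous).continuousAt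

/-- A quotient that is real and at most zero means that `q` sees `u` and `v` in opposite directions,
or equals `v`; in both cases it lies on the segment. -/
theorem view_mem_slitPlane {u v q : Plane} (hu : u ≠ q) (h : q ∉ segment ℝ u v) :
    view u v q ∈ Complex.slitPlane := by
  rw [Complex.mem_slitPlane_iff_not_le_zero, Complex.le_def]
  rintro ⟨hre, him⟩
  apply h
  set s := -(view u v q).re with hs
  have hs0 : 0 ≤ s := by simp at hre; linarith
  have hz : view u v q = ((-s : ℝ) : ℂ) := by
    apply Complex.ext
    · simp [hs]
    · simpa using him
  rw [view, div_eq_iff (toC_sub_ne hu), ← toC_sub, ← toC_sub, ← toC_smul] at hz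
  have h1 := toC_injective hz
  have h2 : (1 + s) • q = v + s • u := by
    have : v = q + -s • (u - q) := by rw [← h1]; abel
    rw [this]; module
  have h3 : 1 + s ≠ 0 := by positivity
  refine ⟨s / (1 + s), 1 / (1 + s), by positivity, by positivity, by field_simp; ring, ?_⟩
  have h4 : q = (1 / (1 + s)) • (v + s • u) := by rw [← h2, smul_smul]; field_simp; simp
  refine Eq.trans ?_ h4.symm
  rw [smul_add, smul_smul, add_comm]
  congr 2
  ring

variable {N : ℕ} (P : BoundaryPoints N)

/-- The angle that a walk describes as seen from `q`. -/
def turn {u v : Plane} (p : (chordGraph P).Walk u v) (q : Plane) : ℝ :=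
  (p.darts.map fun d => (view d.fst d.snd q).arg).sum

theorem turn_nil (u q : Plane) : turn P (.nil : (chordGraph P).Walk u u) q = 0 := by simp [turn]

theorem turn_cons {u w v : Plane} (h : (chordGraph P).Adj u w) (p : (chordGraph P).Walk w v)
    (q : Plane) : turn P (.cons h p) q = (view u w q).arg + turn P p q := by simp [turn]

theorem off_edge {u w q : Plane} (h : q ∉ edgeSegment s(u, w)) :
    u ≠ q ∧ w ≠ q ∧ q ∉ segment ℝ u w :=
  ⟨fun h' => h (h' ▸ left_mem_segment _ _ _), fun h' => h (h' ▸ right_mem_segment _ _ _), h⟩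

theorem turn_continuousAt {u v : Plane} (p : (chordGraph P).Walk u v) {q : Plane}
    (hq : ∀ e ∈ p.edges, q ∉ edgeSegment e) : ContinuousAt (turn P p) q := by
  induction p with
  | @nil w =>
    have : turn P (.nil : (chordGraph P).Walk w w) = fun _ => 0 := funext fun q => turn_nil P _ q
    rw [this]; exact continuousAt_const
  | @cons u w v h p ih =>
    have : turn P (.cons h p) = fun q => (view u w q).arg + turn P p q :=
      funext fun q => turn_cons P h p q
    rw [this]
    obtain ⟨h1, h2, h3⟩ := off_edge (hq s(u, w) (by simp))
    exact ((Complex.continuousAt_arg (view_mem_slitPlane h1 h3)).comp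
      (view_continuousAt h1)).add (ih fun e he => hq e (by simp [he]))

/-- The quotients along the walk telescope, so the turning angle is one of the arguments of the
quotient of the end points. -/
theorem turn_spec {u v : Plane} (p : (chordGraph P).Walk u v) {q : Plane} (hu : u ≠ q)
    (hq : ∀ e ∈ p.edges, q ∉ edgeSegment e) :
    ∃ r : ℝ, 0 < r ∧ view u v q = r * Complex.exp (turn P p q * Complex.I) := by
  induction p with
  | nil => exact ⟨1, one_pos, by simp [turn_nil, view, div_self (toC_sub_ne hu)]⟩
  | @cons u w v h p ih =>
    obtain ⟨h1, h2, h3⟩ := off_edge (hq s(u, w) (by simp))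
    obtain ⟨r, hr, hrv⟩ := ih h2 fun e he => hq e (by simp [he])
    have hne : view u w q ≠ 0 := div_ne_zero (toC_sub_ne h2) (toC_sub_ne h1)
    refine ⟨‖view u w q‖ * r, mul_pos (norm_pos_iff.2 hne) hr, ?_⟩
    have h4 : view u v q = view u w q * view w v q := by
      have e1 := toC_sub_ne h1
      have e2 := toC_sub_ne h2
      simp only [view]; field_simp
    rw [h4, hrv, turn_cons]
    nth_rewrite 1 [← Complex.norm_mul_exp_arg_mul_I (view u w q)]
    push_cast
    rw [add_mul, Complex.exp_add]; ring

/-- A point that sees both ends in the same direction is on their line but outside the chord, hence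
outside the disk. So the negated quotient has a continuous argument on the closed disk without the
two points. -/
theorem neg_view_mem_slitPlane {i j : Fin N} (hij : i ≠ j) {q : Plane} (hq : ‖q‖ ≤ 1)
    (hi : P.pt i ≠ q) (hj : P.pt j ≠ q) : -view (P.pt i) (P.pt j) q ∈ Complex.slitPlane := by
  rw [Complex.mem_slitPlane_iff_not_le_zero, Complex.le_def]
  rintro ⟨hre, him⟩
  set s := (view (P.pt i) (P.pt j) q).re with hs
  have hs0 : 0 ≤ s := by simp at hre; linarith
  have hz : view (P.pt i) (P.pt j) q = ((s : ℝ) : ℂ) := by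
    apply Complex.ext
    · simp [hs]
    · simpa using him
  rw [view, div_eq_iff (toC_sub_ne hi), ← toC_sub, ← toC_sub, ← toC_smul] at hz
  have h1 := toC_injective hz
  have h2 : lf P i j q = 0 := by
    have : lf P i j q = cr (P.pt i - q) (P.pt j - q) := by simp [lf, cr]; ring
    rw [this, h1, cr_smul_right, cr_self, mul_zero]
  obtain ⟨t, ht0, ht1, rfl⟩ := (mem_chord P).1 ((mem_chord_iff P hij hq).2 h2)
  have h3 : (1 - t + s * t) • (P.pt j - P.pt i) = 0 := by
    have e1 : P.pt j - (P.pt i + t • (P.pt j - P.pt i)) = (1 - t) • (P.pt j - P.pt i) := by module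
    have e2 : P.pt i - (P.pt i + t • (P.pt j - P.pt i)) = (-t) • (P.pt j - P.pt i) := by module
    rw [e1, e2, smul_smul, ← sub_eq_zero, ← sub_smul] at h1
    rw [← h1]; congr 1; ring
  rcases smul_eq_zero.1 h3 with h4 | h4
  · have : 0 ≤ s * t := mul_nonneg hs0 ht0
    have ht : t = 1 := by linarith
    apply hj; rw [ht]; simp
  · exact hij (P.injective (sub_eq_zero.1 h4).symm)

/-- The turning angle of a walk, compared with a continuous choice of the angle between its end
points. -/
def wind {i j : Fin N} (p : (chordGraph P).Walk (P.pt i) (P.pt j)) (q : Plane) : ℝ :=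
  turn P p q - (-view (P.pt i) (P.pt j) q).arg

/-- The points of the closed disk that a walk between two of the points does not meet. -/
def offWalk {i j : Fin N} (p : (chordGraph P).Walk (P.pt i) (P.pt j)) : Set Plane :=
  {q | ‖q‖ ≤ 1 ∧ P.pt i ≠ q ∧ P.pt j ≠ q ∧ ∀ e ∈ p.edges, q ∉ edgeSegment e}

theorem wind_continuousAt {i j : Fin N} (hij : i ≠ j) (p : (chordGraph P).Walk (P.pt i) (P.pt j))
    {q : Plane} (hq : q ∈ offWalk P p) : ContinuousAt (wind P p) q := by
  obtain ⟨h0, h1, h2, h3⟩ := hq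
  exact (turn_continuousAt P p h3).sub
    (ContinuousAt.comp (f := fun q => -view (P.pt i) (P.pt j) q)
      (Complex.continuousAt_arg (neg_view_mem_slitPlane P hij h0 h1 h2)) (view_continuousAt h1).neg)

/-- The two angles that are subtracted are arguments of opposite complex numbers. -/
theorem wind_spec {i j : Fin N} (p : (chordGraph P).Walk (P.pt i) (P.pt j))
    {q : Plane} (hq : q ∈ offWalk P p) : ∃ k : ℤ, wind P p q = Real.pi + k * (2 * Real.pi) := by
  obtain ⟨h0, h1, h2, h3⟩ := hq
  obtain ⟨r, hr, h⟩ := turn_spec P p h1 h3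
  set z := view (P.pt i) (P.pt j) q with hz
  have hz0 : z ≠ 0 := div_ne_zero (toC_sub_ne h2) (toC_sub_ne h1)
  have h4 := Complex.norm_mul_exp_arg_mul_I (-z)
  have hn : ‖-z‖ = r := by
    rw [norm_neg, h, norm_mul, Complex.norm_exp_ofReal_mul_I, mul_one, Complex.norm_real,
      Real.norm_of_nonneg hr.le]
  rw [hn] at h4
  have hr' : (r : ℂ) ≠ 0 := by exact_mod_cast hr.ne'
  have h5 : Complex.exp ((-z).arg * Complex.I) = -Complex.exp (turn P p q * Complex.I) := by
    apply mul_left_cancel₀ hr'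
    rw [h4, h]; ring
  have h6 : Complex.exp ((wind P p q - Real.pi : ℝ) * Complex.I) = 1 := by
    have : ((wind P p q - Real.pi : ℝ) : ℂ) * Complex.I =
        turn P p q * Complex.I - (-z).arg * Complex.I - Real.pi * Complex.I := by
      simp only [wind, ← hz]; push_cast; ring
    rw [this, Complex.exp_sub, Complex.exp_sub, h5, Complex.exp_pi_mul_I]
    have := Complex.exp_ne_zero (turn P p q * Complex.I)
    field_simp
  obtain ⟨k, hk⟩ := Complex.exp_eq_one_iff.1 h6
  refine ⟨k, ?_⟩
  have h7 : ((wind P p q - Real.pi : ℝ) : ℂ) = ((k * (2 * Real.pi) : ℝ) : ℂ) := by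
    apply mul_right_cancel₀ Complex.I_ne_zero
    rw [hk]; push_cast; ring
  have h8 := Complex.ofReal_injective h7
  linarith

theorem wind_eq_of_preconnected {i j : Fin N} (hij : i ≠ j)
    (p : (chordGraph P).Walk (P.pt i) (P.pt j)) {S : Set Plane} (hS : IsPreconnected S)
    (hsub : S ⊆ offWalk P p) {x y : Plane} (hx : x ∈ S) (hy : y ∈ S) :
    wind P p x = wind P p y := by
  have hc : ContinuousOn (wind P p) S := fun q hq =>
    (wind_continuousAt P hij p (hsub hq)).continuousWithinAt
  have key : ∀ x ∈ S, ∀ y ∈ S, ¬ wind P p x < wind P p y := by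
    intro x hx y hy hlt
    obtain ⟨k, hk⟩ := wind_spec P p (hsub hx)
    obtain ⟨l, hl⟩ := wind_spec P p (hsub hy)
    have hkl : k < l := by
      rw [hk, hl] at hlt
      have : (k : ℝ) < l := by nlinarith [Real.pi_pos]
      exact_mod_cast this
    have hkl' : (k : ℝ) + 1 ≤ l := by exact_mod_cast hkl
    -- Between two different odd multiples of `π` there is an even one, which cannot be a value.
    obtain ⟨q, hq, hqv⟩ := hS.intermediate_value hx hy hc
      (show Real.pi + k * (2 * Real.pi) + Real.pi ∈ Set.Icc (wind P p x) (wind P p y) by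
        rw [hk, hl]; constructor <;> nlinarith [Real.pi_pos])
    obtain ⟨n, hn⟩ := wind_spec P p (hsub hq)
    have h1 : (2 * (n : ℝ) - 2 * k - 1) * Real.pi = 0 := by linarith
    rcases mul_eq_zero.1 h1 with h | h
    · have : (2 * n - 2 * k - 1 : ℤ) = 0 := by exact_mod_cast h
      omega
    · exact Real.pi_ne_zero h
  exact le_antisymm (not_lt.1 (key y hy x hx)) (not_lt.1 (key x hx y hy))

theorem edgeSegment_subset_chord {e : Sym2 Plane} (he : e ∈ (chordGraph P).edgeSet) :
    ∃ k l, k ≠ l ∧ edgeSegment e ⊆ chord P k l := by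
  induction e with | _ u v =>
  obtain ⟨k, l, hkl, hu, hv⟩ := exists_chord_of_edge P he
  exact ⟨k, l, hkl, (convex_segment _ _).segment_subset hu hv⟩

theorem region_subset_offWalk {i j : Fin N} (p : (chordGraph P).Walk (P.pt i) (P.pt j))
    (c : Cell P) : region P c ⊆ offWalk P p := by
  intro q hq
  have h := hq.1
  refine ⟨h.1.le, ?_, ?_, ?_⟩
  · rintro rfl; have := h.1; rw [P.norm_pt] at this; exact lt_irrefl _ this
  · rintro rfl; have := h.1; rw [P.norm_pt] at this; exact lt_irrefl _ this
  · intro e he hqe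
    obtain ⟨k, l, hkl, hsub⟩ := edgeSegment_subset_chord P (p.edges_subset_edgeSet he)
    exact h.2 k l hkl (hsub hqe)

/-- A cell remains connected when one point of its closure is added, so its value can be read off at
any boundary point that the walk avoids. -/
theorem wind_eq_of_mem_closure {i j : Fin N} (hij : i ≠ j)
    (p : (chordGraph P).Walk (P.pt i) (P.pt j)) {c : Cell P} {x y : Plane}
    (hx : x ∈ region P c) (hy : y ∈ closure (region P c)) (hy' : y ∈ offWalk P p) :
    wind P p x = wind P p y := by
  refine wind_eq_of_preconnected P hij p (S := insert y (region P c)) ?_ ?_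
    (Set.mem_insert_of_mem _ hx) (Set.mem_insert _ _)
  · exact (region_convex P c).isPreconnected.subset_closure (Set.subset_insert _ _)
      (Set.insert_subset hy subset_closure)
  · exact Set.insert_subset hy' (region_subset_offWalk P p c)

/-- Seen from a point of the circle, the disk lies in a half-plane: the arguments on the right are
smaller than `π / 2` in modulus, so their difference needs no correction by `2 * π`. -/
theorem arg_view_circle {u v q : Plane} (hu : ‖u‖ ≤ 1) (hv : ‖v‖ ≤ 1) (hq : ‖q‖ = 1) (huq : u ≠ q)
    (hvq : v ≠ q) : (view u v q).arg = (1 - toC v / toC q).arg - (1 - toC u / toC q).arg := by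
  have hq0 : toC q ≠ 0 := by
    intro h
    rw [plane_norm_eq_one] at hq
    have h1 : q 0 = 0 := congrArg Complex.re h
    have h2 : q 1 = 0 := congrArg Complex.im h
    rw [h1, h2] at hq; simp at hq
  have hpos : ∀ u : Plane, ‖u‖ ≤ 1 → u ≠ q → |(1 - toC u / toC q).arg| < Real.pi / 2 := by
    intro u hu huq
    rw [Complex.abs_arg_lt_pi_div_two_iff]
    left
    rw [plane_norm_le_one] at hu
    rw [plane_norm_eq_one] at hq
    have hne : 0 < ‖u - q‖ ^ 2 := by
      have := norm_pos_iff.2 (sub_ne_zero.2 huq); positivity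
    rw [plane_norm_sq] at hne
    have : (1 - toC u / toC q).re = 1 - (u 0 * q 0 + u 1 * q 1) := by
      rw [Complex.sub_re, Complex.div_re, Complex.normSq_apply]
      simp only [toC, Complex.one_re]
      have : q 0 * q 0 + q 1 * q 1 = 1 := by linarith
      rw [this]; ring
    rw [this]
    simp at hne
    nlinarith
  have h1 : ∀ u : Plane, u ≠ q → 1 - toC u / toC q ≠ 0 := by
    intro u huq h
    rw [sub_eq_zero, eq_comm, div_eq_one_iff_eq hq0] at h
    exact huq (toC_injective h)
  have hA := abs_lt.1 (hpos u hu huq)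
  have hB := abs_lt.1 (hpos v hv hvq)
  have e : view u v q = (1 - toC v / toC q) * (1 - toC u / toC q)⁻¹ := by
    have e1 := h1 u huq
    have e2 := toC_sub_ne huq
    have e3 : toC q - toC u ≠ 0 := by rw [← neg_sub]; exact neg_ne_zero.2 e2
    rw [view, one_sub_div hq0, one_sub_div hq0]
    field_simp
    ring
  have hinv : ((1 - toC u / toC q)⁻¹).arg = -(1 - toC u / toC q).arg := by
    rw [Complex.arg_inv, if_neg]
    intro h; linarith [hA.2, Real.pi_pos]
  rw [e, Complex.arg_mul (h1 v hvq) (inv_ne_zero (h1 u huq)), hinv]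
  · ring
  · rw [hinv]; constructor <;> linarith [hA.1, hA.2, hB.1, hB.2]

/-- The exact differences of `arg_view_circle` telescope, so from the circle every walk with the
same ends describes the same angle. -/
theorem turn_circle {u v : Plane} (p : (chordGraph P).Walk u v) {q : Plane} (hq : ‖q‖ = 1)
    (hqv : q ∉ vertices P) (hv : v ∈ vertices P) :
    turn P p q = (1 - toC v / toC q).arg - (1 - toC u / toC q).arg := by
  induction p with
  | nil => rw [turn_nil]; ring
  | @cons u w v h p ih =>
    rw [turn_cons, ih hv, arg_view_circle (vertex_norm_le P h.2.1) (vertex_norm_le P h.2.2.1) hq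
      (fun h' => hqv (h' ▸ h.2.1)) (fun h' => hqv (h' ▸ h.2.2.1))]
    ring

theorem view_im_pos {i j : Fin N} {q : Plane} (h : P.pt i ≠ q) :
    SignType.sign (view (P.pt i) (P.pt j) q).im = SignType.sign (lf P i j q) := by
  have hn : 0 < Complex.normSq (toC (P.pt i) - toC q) := Complex.normSq_pos.2 (toC_sub_ne h)
  have : (view (P.pt i) (P.pt j) q).im = lf P i j q * (Complex.normSq (toC (P.pt i) - toC q))⁻¹ := by
    rw [view, Complex.div_im]
    field_simp
    simp [toC, lf, cr]
    ring
  rw [this, sign_mul, sign_pos (inv_pos.2 hn), mul_one]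

/-- The walk turns by the principal angle between its ends, and negating a complex number shifts its
argument by `-π` in the upper half-plane and by `π` in the lower. -/
theorem wind_circle {i j : Fin N} (p : (chordGraph P).Walk (P.pt i) (P.pt j))
    {q : Plane} (hq : ‖q‖ = 1) (hqv : q ∉ vertices P) :
    (0 < lf P i j q → wind P p q = Real.pi) ∧ (lf P i j q < 0 → wind P p q = -Real.pi) := by
  have h1 : P.pt i ≠ q := fun h => hqv (h ▸ pt_mem_vertices P i)
  have h2 : P.pt j ≠ q := fun h => hqv (h ▸ pt_mem_vertices P j)
  have ht := turn_circle P p hq hqv (pt_mem_vertices P j)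
  rw [← arg_view_circle (P.norm_pt i).le (P.norm_pt j).le hq h1 h2] at ht
  have hs := view_im_pos P (j := j) h1
  unfold wind
  rw [ht]
  constructor
  · intro h
    rw [sign_pos h] at hs
    rw [Complex.arg_neg_eq_arg_sub_pi_of_im_pos (sign_eq_one_iff.1 hs)]; ring
  · intro h
    rw [sign_neg h] at hs
    rw [Complex.arg_neg_eq_arg_add_pi_of_im_neg (sign_eq_neg_one_iff.1 hs)]; ring

theorem openSegment_subset_of_mem {u v x : Plane} (hx : x ∈ openSegment ℝ u v) :
    openSegment ℝ x u ⊆ openSegment ℝ u v := by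
  obtain ⟨a, b, ha, hb, hab, rfl⟩ := hx
  rintro _ ⟨c, d, hc, hd, hcd, rfl⟩
  refine ⟨c * a + d, c * b, by positivity, by positivity, ?_, by module⟩
  linear_combination c * hab + hcd

/-- Two edges through a point that is not a vertex are equal. -/
theorem edge_eq_of_mem {e e' : Sym2 Plane} (he : e ∈ (chordGraph P).edgeSet)
    (he' : e' ∈ (chordGraph P).edgeSet) {x : Plane} (hx : x ∉ vertices P) (hxe : x ∈ edgeSegment e)
    (hxe' : x ∈ edgeSegment e') : e = e' := by
  induction e with | _ u v =>
  induction e' with | _ u' v' =>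
  obtain ⟨k, l, hkl, hu, hv⟩ := exists_chord_of_edge P he
  obtain ⟨k', l', hkl', hu', hv'⟩ := exists_chord_of_edge P he'
  have hadj : (chordGraph P).Adj u v := he
  have hadj' : (chordGraph P).Adj u' v' := he'
  have hxk : x ∈ chord P k l := (convex_segment _ _).segment_subset hu hv hxe
  have hxk' : x ∈ chord P k' l' := (convex_segment _ _).segment_subset hu' hv' hxe'
  have hs : s(k, l) = s(k', l') := by
    by_contra hne
    exact hx (Or.inr ⟨k, l, k', l', hkl, hkl', hne, hxk, hxk'⟩)
  have hc : chord P k' l' = chord P k l := by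
    rcases Sym2.eq_iff.1 hs with ⟨rfl, rfl⟩ | ⟨rfl, rfl⟩
    · rfl
    · exact chord_swap P _ _
  rw [hc] at hu' hv'
  have hne : ∀ {w : Plane}, w ∈ vertices P → x ≠ w := fun hw h => hx (h ▸ hw)
  have hd0 := sub_ne_zero.2 (P.injective.ne hkl.symm)
  have hpar : ∀ {w : Plane}, w ∈ chord P k l → ∃ r : ℝ, w - x = r • (P.pt l - P.pt k) := by
    intro w hw
    apply eq_smul_of_cr_eq_zero hd0
    rw [← lf_sub, lf_eq_zero_of_mem_chord P hw, lf_eq_zero_of_mem_chord P hxk, sub_zero]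
  -- With `x` as origin on the common chord, each edge has one end on either side, and no vertex
  -- lies between `x` and these ends.
  have hopen : ∀ {u v : Plane}, (chordGraph P).Adj u v → x ∈ segment ℝ u v →
      ∃ a b : ℝ, 0 < a ∧ 0 < b ∧ a • (u - x) + b • (v - x) = 0 ∧
        (∀ y ∈ openSegment ℝ x u, y ∉ vertices P) ∧ ∀ y ∈ openSegment ℝ x v, y ∉ vertices P := by
    intro u v hadj hx1
    have hx2 : x ∈ openSegment ℝ u v :=
      mem_openSegment_of_ne_left_right (hne hadj.2.1).symm (hne hadj.2.2.1).symm hx1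
    obtain ⟨a, b, ha, hb, hab, h⟩ := id hx2
    refine ⟨a, b, ha, hb, ?_, ?_, ?_⟩
    · have h5 : x = (a + b) • x := by rw [hab, one_smul]
      rw [smul_sub, smul_sub, sub_add_sub_comm, h, ← add_smul, ← h5, sub_self]
    · intro y hy
      refine hadj.2.2.2.2 y ?_
      exact openSegment_subset_of_mem hx2 hy
    · intro y hy
      refine hadj.2.2.2.2 y ?_
      rw [openSegment_symm] at hx2 ⊢
      exact openSegment_subset_of_mem hx2 hy
  have key : ∀ {w w' : Plane} {r r' : ℝ}, w ∈ vertices P → w' ∈ vertices P →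
      (∀ y ∈ openSegment ℝ x w, y ∉ vertices P) → (∀ y ∈ openSegment ℝ x w', y ∉ vertices P) →
      w - x = r • (P.pt l - P.pt k) → w' - x = r' • (P.pt l - P.pt k) → 0 < r * r' → w = w' := by
    have aux : ∀ {w w' : Plane} {r r' : ℝ}, w ∈ vertices P →
      (∀ y ∈ openSegment ℝ x w', y ∉ vertices P) →
      w - x = r • (P.pt l - P.pt k) → w' - x = r' • (P.pt l - P.pt k) → 0 < r * r' →
      ¬ r / r' < 1 := by
      intro w w' r r' hw hno h1 h2 hpos hlt
      have hr' : r' ≠ 0 := by rintro rfl; simp at hpos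
      refine hno w ?_ hw
      rw [openSegment_eq_image']
      refine ⟨r / r', ⟨?_, hlt⟩, ?_⟩
      · have : r / r' = r * r' / r' ^ 2 := by field_simp
        rw [this]; positivity
      · simp only
        rw [h2, smul_smul, div_mul_cancel₀ _ hr', ← h1]; abel
    intro w w' r r' hw hw' hno hno' h1 h2 hpos
    have hr : r ≠ 0 := by rintro rfl; simp at hpos
    have hr' : r' ≠ 0 := by rintro rfl; simp at hpos
    have a1 := aux hw hno' h1 h2 hpos
    have a2 := aux hw' hno h2 h1 (by linarith)
    have hrr : r = r' := by
      rw [not_lt] at a1 a2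
      rcases pos_and_pos_or_neg_and_neg_of_mul_pos hpos with ⟨p1, p2⟩ | ⟨p1, p2⟩
      · rw [le_div_iff₀ p2] at a1; rw [le_div_iff₀ p1] at a2; linarith
      · rw [le_div_iff_of_neg p2] at a1; rw [le_div_iff_of_neg p1] at a2; linarith
    rw [hrr, ← h2] at h1
    exact sub_left_injective h1
  obtain ⟨r, hr⟩ := hpar hu
  obtain ⟨s, hs⟩ := hpar hv
  obtain ⟨r', hr'⟩ := hpar hu'
  obtain ⟨s', hs'⟩ := hpar hv'
  obtain ⟨a, b, ha, hb, h1, h2, h3⟩ := hopen hadj hxe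
  obtain ⟨a', b', ha', hb', h1', h2', h3'⟩ := hopen hadj' hxe'
  have hrs : a * r + b * s = 0 := by
    rw [hr, hs, smul_smul, smul_smul, ← add_smul] at h1
    exact (smul_eq_zero.1 h1).resolve_right hd0
  have hrs' : a' * r' + b' * s' = 0 := by
    rw [hr', hs', smul_smul, smul_smul, ← add_smul] at h1'
    exact (smul_eq_zero.1 h1').resolve_right hd0
  have nz : ∀ {w : Plane} {r : ℝ}, w ∈ vertices P → w - x = r • (P.pt l - P.pt k) → r ≠ 0 := by
    rintro w r hw h rfl
    rw [zero_smul] at h; exact hne hw (sub_eq_zero.1 h).symm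
  have hr0 := nz hadj.2.1 hr
  have hr0' := nz hadj'.2.1 hr'
  have hs_eq : s = -(a / b) * r := by field_simp; linarith
  have hs_eq' : s' = -(a' / b') * r' := by field_simp; linarith
  have hab : 0 < a / b := div_pos ha hb
  have hab' : 0 < a' / b' := div_pos ha' hb'
  -- The nearest vertex on each side of `x` is unique; the sign tells which ends of the two edges
  -- correspond.
  rcases lt_or_gt_of_ne (mul_ne_zero hr0 hr0') with h | h
  · have e1 := key hadj.2.1 hadj'.2.2.1 h2 h3' hr hs' (by
      rw [hs_eq']; have := mul_pos hab' (neg_pos.2 h); linarith)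
    have e2 := key hadj.2.2.1 hadj'.2.1 h3 h2' hs hr' (by
      rw [hs_eq]; have := mul_pos hab (neg_pos.2 h); linarith)
    rw [e1, e2]; exact Sym2.eq_swap
  · have e1 := key hadj.2.1 hadj'.2.1 h2 h2' hr hr' h
    have e2 := key hadj.2.2.1 hadj'.2.2.1 h3 h3' hs hs' (by
      rw [hs_eq, hs_eq']; have := mul_pos (mul_pos hab hab') h; linarith)
    rw [e1, e2]

/-- The cut consists of the cells where `wind` is `π`, the value on the arc to the left of the
chord. Two cells at an edge that the walk does not use share the midpoint of the edge, hence have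
the same value. -/
theorem exists_cut_of_walk {i j : Fin N} (hij : i ≠ j)
    (p : (chordGraph P).Walk (P.pt i) (P.pt j)) :
    ∃ X, IsCut (outerCells P) (interval P i j) X ∧
      ∀ e : ChordEdge P, Crosses P X e → e.1 ∈ p.edges := by
  refine ⟨{c | ∀ q ∈ region P c, wind P p q = Real.pi}, ?_, ?_⟩
  · rintro ⟨c, x, hx, hx1, hxP⟩
    have hxv : x ∉ vertices P := fun h => by
      obtain ⟨k, rfl⟩ := vertex_eq_pt P h hx1; exact hxP ⟨k, rfl⟩
    have hoff : x ∈ offWalk P p := by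
      refine ⟨hx1.le, fun h => hxP ⟨i, h⟩, fun h => hxP ⟨j, h⟩, fun e he h => ?_⟩
      obtain ⟨k, l, hkl, hsub⟩ := edgeSegment_subset_chord P (p.edges_subset_edgeSet he)
      rcases eq_pt_of_mem_chord P (hsub h) hx1 with h | h
      exacts [hxP ⟨k, h.symm⟩, hxP ⟨l, h.symm⟩]
    have hlf : lf P i j x ≠ 0 := fun h => by
      rcases eq_pt_of_mem_chord P ((mem_chord_iff P hij hx1.le).2 h) hx1 with h | h
      exacts [hxP ⟨i, h.symm⟩, hxP ⟨j, h.symm⟩]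
    have hsg := (sign_mul_nonneg_iff (c.ne_zero hij) hlf).1
      (((mem_closure_region P).1 hx).2 i j hij)
    change (∀ q ∈ region P c, wind P p q = Real.pi) ↔ c.1 i j = 1
    constructor
    · intro h
      obtain ⟨q, hq⟩ := region_nonempty P c
      have h1 := wind_eq_of_mem_closure P hij p hq hx hoff
      rw [h q hq] at h1
      rcases lt_or_gt_of_ne hlf with h2 | h2
      · rw [(wind_circle P p hx1 hxv).2 h2] at h1
        linarith [Real.pi_pos]
      · rw [← hsg, sign_pos h2]
    · intro h q hq
      rw [wind_eq_of_mem_closure P hij p hq hx hoff]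
      exact (wind_circle P p hx1 hxv).1 (sign_eq_one_iff.1 (hsg.trans h))
  · rintro ⟨e, he⟩ ⟨⟨c, hc, hce⟩, ⟨c', hc', hce'⟩⟩
    by_contra hno
    apply hc'
    intro q' hq'
    obtain ⟨q, hq⟩ := region_nonempty P c
    obtain ⟨x, hxe, hx1, hxv⟩ : ∃ x ∈ edgeSegment e, ‖x‖ < 1 ∧ x ∉ vertices P := by
      induction e with | _ u v =>
      exact ⟨midpoint ℝ u v, openSegment_subset_segment _ _ _ midpoint_mem_openSegment',
        openSegment_norm_lt he.1 (vertex_norm_le P he.2.1) (vertex_norm_le P he.2.2.1)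
          midpoint_mem_openSegment', he.2.2.2.2 _ midpoint_mem_openSegment'⟩
    have hoff : x ∈ offWalk P p := by
      refine ⟨hx1.le, fun h => hxv (h ▸ pt_mem_vertices P i),
        fun h => hxv (h ▸ pt_mem_vertices P j), fun e' he' h => hno ?_⟩
      have := edge_eq_of_mem P he (p.edges_subset_edgeSet he') hxv hxe h
      subst this
      exact he'
    rw [wind_eq_of_mem_closure P hij p hq' (hce' hxe) hoff,
      ← wind_eq_of_mem_closure P hij p hq (hce hxe) hoff]
    exact hc q hq

/-- A minimal cut of the network for an interval is a minimal walk in the chord graph. -/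
theorem netMinCut_eq_pathLegs (δ : ℝ) {i j : Fin N} (hij : i ≠ j) :
    netMinCut P δ (interval P i j) = pathLegs P δ (P.pt i) (P.pt j) := by
  obtain ⟨p0, -⟩ := exists_straight_walk P hij
    ⟨pt_mem_vertices P i, pt_mem_chord_left P i j⟩ ⟨pt_mem_vertices P j, pt_mem_chord_right P i j⟩
  apply le_antisymm
  · refine le_csInf ⟨_, p0, rfl⟩ ?_
    rintro n ⟨p, rfl⟩
    obtain ⟨X, hX, hcr⟩ := exists_cut_of_walk P hij p
    refine le_trans (Nat.sInf_le ?_) (cutLegs_le_sum_legs P hcr)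
    exact ⟨X, hX, rfl⟩
  · obtain ⟨X0, hX0, -⟩ := exists_cut_of_walk P hij p0
    refine le_csInf ⟨_, X0, hX0, rfl⟩ ?_
    rintro n ⟨X, hX, rfl⟩
    obtain ⟨p, hp, hcr⟩ := exists_crossed_path P hij hX
    refine le_trans (Nat.sInf_le ?_) (sum_legs_le_cutLegs P hp hcr)
    exact ⟨p, rfl⟩

end

section

variable {N : ℕ} (P : BoundaryPoints N)

/-! ### Minimal walks are straight at high resolution -/

/-- The lengths of sets of edges do not come arbitrarily close from above to the distances of
vertices. -/
theorem exists_length_gap : ∃ g : ℝ, 0 < g ∧ ∀ S : Finset (Sym2 Plane),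
    (∀ e ∈ S, e ∈ (chordGraph P).edgeSet) → ∀ u ∈ vertices P, ∀ v ∈ vertices P,
    dist u v < ∑ e ∈ S, edgeLength e → dist u v + g ≤ ∑ e ∈ S, edgeLength e := by
  classical
  have hE : (chordGraph P).edgeSet.Finite := Set.toFinite _
  -- The positive excesses form a finite set, and its least element is the gap.
  set T : Set ℝ := {x | 0 < x ∧ ∃ S : Finset (Sym2 Plane), (∀ e ∈ S, e ∈ (chordGraph P).edgeSet) ∧
    ∃ u ∈ vertices P, ∃ v ∈ vertices P, x = (∑ e ∈ S, edgeLength e) - dist u v} with hT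
  have hfin : T.Finite := by
    refine (((hE.toFinset.powerset.finite_toSet.prod
      ((vertices_finite P).prod (vertices_finite P)))).image fun q =>
      (∑ e ∈ q.1, edgeLength e) - dist q.2.1 q.2.2).subset ?_
    rintro x ⟨-, S, hS, u, hu, v, hv, rfl⟩
    refine ⟨(S, u, v), ⟨?_, hu, hv⟩, rfl⟩
    simp only [Finset.coe_powerset, Set.mem_preimage, Set.mem_powerset_iff]
    intro e he
    exact Finset.mem_coe.2 (hE.mem_toFinset.2 (hS e he))
  rcases T.eq_empty_or_nonempty with h | h
  · refine ⟨1, one_pos, fun S hS u hu v hv hlt => ?_⟩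
    have : (∑ e ∈ S, edgeLength e) - dist u v ∈ T := ⟨sub_pos.2 hlt, S, hS, u, hu, v, hv, rfl⟩
    rw [h] at this; exact absurd this (Set.notMem_empty _)
  · obtain ⟨g, hg, hmin⟩ := hfin.exists_minimal h
    refine ⟨g, hg.1, fun S hS u hu v hv hlt => ?_⟩
    have hx : (∑ e ∈ S, edgeLength e) - dist u v ∈ T := ⟨sub_pos.2 hlt, S, hS, u, hu, v, hv, rfl⟩
    by_contra! hlt'
    have := hmin hx (by linarith)
    linarith

/-- Omitting an element of positive weight decreases the sum. It serves to compare the edges of a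
minimal walk with the same list without repetitions. -/
theorem eq_of_sublist_of_sum_le {α : Type*} {f : α → ℕ} {l₁ l₂ : List α} (h : l₁.Sublist l₂)
    (hf : ∀ x ∈ l₂, 1 ≤ f x) (hsum : (l₂.map f).sum ≤ (l₁.map f).sum) : l₁ = l₂ := by
  induction h with
  | slnil => rfl
  | @cons l₁ l₂ a h ih =>
    exfalso
    have h1 := List.Sublist.sum_le_sum (h.map f) (fun _ _ => Nat.zero_le _)
    have h2 := hf a (by simp)
    rw [List.map_cons, List.sum_cons] at hsum
    omega
  | @cons_cons l₁ l₂ a h ih =>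
    rw [List.map_cons, List.sum_cons, List.map_cons, List.sum_cons] at hsum
    rw [ih (fun x hx => hf x (by simp [hx])) (by omega)]

theorem sum_toFinset_eq_dedup {α : Type*} [DecidableEq α] (f : α → ℕ) (l : List α) :
    ∑ e ∈ l.toFinset, f e = (l.dedup.map f).sum := by
  rw [← List.sum_toFinset _ l.nodup_dedup]
  congr 1; ext; simp

/-- A resolution at which the lengths of different routes are told apart. -/
def IsFine (δ : ℝ) : Prop := 0 < δ ∧ ∃ g : ℝ, δ * (Nat.card (ChordEdge P) + 1) ≤ g ∧
  ∀ S : Finset (Sym2 Plane), (∀ e ∈ S, e ∈ (chordGraph P).edgeSet) → ∀ u ∈ vertices P,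
    ∀ v ∈ vertices P, dist u v < ∑ e ∈ S, edgeLength e → dist u v + g ≤ ∑ e ∈ S, edgeLength e

variable {P}

/-- The gap, applied to a single edge and the distance of a vertex to itself, bounds the length of
every edge from below by `g`, which is at least `δ`. -/
theorem IsFine.one_le_legs {δ : ℝ} (h : IsFine P δ) {e : Sym2 Plane}
    (he : e ∈ (chordGraph P).edgeSet) : 1 ≤ legs δ e := by
  obtain ⟨hδ, g, hg, hgap⟩ := h
  have hlen : g ≤ edgeLength e := by
    induction e with | _ u v =>
    have h1 := hgap {s(u, v)} (by simpa using he) u he.2.1 u he.2.1 (by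
      rw [dist_self, Finset.sum_singleton]; exact dist_pos.2 he.1)
    rwa [dist_self, zero_add, Finset.sum_singleton] at h1
  apply Nat.le_floor
  rw [Nat.cast_one, le_div_iff₀ hδ]
  have : 0 ≤ δ * Nat.card (ChordEdge P) := by positivity
  linarith

/-- Removing the loops leaves a path through some of the same edges, each used once; a repeated edge
would cost at least one leg more. -/
theorem IsFine.edges_nodup {δ : ℝ} (h : IsFine P δ) {u v : Plane} {q : (chordGraph P).Walk u v}
    (hq : IsMinWalk P δ q) : q.edges.Nodup := by
  classical
  have h1 : walkLegs P δ q ≤ ∑ e ∈ q.edges.toFinset, legs δ e := by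
    refine (hq q.bypass).trans ?_
    rw [walkLegs, ← List.sum_toFinset _ q.bypass_isPath.isTrail.edges_nodup]
    refine Finset.sum_le_sum_of_subset fun e he => ?_
    rw [List.mem_toFinset] at he ⊢
    exact q.edges_bypass_subset_edges he
  rw [sum_toFinset_eq_dedup] at h1
  have := eq_of_sublist_of_sum_le (List.dedup_sublist q.edges)
    (fun e he => h.one_le_legs (q.edges_subset_edgeSet he)) h1
  exact List.dedup_eq_self.1 this

/-- Without repeated edges the rounding error is at most `δ` times the number of all edges, which is
less than the gap. The length therefore cannot exceed the distance. -/
theorem IsFine.walkLength_eq {δ : ℝ} (h : IsFine P δ) {i j : Fin N} (hij : i ≠ j) {u v : Plane}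
    (hu : u ∈ vertices P ∩ chord P i j) (hv : v ∈ vertices P ∩ chord P i j)
    {q : (chordGraph P).Walk u v} (hq : IsMinWalk P δ q) : walkLength P q ≤ dist u v := by
  classical
  have hnd := h.edges_nodup hq
  obtain ⟨hδ, g, hg, hgap⟩ := h
  have h1 : walkLength P q = ∑ e ∈ q.edges.toFinset, edgeLength e :=
    (List.sum_toFinset _ hnd).symm
  have h2 := minWalk_legs_le P hij hδ hu hv hq
  have h3 := walkLength_le P hδ q
  have h4 : q.length ≤ Nat.card (ChordEdge P) := by
    rw [← SimpleGraph.Walk.length_edges, ← List.toFinset_card_of_nodup hnd, ← Set.ncard_coe_finset]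
    exact Set.ncard_le_ncard (t := (chordGraph P).edgeSet)
      (fun e he => q.edges_subset_edgeSet (List.mem_toFinset.1 he)) (Set.toFinite _)
  by_contra! hlt
  have h5 := hgap q.edges.toFinset (fun e he => q.edges_subset_edgeSet (List.mem_toFinset.1 he))
    u hu.1 v hv.1 (h1 ▸ hlt)
  rw [← h1] at h5
  have h6 : (q.length : ℝ) * δ ≤ Nat.card (ChordEdge P) * δ :=
    mul_le_mul_of_nonneg_right (by exact_mod_cast h4) hδ.le
  linarith

/-- Equality must hold in the triangle inequality at every step, and the distance to `v` strictly
decreases. -/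
theorem geodesic_walk {u v : Plane} (p : (chordGraph P).Walk u v)
    (hp : walkLength P p ≤ dist u v) :
    p.support.Nodup ∧ ∀ x ∈ p.support, dist u x + dist x v = dist u v := by
  induction p with
  | nil => simp
  | @cons u w v h p ih =>
    have h1 : walkLength P (.cons h p) = dist u w + walkLength P p := by
      simp [walkLength, edgeLength_mk]
    have h2 := dist_le_walkLength P p
    have h3 := dist_triangle u w v
    obtain ⟨h4, h5⟩ := ih (by linarith)
    have h6 : 0 < dist u w := dist_pos.2 h.1
    constructor
    · rw [SimpleGraph.Walk.support_cons, List.nodup_cons]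
      refine ⟨fun hu => ?_, h4⟩
      have := h5 u hu
      have := dist_nonneg (x := w) (y := u)
      linarith
    · intro x hx
      rw [SimpleGraph.Walk.support_cons, List.mem_cons] at hx
      rcases hx with rfl | hx
      · simp
      · have h7 := h5 x hx
        have h8 := dist_triangle u w x
        have h9 := dist_triangle u x v
        linarith

theorem support_subset_vertices {u v : Plane} (p : (chordGraph P).Walk u v) (hu : u ∈ vertices P) :
    ∀ x ∈ p.support, x ∈ vertices P := by
  induction p with
  | nil => simpa using hu
  | @cons u w v h p ih =>
    intro x hx
    rw [SimpleGraph.Walk.support_cons, List.mem_cons] at hx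
    rcases hx with rfl | hx
    exacts [hu, ih h.2.2.1 x hx]

theorem IsFine.support_subset {δ : ℝ} (h : IsFine P δ) {i j : Fin N} (hij : i ≠ j) {u v : Plane}
    (hu : u ∈ vertices P ∩ chord P i j) (hv : v ∈ vertices P ∩ chord P i j)
    {q : (chordGraph P).Walk u v} (hq : IsMinWalk P δ q) :
    ∀ x ∈ q.support, x ∈ vertices P ∩ chord P i j := by
  intro x hx
  refine ⟨support_subset_vertices q hu.1 x hx, ?_⟩
  have h1 := (geodesic_walk q (h.walkLength_eq hij hu hv hq)).2 x hx
  rw [dist_add_dist_eq_iff, ← mem_segment_iff_wbtw] at h1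
  exact (convex_segment _ _).segment_subset hu.2 hv.2 h1

/-- The walk visits distinct vertices of the chord. Counting its two ends, a chord has one vertex
more than it has segments, and a walk has one vertex more than it has edges. -/
theorem IsFine.length_le {δ : ℝ} (h : IsFine P δ) {i j : Fin N} (hij : i ≠ j) {u v : Plane}
    (hu : u ∈ vertices P ∩ chord P i j) (hv : v ∈ vertices P ∩ chord P i j)
    {q : (chordGraph P).Walk u v} (hq : IsMinWalk P δ q) : q.length ≤ maxSegments P := by
  classical
  refine le_trans ?_ (chordSegments_le P hij)
  have hnd := (geodesic_walk q (h.walkLength_eq hij hu hv hq)).1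
  have h1 : q.length + 1 ≤ (vertices P ∩ chord P i j).ncard := by
    rw [← SimpleGraph.Walk.length_support, ← List.toFinset_card_of_nodup hnd,
      ← Set.ncard_coe_finset]
    exact Set.ncard_le_ncard (fun x hx => h.support_subset hij hu hv hq x (List.mem_toFinset.1 hx))
      ((vertices_finite P).inter_of_left _)
  have h2 : vertices P ∩ chord P i j ⊆
      insert (P.pt i) (insert (P.pt j) (vertices P ∩ openSegment ℝ (P.pt i) (P.pt j))) := by
    rintro x ⟨hx, hxc⟩
    rw [Set.mem_insert_iff, Set.mem_insert_iff]
    by_contra! hne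
    exact hne.2.2 ⟨hx, mem_openSegment_of_ne_left_right hne.1.symm hne.2.1.symm hxc⟩
  have h3 := Set.ncard_le_ncard h2
    ((((vertices_finite P).inter_of_left _).insert _).insert _)
  have h4 := Set.ncard_insert_le (P.pt i)
    (insert (P.pt j) (vertices P ∩ openSegment ℝ (P.pt i) (P.pt j)))
  have h5 := Set.ncard_insert_le (P.pt j) (vertices P ∩ openSegment ℝ (P.pt i) (P.pt j))
  unfold chordSegments
  omega

/-! ### Cells are connected through the edges of the other chords -/

/-- Move the target inside its open cell in a direction parallel to no line from `q` to a vertex: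
each vertex then excludes at most one position. -/
theorem exists_generic_target {q : Plane} {c : Cell P} (hq : q ∉ vertices P) :
    ∃ q₀ ∈ region P c, ∀ x ∈ segment ℝ q q₀, x ∉ vertices P := by
  obtain ⟨y, hy⟩ := region_nonempty P c
  obtain ⟨n, hn⟩ := exists_dt_ne_zero ((vertices_finite P).image fun v => v - q)
  have hcr : ∀ v ∈ vertices P, cr (v - q) (rot n) ≠ 0 := fun v hv => by
    rw [cr_rot_right]
    exact hn _ ⟨v, hv, rfl⟩ (sub_ne_zero.2 fun h => hq (h ▸ hv))
  have hbad : {s : ℝ | ∃ v ∈ vertices P, cr (v - q) (y + s • rot n - q) = 0}.Finite := by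
    refine ((vertices_finite P).image fun v => -cr (v - q) (y - q) / cr (v - q) (rot n)).subset ?_
    rintro s ⟨v, hv, h⟩
    refine ⟨v, hv, ?_⟩
    rw [add_sub_right_comm, cr_add_right, cr_smul_right] at h
    simp only
    rw [div_eq_iff (hcr v hv)]; linarith
  have hnear : {s : ℝ | y + s • rot n ∈ region P c} ∈ 𝓝 (0 : ℝ) := by
    have hc : Continuous fun s : ℝ => y + s • rot n := by fun_prop
    refine hc.continuousAt.preimage_mem_nhds ((region_isOpen P c).mem_nhds ?_)
    simpa using hy
  obtain ⟨s, hs1, hs2⟩ := ((infinite_of_mem_nhds 0 hnear).sdiff hbad).nonempty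
  refine ⟨_, hs1, fun x hx hxv => hs2 ⟨x, hxv, ?_⟩⟩
  rw [segment_eq_image'] at hx
  obtain ⟨t, -, rfl⟩ := hx
  simp [cr]; ring

/-- The parameter `a / (a - b)` is the zero of the affine function; before it the sign does not
change. -/
theorem sign_lineMap {a b t : ℝ} (h0 : 0 ≤ t) (h1 : t < 1) (h : 0 < a * b ∨ a * b < 0 ∧ t < a / (a - b)) :
    SignType.sign ((1 - t) * a + t * b) = SignType.sign a := by
  apply sign_eq_of_mul_pos
  have ha : a ≠ 0 := by rintro rfl; simp at h
  have ha2 : 0 < a ^ 2 := by positivity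
  rcases h with h | ⟨h, ht⟩
  · nlinarith [mul_nonneg h0 h.le, mul_pos (sub_pos.2 h1) ha2]
  · have h2 : 0 < a * (a - b) := by nlinarith
    have h3 : t * (a * (a - b)) < a ^ 2 := by
      have : a / (a - b) = a ^ 2 / (a * (a - b)) := by
        have : a - b ≠ 0 := by rintro h; rw [h] at h2; simp at h2
        field_simp
      rw [this, lt_div_iff₀ h2] at ht
      exact ht
    nlinarith

theorem mem_openSegment_of_opposite {x u v d : Plane} {α β : ℝ} (hα : 0 < α) (hβ : 0 < β)
    (hu : u - x = (-α) • d) (hv : v - x = β • d) : x ∈ openSegment ℝ u v := by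
  refine ⟨β / (α + β), α / (α + β), by positivity, by positivity, by field_simp; ring, ?_⟩
  have e1 : u = x + (-α) • d := by rw [← hu]; abel
  have e2 : v = x + β • d := by rw [← hv]; abel
  have hsum : β / (α + β) + α / (α + β) = 1 := by field_simp; ring
  have hz : β / (α + β) * -α + α / (α + β) * β = 0 := by field_simp; ring
  rw [e1, e2, smul_add, smul_add, smul_smul, smul_smul, add_add_add_comm, ← add_smul, ← add_smul,
    hsum, hz, one_smul, zero_smul, add_zero]

/-- Move from `c` towards `c₀` along a segment that avoids all vertices. The first line that it
meets belongs to another chord and is met inside an edge, which `X` does not cross. The cell behind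
that edge differs from `c₀` in fewer signs. -/
theorem mem_iff_mem_of_same_side {i j : Fin N} (hij : i ≠ j) {X : Set (Cell P)}
    (hX : ∀ e : ChordEdge P, Crosses P X e → edgeSegment e.1 ⊆ chord P i j) {c c₀ : Cell P}
    (h : c.1 i j = c₀.1 i j) : c ∈ X ↔ c₀ ∈ X := by
  classical
  induction hn : (Finset.univ.filter fun q : Fin N × Fin N => c.1 q.1 q.2 ≠ c₀.1 q.1 q.2).card
    using Nat.strong_induction_on generalizing c with
  | _ n ih =>
  by_cases hcc : c = c₀
  · rw [hcc]
  set F := Finset.univ.filter fun q : Fin N × Fin N => c.1 q.1 q.2 ≠ c₀.1 q.1 q.2 with hF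
  have hne : F.Nonempty := by
    by_contra hem
    rw [Finset.not_nonempty_iff_eq_empty] at hem
    refine hcc (Cell.ext' fun k l _ => ?_)
    by_contra h1
    have : (k, l) ∈ F := by rw [hF]; simpa using h1
    rw [hem] at this; simp at this
  obtain ⟨q, hq⟩ := region_nonempty P c
  have hqv : q ∉ vertices P := by
    rintro (⟨k, rfl⟩ | ⟨k, l, _, _, hkl, -, -, hk, -⟩)
    · have := hq.1.1; rw [P.norm_pt] at this; exact lt_irrefl _ this
    · exact hq.1.2 k l hkl hk
  obtain ⟨q₀, hq₀, hgen⟩ := exists_generic_target (c := c₀) hqv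
  have hsq : ∀ k l, SignType.sign (lf P k l q) = c.1 k l := fun k l => by
    rw [← side_eq, hq.2]
  have hsq₀ : ∀ k l, SignType.sign (lf P k l q₀) = c₀.1 k l := fun k l => by
    rw [← side_eq, hq₀.2]
  have hmul : ∀ k l, k ≠ l → (c.1 k l ≠ c₀.1 k l ↔ lf P k l q * lf P k l q₀ < 0) := by
    intro k l hkl
    have h1 := c.ne_zero hkl
    have h2 := c₀.ne_zero hkl
    rw [← hsq, ← hsq₀] at *
    rcases lt_trichotomy (lf P k l q) 0 with a | a | a <;>
      rcases lt_trichotomy (lf P k l q₀) 0 with b | b | b <;>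
      simp [a, b, sign_neg, sign_pos] at h1 h2 ⊢ <;> nlinarith
  -- The separating line that the segment meets first.
  obtain ⟨⟨k, l⟩, hklF, hmin⟩ := F.exists_min_image
    (fun p => lf P p.1 p.2 q / (lf P p.1 p.2 q - lf P p.1 p.2 q₀)) hne
  have hklne : c.1 k l ≠ c₀.1 k l := by simpa [hF] using hklF
  have hkl : k ≠ l := by
    rintro rfl
    have h1 := hsq k k
    have h2 := hsq₀ k k
    rw [lf_self] at h1 h2
    exact hklne (h1.symm.trans h2)
  have hneg := (hmul k l hkl).1 hklne
  set a := lf P k l q with ha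
  set b := lf P k l q₀ with hb
  have hab2 : 0 < (a - b) ^ 2 := by nlinarith [sq_nonneg (a + b)]
  have hab : a - b ≠ 0 := by rintro h; rw [h] at hab2; simp at hab2
  set t := a / (a - b) with ht
  have ht0 : 0 < t := by
    have : t = a * (a - b) / (a - b) ^ 2 := by rw [ht]; field_simp
    rw [this]; apply div_pos _ hab2; nlinarith [sq_nonneg a]
  have ht1 : t < 1 := by
    have : 1 - t = -(b * (a - b)) / (a - b) ^ 2 := by rw [ht]; field_simp; ring
    have h2 : 0 < -(b * (a - b)) / (a - b) ^ 2 := by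
      apply div_pos _ hab2; nlinarith [sq_nonneg b]
    linarith
  set x := q + t • (q₀ - q) with hx
  have hxs : x ∈ segment ℝ q q₀ := by
    rw [segment_eq_image']; exact ⟨t, ⟨ht0.le, ht1.le⟩, rfl⟩
  have hxv := hgen x hxs
  have hx1 : ‖x‖ < 1 := by
    have := (convex_ball (0 : Plane) 1).segment_subset (mem_ball_zero_iff.2 hq.1.1)
      (mem_ball_zero_iff.2 hq₀.1.1) hxs
    simpa using this
  have hx0 : lf P k l x = 0 := by
    rw [hx, lf_lineMap, ← ha, ← hb, ht]; field_simp; ring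
  have hxc : x ∈ chord P k l := (mem_chord_iff P hkl hx1.le).2 hx0
  -- The crossing point `x` is no vertex, so no second line passes through it, and all other signs
  -- are still those of `c`.
  have hother : ∀ k' l', k' ≠ l' → s(k', l') ≠ s(k, l) →
      lf P k' l' x ≠ 0 ∧ SignType.sign (lf P k' l' x) = c.1 k' l' := by
    intro k' l' hkl' hs
    have hnz : lf P k' l' x ≠ 0 := fun h0 =>
      hxv (mem_vertices_of_lf P hkl' hkl hs hx1.le h0 hx0)
    refine ⟨hnz, ?_⟩
    rw [← hsq]
    by_cases hd : c.1 k' l' = c₀.1 k' l'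
    · have h1 := (hmul k' l' hkl').not.1 (not_not.2 hd)
      have h2 : lf P k' l' q ≠ 0 := ((mem_offChords P).1 hq.1).2 k' l' hkl'
      have h3 : lf P k' l' q₀ ≠ 0 := ((mem_offChords P).1 hq₀.1).2 k' l' hkl'
      rw [hx, lf_lineMap]
      exact sign_lineMap ht0.le ht1
        (Or.inl (lt_of_le_of_ne (not_lt.1 h1) (mul_ne_zero h2 h3).symm))
    · have h1 := (hmul k' l' hkl').1 hd
      have h2 := hmin (k', l') (by rw [hF]; simpa using hd)
      simp only at h2
      rw [hx, lf_lineMap] at hnz ⊢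
      refine sign_lineMap ht0.le ht1 (Or.inr ⟨h1, lt_of_le_of_ne h2 fun h3 => hnz ?_⟩)
      change t = _ at h3
      have h4 : lf P k' l' q - lf P k' l' q₀ ≠ 0 := by
        intro h4; rw [h4, div_zero] at h3; exact ht0.ne' h3
      rw [h3]; field_simp; ring
  have hne : ∀ m, x ≠ P.pt m := fun m h => hxv (h ▸ pt_mem_vertices P m)
  -- The nearest vertices on both sides of `x` along the chord are the ends of the edge that
  -- contains `x`.
  obtain ⟨s₁, hs₁0, hs₁1, hu, hnou⟩ := exists_nearest (vertices_finite P) (pt_mem_vertices P k) (hne k)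
  obtain ⟨s₂, hs₂0, hs₂1, hv, hnov⟩ := exists_nearest (vertices_finite P) (pt_mem_vertices P l) (hne l)
  set u := x + s₁ • (P.pt k - x) with hudef
  set v := x + s₂ • (P.pt l - x) with hvdef
  have huc : u ∈ chord P k l := mem_chord_lineMap P hxc (pt_mem_chord_left P k l) hs₁0.le hs₁1
  have hvc : v ∈ chord P k l := mem_chord_lineMap P hxc (pt_mem_chord_right P k l) hs₂0.le hs₂1
  obtain ⟨τ, hτ0, hτ1, hτ⟩ := (mem_chord P).1 hxc
  have hτ0' : 0 < τ := lt_of_le_of_ne hτ0 fun h => hne k (by rw [hτ, ← h]; simp)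
  have hτ1' : τ < 1 := lt_of_le_of_ne hτ1 fun h => hne l (by rw [hτ, h]; simp)
  have hu' : u - x = (-(s₁ * τ)) • (P.pt l - P.pt k) := by rw [hudef, hτ]; module
  have hv' : v - x = (s₂ * (1 - τ)) • (P.pt l - P.pt k) := by rw [hvdef, hτ]; module
  have hα : 0 < s₁ * τ := by positivity
  have hβ : 0 < s₂ * (1 - τ) := mul_pos hs₂0 (by linarith)
  have hxo : x ∈ openSegment ℝ u v := mem_openSegment_of_opposite hα hβ hu' hv'
  have huv : u ≠ v := by
    intro h
    have h1 : (-(s₁ * τ) - s₂ * (1 - τ)) • (P.pt l - P.pt k) = 0 := by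
      rw [sub_smul, ← hu', ← hv', h, sub_self]
    rcases smul_eq_zero.1 h1 with h1 | h1
    · linarith
    · exact hkl (P.injective (sub_eq_zero.1 h1).symm)
  have hadj : (chordGraph P).Adj u v := by
    refine ⟨huv, hu, hv, ⟨k, l, hkl, huc, hvc⟩, fun p hp => ?_⟩
    have hxr : x ∈ Set.range (AffineMap.lineMap u v : ℝ → Plane) := by
      have := openSegment_subset_segment ℝ _ _ hxo
      rw [segment_eq_image_lineMap] at this
      exact Set.image_subset_range _ _ this
    have := openSegment_subset_union u v hxr hp
    rcases this with rfl | hp | hp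
    · exact hxv
    · rw [openSegment_symm] at hp; exact hnou p hp
    · exact hnov p hp
  have hd1 : cr (P.pt l - P.pt k) (q₀ - q) ≠ 0 := by
    rw [← lf_sub, ← ha, ← hb]; intro h; apply hab; linarith
  have hd2 : cr (P.pt l - P.pt k) (q - q₀) ≠ 0 := by
    rw [← lf_sub, ← ha, ← hb]; exact hab
  obtain ⟨c₁, hc₁, hc₁s, -⟩ := edge_cell P hadj hkl huc hvc hxo hd2
  obtain ⟨c₂, hc₂, hc₂s, -⟩ := edge_cell P hadj hkl huc hvc hxo hd1
  have sa : ∀ {a b : ℝ}, a * b < 0 → SignType.sign (a - b) = SignType.sign a := by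
    intro a b h
    apply sign_eq_of_mul_pos; nlinarith [sq_nonneg a]
  have hc₁kl : c₁.1 k l = c.1 k l := by
    rw [hc₁s, sg, if_pos hx0, ← lf_sub, ← hsq]; exact sa hneg
  have hc₂kl : c₂.1 k l = c₀.1 k l := by
    rw [hc₂s, sg, if_pos hx0, ← lf_sub, ← hsq₀]; exact sa (by rw [mul_comm]; exact hneg)
  have hc₁o : ∀ k' l', k' ≠ l' → s(k', l') ≠ s(k, l) → c₁.1 k' l' = c.1 k' l' := by
    intro k' l' h1 h2
    rw [hc₁s, sg, if_neg (hother k' l' h1 h2).1, (hother k' l' h1 h2).2]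
  have hc₂o : ∀ k' l', k' ≠ l' → s(k', l') ≠ s(k, l) → c₂.1 k' l' = c.1 k' l' := by
    intro k' l' h1 h2
    rw [hc₂s, sg, if_neg (hother k' l' h1 h2).1, (hother k' l' h1 h2).2]
  have hsw : ∀ {c c' : Cell P}, c.1 k l = c'.1 k l → ∀ k' l', s(k', l') = s(k, l) →
      c.1 k' l' = c'.1 k' l' := by
    intro c c' h k' l' hs
    rcases Sym2.eq_iff.1 hs with ⟨rfl, rfl⟩ | ⟨rfl, rfl⟩
    · exact h
    · rw [Cell.swap c, h, ← Cell.swap c']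
  -- The cell behind `x`, against the direction of motion, is `c` itself.
  obtain rfl : c₁ = c := Cell.ext' fun k' l' hkl' => by
    by_cases hs : s(k', l') = s(k, l)
    · exact hsw hc₁kl k' l' hs
    · exact hc₁o k' l' hkl' hs
  have hijkl : s(i, j) ≠ s(k, l) := by
    intro hs
    rcases Sym2.eq_iff.1 hs with ⟨rfl, rfl⟩ | ⟨rfl, rfl⟩
    · exact hklne h
    · apply hklne; rw [Cell.swap c₁, h, ← Cell.swap c₀]
  have hc12 : c₁ ≠ c₂ := fun h => hklne (by rw [← hc₂kl, ← h])
  -- If the edge were crossed, it would lie on the chord from `P.pt i` to `P.pt j` as well, and `x`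
  -- would be a vertex.
  have hncross : ¬ Crosses P X ⟨s(u, v), hadj⟩ := fun hcr =>
    hxv (Or.inr ⟨i, j, k, l, hij, hkl, hijkl, hX _ hcr (openSegment_subset_segment _ _ _ hxo), hxc⟩)
  rw [crosses_iff P hc12 hc₁ hc₂, not_not] at hncross
  rw [hncross]
  refine ih _ ?_ (c := c₂) (by rw [hc₂o i j hij hijkl, h]) rfl
  rw [← hn]
  refine Finset.card_lt_card ⟨?_, fun hsub => ?_⟩
  · rintro ⟨k', l'⟩ hm
    simp only [Finset.mem_filter, Finset.mem_univ, true_and] at hm ⊢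
    by_cases hs : s(k', l') = s(k, l)
    · exact absurd (hsw hc₂kl k' l' hs) hm
    · by_cases hkl' : k' = l'
      · subst hkl'
        have : c₂.1 k' k' = c₀.1 k' k' := by
          rw [hc₂s, sg, if_pos (lf_self P _ _), sub_self, cr_zero_left, ← hsq₀, lf_self]
        exact absurd this hm
      · rw [hF]; rw [hc₂o k' l' hkl' hs] at hm; simpa using hm
  · have := hsub hklF
    simp only [Finset.mem_filter, Finset.mem_univ, true_and] at this
    exact this hc₂kl

/-- The crossed edges contain a path. By minimality and positivity of the weights they are exactly
its edges, and the path is a minimal walk, hence runs along the chord. So `X` is constant on each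
side of the chord, with the value at an outer cell. -/
theorem isMinCut_eq {δ : ℝ} (h : IsFine P δ) {i j : Fin N} (hij : i ≠ j) {X : Set (Cell P)}
    (hX : IsMinCut (incident P) (netLegs P δ) (outerCells P) (interval P i j) X) :
    X = {c | c.1 i j = 1} := by
  obtain ⟨q, hq, hcr⟩ := exists_crossed_path P hij hX.1
  have hmin : cutLegs (incident P) (netLegs P δ) X = pathLegs P δ (P.pt i) (P.pt j) := by
    rw [← netMinCut_eq_pathLegs P δ hij]
    refine le_antisymm (le_csInf ⟨_, X, hX.1, rfl⟩ ?_) (Nat.sInf_le ⟨X, hX.1, rfl⟩)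
    rintro n ⟨Y, hY, rfl⟩
    exact hX.2 Y hY
  have hqmin : IsMinWalk P δ q := fun r =>
    (sum_legs_le_cutLegs P hq hcr).trans (hmin ▸ Nat.sInf_le ⟨r, rfl⟩)
  have hqeq : walkLegs P δ q = cutLegs (incident P) (netLegs P δ) X := by
    rw [hmin, pathLegs_eq P hqmin]
  -- A crossed edge off the path would add at least one leg to the cut.
  have hedge : ∀ e : ChordEdge P, Crosses P X e → e.1 ∈ q.edges := by
    intro e he
    by_contra hno
    have h1 := sum_legs_le_cutLegs P (δ := δ) (X := X) (l := e.1 :: q.edges)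
      (List.nodup_cons.2 ⟨hno, hq⟩) (by
        intro e' he'
        rcases List.mem_cons.1 he' with rfl | he'
        exacts [⟨e.2, he⟩, hcr e' he'])
    rw [List.map_cons, List.sum_cons] at h1
    have h2 := h.one_le_legs e.2
    have h3 : walkLegs P δ q = (q.edges.map (legs δ)).sum := rfl
    omega
  have hsub := h.support_subset hij ⟨pt_mem_vertices P i, pt_mem_chord_left P i j⟩
    ⟨pt_mem_vertices P j, pt_mem_chord_right P i j⟩ hqmin
  have hX' : ∀ e : ChordEdge P, Crosses P X e → edgeSegment e.1 ⊆ chord P i j := by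
    intro e he
    have he' := hedge e he
    obtain ⟨e, hee⟩ := e
    induction e with | _ u v =>
    exact (convex_segment _ _).segment_subset (hsub u (q.fst_mem_support_of_mem_edges he')).2
      (hsub v (q.snd_mem_support_of_mem_edges he')).2
  -- On each side of the chord there is an outer cell, next to the circle at `P.pt i`.
  have hcell : ∀ s : SignType, s ≠ 0 → ∃ c₀ ∈ outerCells P, c₀.1 i j = s := by
    intro s hs
    have h1 := cr_rot_pt_ne P hij (lf_left P i j)
    obtain ⟨m, hm, hms⟩ : ∃ m, (m = rot (P.pt i) ∨ m = -rot (P.pt i)) ∧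
        SignType.sign (cr (P.pt j - P.pt i) m) = s := by
      rcases lt_or_gt_of_ne h1 with h2 | h2
      · cases s with
        | zero => exact absurd rfl hs
        | neg => exact ⟨_, Or.inl rfl, sign_neg h2⟩
        | pos => exact ⟨_, Or.inr rfl, by rw [cr_neg_right]; exact sign_pos (neg_pos.2 h2)⟩
      · cases s with
        | zero => exact absurd rfl hs
        | pos => exact ⟨_, Or.inl rfl, sign_pos h2⟩
        | neg => exact ⟨_, Or.inr rfl, by rw [cr_neg_right]; exact sign_neg (neg_lt_zero.2 h2)⟩
    obtain ⟨c₀, hc₀⟩ := end_cell P hm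
    refine ⟨c₀, outer_of_sg P hm hc₀, ?_⟩
    rw [hc₀, sg, if_pos (lf_left P i j), hms]
  ext c
  obtain ⟨c₀, hout, hc₀⟩ := hcell (c.1 i j) (c.ne_zero hij)
  rw [mem_iff_mem_of_same_side hij hX' hc₀.symm]
  change c₀ ∈ X ↔ c.1 i j = 1
  rw [← hc₀]
  exact hX.1 ⟨c₀, hout⟩

theorem hasUniqueMinCut_of_isFine {δ : ℝ} (h : IsFine P δ) {i j : Fin N} (hij : i ≠ j) :
    HasUniqueMinCut P δ (interval P i j) := by
  obtain ⟨p0, -⟩ := exists_straight_walk P hij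
    ⟨pt_mem_vertices P i, pt_mem_chord_left P i j⟩ ⟨pt_mem_vertices P j, pt_mem_chord_right P i j⟩
  obtain ⟨X0, hX0, -⟩ := exists_cut_of_walk P hij p0
  obtain ⟨X, hX, hXn⟩ := Nat.sInf_mem (s := {n | ∃ X : Set (Cell P),
    IsCut (outerCells P) (interval P i j) X ∧ cutLegs (incident P) (netLegs P δ) X = n})
    ⟨_, X0, hX0, rfl⟩
  have hmin : IsMinCut (incident P) (netLegs P δ) (outerCells P) (interval P i j) X :=
    ⟨hX, fun Y hY => hXn ▸ Nat.sInf_le ⟨Y, hY, rfl⟩⟩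
  exact ⟨X, hmin, fun Y hY => (isMinCut_eq h hij hY).trans (isMinCut_eq h hij hmin).symm⟩

variable (P)

theorem one_le_maxSegments (hN : 2 ≤ N) : 1 ≤ maxSegments P := by
  have h : (⟨0, by omega⟩ : Fin N) ≠ ⟨1, by omega⟩ := by simp
  refine le_trans ?_ (chordSegments_le P h)
  unfold chordSegments; omega

theorem fine_resolution (hN : 2 ≤ N) :
    ∃ ε₀ : ℝ, 0 < ε₀ ∧ ∀ ε δ : ℝ, 0 < δ → δ ≤ min ε ε₀ / maxSegments P →
      ∀ i j : Fin N, i ≠ j →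
        HasUniqueMinCut P δ (interval P i j) ∧
        ∀ u ∈ vertices P ∩ chord P i j,
        ∀ v ∈ vertices P ∩ chord P i j,
          (∀ p : (chordGraph P).Walk u v, IsMinWalk P δ p → p.length ≤ maxSegments P) ∧
          ∀ D : ℕ, 2 ≤ D → |dist u v - δ / Real.log D * graphLength P δ D u v| ≤ ε := by
  obtain ⟨g, hg, hgap⟩ := exists_length_gap P
  have hf : (1 : ℝ) ≤ maxSegments P := by exact_mod_cast one_le_maxSegments P hN
  have hcard : (0 : ℝ) < Nat.card (ChordEdge P) + 1 := by positivity
  refine ⟨g / (Nat.card (ChordEdge P) + 1), by positivity, ?_⟩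
  intro ε δ hδ hle i j hij
  rw [le_div_iff₀ (by linarith)] at hle
  have hfine : IsFine P δ := by
    refine ⟨hδ, g, ?_, hgap⟩
    rw [← le_div_iff₀ hcard]
    -- Here `maxSegments` is at least one, so `δ` itself is at most the threshold.
    exact le_trans (by nlinarith) (hle.trans (min_le_right _ _))
  refine ⟨hasUniqueMinCut_of_isFine hfine hij, fun u hu v hv =>
    ⟨fun p hp => hfine.length_le hij hu hv hp, fun D hD => ?_⟩⟩
  obtain ⟨p0, -⟩ := exists_straight_walk P hij hu hv
  obtain ⟨p, hp⟩ := exists_isMinWalk P δ p0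
  refine (abs_dist_sub_graphLength_le P hij hδ hD hu hv hp).trans ?_
  have h1 : (p.length : ℝ) ≤ maxSegments P := by exact_mod_cast hfine.length_le hij hu hv hp
  have h2 := min_le_left ε (g / (Nat.card (ChordEdge P) + 1))
  nlinarith

end

section

open scoped ComplexOrder

/-! ### Entropy, purity and rank -/

section Entropy

variable {ι : Type*} [Fintype ι]

/-- The entropy of a probability vector is at least its collision entropy. -/
theorem neg_log_sum_sq_le (l : ι → ℝ) (h0 : ∀ i, 0 ≤ l i) (h1 : ∑ i, l i = 1) :
    -Real.log (∑ i, l i ^ 2) ≤ ∑ i, Real.negMulLog (l i) := by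
  classical
  set s := Finset.univ.filter fun i => l i ≠ 0 with hs
  have hpos : ∀ i ∈ s, 0 < l i := fun i hi =>
    lt_of_le_of_ne (h0 i) (Ne.symm (Finset.mem_filter.1 hi).2)
  have e1 : ∑ i ∈ s, l i = 1 := by rw [hs, Finset.sum_filter_ne_zero, h1]
  have e2 : ∑ i ∈ s, l i * l i = ∑ i, l i ^ 2 := by
    rw [hs, Finset.sum_filter]
    refine Finset.sum_congr rfl fun i _ => ?_
    split_ifs with h
    · ring
    · rw [not_not.1 h]; ring
  have e3 : ∑ i ∈ s, l i * Real.log (l i) = -∑ i, Real.negMulLog (l i) := by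
    rw [hs, Finset.sum_filter, ← Finset.sum_neg_distrib]
    refine Finset.sum_congr rfl fun i _ => ?_
    split_ifs with h
    · simp [Real.negMulLog]
    · rw [not_not.1 h]; simp
  -- Jensen's inequality for the logarithm, with the probabilities both as weights and as points.
  have := strictConcaveOn_log_Ioi.concaveOn.le_map_sum (t := s) (w := l) (p := l)
    (fun i _ => h0 i) e1 (fun i hi => hpos i hi)
  simp only [smul_eq_mul] at this
  rw [e2, e3] at this
  linarith

/-- Jensen's inequality at the reciprocals of the probabilities gives the first bound, the
Cauchy-Schwarz inequality on the support the second. -/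
theorem sum_negMulLog_le_log (l : ι → ℝ) (h0 : ∀ i, 0 ≤ l i) (h1 : ∑ i, l i = 1) {r : ℕ}
    (hr : (Finset.univ.filter fun i => l i ≠ 0).card ≤ r) :
    ∑ i, Real.negMulLog (l i) ≤ Real.log r ∧ 1 ≤ r * ∑ i, l i ^ 2 := by
  classical
  set s := Finset.univ.filter fun i => l i ≠ 0 with hs
  have hpos : ∀ i ∈ s, 0 < l i := fun i hi =>
    lt_of_le_of_ne (h0 i) (Ne.symm (Finset.mem_filter.1 hi).2)
  have e1 : ∑ i ∈ s, l i = 1 := by rw [hs, Finset.sum_filter_ne_zero, h1]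
  have hsne : s.Nonempty := by
    by_contra h
    rw [Finset.not_nonempty_iff_eq_empty] at h
    rw [h] at e1; simp at e1
  have hcard : 0 < s.card := Finset.card_pos.2 hsne
  constructor
  · have e2 : ∑ i ∈ s, l i * (l i)⁻¹ = s.card := by
      rw [Finset.sum_congr rfl fun i hi => mul_inv_cancel₀ (hpos i hi).ne']; simp
    have e3 : ∑ i ∈ s, l i * Real.log (l i)⁻¹ = ∑ i, Real.negMulLog (l i) := by
      rw [hs, Finset.sum_filter]
      refine Finset.sum_congr rfl fun i _ => ?_
      split_ifs with h
      · simp [Real.negMulLog, Real.log_inv]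
      · rw [not_not.1 h]; simp
    have := strictConcaveOn_log_Ioi.concaveOn.le_map_sum (t := s) (w := l) (p := fun i => (l i)⁻¹)
      (fun i _ => h0 i) e1 (fun i hi => inv_pos.2 (hpos i hi))
    simp only [smul_eq_mul] at this
    rw [e2, e3] at this
    exact this.trans (Real.log_le_log (by exact_mod_cast hcard) (by exact_mod_cast hr))
  · have h2 := sq_sum_le_card_mul_sum_sq (s := s) (f := l)
    rw [e1] at h2
    have h3 : ∑ i ∈ s, l i ^ 2 ≤ ∑ i, l i ^ 2 :=
      Finset.sum_le_sum_of_subset_of_nonneg (Finset.subset_univ _) fun i _ _ => sq_nonneg _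
    have h4 : (s.card : ℝ) ≤ r := by exact_mod_cast hr
    have h5 : 0 ≤ ∑ i ∈ s, l i ^ 2 := Finset.sum_nonneg fun i _ => sq_nonneg _
    nlinarith [mul_le_mul h4 h3 h5 (Nat.cast_nonneg r)]

variable {κ : Type*} [Fintype κ]

/-- The square of the norm of the state with coefficient matrix `M`. -/
def normSqM (M : Matrix ι κ ℂ) : ℝ := ∑ i, ∑ j, ‖M i j‖ ^ 2

/-- The unnormalized purity of the reduced state. -/
def purityM (M : Matrix ι κ ℂ) : ℝ := ∑ i, ∑ i', ‖(M * M.conjTranspose) i i'‖ ^ 2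

theorem normSqM_nonneg (M : Matrix ι κ ℂ) : 0 ≤ normSqM M :=
  Finset.sum_nonneg fun _ _ => Finset.sum_nonneg fun _ _ => sq_nonneg _

theorem purityM_nonneg (M : Matrix ι κ ℂ) : 0 ≤ purityM M :=
  Finset.sum_nonneg fun _ _ => Finset.sum_nonneg fun _ _ => sq_nonneg _

theorem trace_mul_conjTranspose' (M : Matrix ι κ ℂ) :
    (M * M.conjTranspose).trace = (normSqM M : ℂ) := by
  simp only [Matrix.trace, Matrix.diag, Matrix.mul_apply, Matrix.conjTranspose_apply, normSqM]
  push_cast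
  refine Finset.sum_congr rfl fun i _ => Finset.sum_congr rfl fun j _ => ?_
  exact Complex.mul_conj' _

theorem sum_eigenvalues_sq [DecidableEq ι] {A : Matrix ι ι ℂ} (hA : A.IsHermitian) :
    ((∑ i, hA.eigenvalues i ^ 2 : ℝ) : ℂ) = (A * A.conjTranspose).trace := by
  rw [hA.eq]
  have h := hA.spectral_theorem
  rw [Unitary.conjStarAlgAut_apply] at h
  set U := (hA.eigenvectorUnitary : Matrix ι ι ℂ) with hU
  have hUU : star U * U = 1 := Unitary.coe_star_mul_self hA.eigenvectorUnitary
  set Δ := Matrix.diagonal ((RCLike.ofReal : ℝ → ℂ) ∘ hA.eigenvalues) with hD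
  have h2 : A * A = U * (Δ * Δ) * star U := by
    conv_lhs => rw [h]
    calc U * Δ * star U * (U * Δ * star U) = U * Δ * (star U * U) * Δ * star U := by
          simp only [Matrix.mul_assoc]
      _ = _ := by rw [hUU]; simp only [Matrix.mul_assoc, Matrix.mul_one]
  rw [h2, Matrix.trace_mul_comm, ← Matrix.mul_assoc, hUU, Matrix.one_mul, hD,
    Matrix.diagonal_mul_diagonal, Matrix.trace_diagonal]
  push_cast
  refine Finset.sum_congr rfl fun i _ => ?_
  simp [sq]

/-- The entropy of a pure state with coefficient matrix `M` on one side. -/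
theorem entropy_bounds [DecidableEq ι] (M : Matrix ι κ ℂ) {ρ : Matrix ι ι ℂ} (hρ : ρ.IsHermitian)
    (hdef : ρ = ((normSqM M)⁻¹ : ℝ) • (M * M.conjTranspose)) {r : ℕ} (hr : M.rank ≤ r)
    (hZ : normSqM M ≠ 0) :
    0 ≤ ∑ i, Real.negMulLog (hρ.eigenvalues i) ∧
    ∑ i, Real.negMulLog (hρ.eigenvalues i) ≤ Real.log r ∧
    -Real.log (purityM M / normSqM M ^ 2) ≤ ∑ i, Real.negMulLog (hρ.eigenvalues i) ∧
    normSqM M ^ 2 ≤ r * purityM M := by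
  have hZpos : 0 < normSqM M := lt_of_le_of_ne (normSqM_nonneg M) hZ.symm
  have hpsd : ρ.PosSemidef := by
    rw [hdef]
    exact (Matrix.posSemidef_self_mul_conjTranspose M).smul (inv_nonneg.2 hZpos.le)
  have h0 : ∀ i, 0 ≤ hρ.eigenvalues i := hpsd.eigenvalues_nonneg
  have h1 : ∑ i, hρ.eigenvalues i = 1 := by
    have ht : ρ.trace = ((1 : ℝ) : ℂ) := by
      rw [hdef, Matrix.trace_smul, trace_mul_conjTranspose', Complex.real_smul,
        ← Complex.ofReal_mul, inv_mul_cancel₀ hZ]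
    rw [hρ.trace_eq_sum_eigenvalues] at ht
    apply Complex.ofReal_injective
    rw [← ht]; push_cast; rfl
  have h2 : ∑ i, hρ.eigenvalues i ^ 2 = purityM M / normSqM M ^ 2 := by
    have h := sum_eigenvalues_sq hρ
    rw [trace_mul_conjTranspose'] at h
    rw [Complex.ofReal_injective h, hdef, normSqM, purityM, Finset.sum_div]
    refine Finset.sum_congr rfl fun i _ => ?_
    rw [Finset.sum_div]
    refine Finset.sum_congr rfl fun j _ => ?_
    rw [Matrix.smul_apply, norm_smul, mul_pow, Real.norm_of_nonneg (inv_nonneg.2 hZpos.le)]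
    field_simp
  have h3 : (Finset.univ.filter fun i => hρ.eigenvalues i ≠ 0).card ≤ r := by
    refine le_trans ?_ hr
    rw [← Fintype.card_subtype, ← hρ.rank_eq_card_non_zero_eigs, hdef]
    have : ((normSqM M)⁻¹ : ℝ) • (M * M.conjTranspose) =
        M * (((normSqM M)⁻¹ : ℝ) • M.conjTranspose) := by rw [Matrix.mul_smul]
    rw [this]
    exact Matrix.rank_mul_le_left _ _
  obtain ⟨h4, h5⟩ := sum_negMulLog_le_log _ h0 h1 h3
  refine ⟨?_, h4, h2 ▸ neg_log_sum_sq_le _ h0 h1, ?_⟩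
  · refine Finset.sum_nonneg fun i _ => Real.negMulLog_nonneg (h0 i) ?_
    rw [← h1]
    exact Finset.single_le_sum (fun j _ => h0 j) (Finset.mem_univ i)
  · rw [h2, mul_div_assoc', le_div_iff₀ (by positivity)] at h5
    linarith

theorem entropy_zero [DecidableEq ι] {ρ : Matrix ι ι ℂ} (hρ : ρ.IsHermitian) (h : ρ = 0) :
    ∑ i, Real.negMulLog (hρ.eigenvalues i) = 0 := by
  have := hρ.eigenvalues_eq_zero_iff.2 h
  simp [this]

variable {L : Type*} [Fintype L] [DecidableEq ι] [DecidableEq κ]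

/-- The matrix obtained by summing a function over the fibres of two maps. -/
def fibreMatrix (p : L → ι) (q : L → κ) (t : L → ℂ) : Matrix ι κ ℂ :=
  fun i j => ∑ a, if p a = i ∧ q a = j then t a else 0

theorem fibreMatrix_mul (p : L → ι) (q : L → κ) (t : L → ℂ) (i i' : ι) :
    (fibreMatrix p q t * (fibreMatrix p q t).conjTranspose) i i' =
      ∑ a, ∑ b, if p a = i ∧ p b = i' ∧ q a = q b then t a * star (t b) else 0 := by
  simp only [Matrix.mul_apply, Matrix.conjTranspose_apply, fibreMatrix, star_sum, Finset.sum_mul_sum]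
  rw [Finset.sum_comm]
  refine Finset.sum_congr rfl fun a _ => ?_
  rw [Finset.sum_comm]
  refine Finset.sum_congr rfl fun b _ => ?_
  rw [Finset.sum_eq_single (q a)]
  · by_cases h1 : p a = i <;> by_cases h2 : p b = i' <;> by_cases h3 : q a = q b <;>
      simp [h1, h2, h3, eq_comm]
  · intro j _ hj
    simp [Ne.symm hj]
  · simp

theorem normSqM_fibreMatrix (p : L → ι) (q : L → κ) (t : L → ℂ) :
    (normSqM (fibreMatrix p q t) : ℂ) =
      ∑ a, ∑ b, if p a = p b ∧ q a = q b then t a * star (t b) else 0 := by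
  rw [← trace_mul_conjTranspose', Matrix.trace]
  simp only [Matrix.diag, fibreMatrix_mul]
  rw [Finset.sum_comm]
  refine Finset.sum_congr rfl fun a _ => ?_
  rw [Finset.sum_comm]
  refine Finset.sum_congr rfl fun b _ => ?_
  rw [Finset.sum_eq_single (p a)]
  · simp only [true_and, eq_comm]
  · intro j _ hj; simp [Ne.symm hj]
  · simp

/-- Four copies of the state are glued in pairs: rows pair `a` with `d` and `c` with `b`, columns
pair `a` with `b` and `c` with `d`. In this form the Haar average can be taken term by term. -/
theorem purityM_fibreMatrix (p : L → ι) (q : L → κ) (t : L → ℂ) :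
    (purityM (fibreMatrix p q t) : ℂ) = ∑ a, ∑ b, ∑ c, ∑ d,
      if p a = p d ∧ p c = p b ∧ q a = q b ∧ q c = q d then
        t a * star (t b) * t c * star (t d) else 0 := by
  have e1 : (purityM (fibreMatrix p q t) : ℂ) = ∑ i, ∑ i',
      (fibreMatrix p q t * (fibreMatrix p q t).conjTranspose) i i' *
      (fibreMatrix p q t * (fibreMatrix p q t).conjTranspose) i' i := by
    unfold purityM; push_cast
    refine Finset.sum_congr rfl fun i _ => Finset.sum_congr rfl fun i' _ => ?_
    rw [← Complex.mul_conj']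
    congr 1
    have := Matrix.isHermitian_mul_conjTranspose_self (fibreMatrix p q t)
    exact this.apply _ _
  rw [e1]
  simp only [fibreMatrix_mul, Finset.sum_mul_sum]
  have comm : ∀ H : ι → ι → L → ℂ, ∑ i, ∑ i', ∑ a, H i i' a = ∑ a, ∑ i, ∑ i', H i i' a := by
    intro H
    rw [Finset.sum_congr rfl fun i _ => Finset.sum_comm, Finset.sum_comm]
  rw [comm]
  refine Finset.sum_congr rfl fun a _ => ?_
  rw [comm]
  conv_rhs => rw [Finset.sum_comm]
  refine Finset.sum_congr rfl fun c _ => ?_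
  rw [comm]
  refine Finset.sum_congr rfl fun b _ => ?_
  rw [comm]
  refine Finset.sum_congr rfl fun d _ => ?_
  rw [Finset.sum_eq_single (p a), Finset.sum_eq_single (p b)]
  · by_cases h1 : p a = p d <;> by_cases h2 : p c = p b <;> by_cases h3 : q a = q b <;>
      by_cases h4 : q c = q d <;> simp [h1, h2, h3, h4, mul_assoc, eq_comm]
  · intro j _ hj; simp [Ne.symm hj]
  · simp
  · intro j _ hj; simp [Ne.symm hj]
  · simp

end Entropy

end

section

/-! ### The rank of the boundary state across a cut -/

section Rank

variable {V E : Type} (inc : V → E → Prop) (w : E → ℕ) (D : ℕ) (out : Set V)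

/-- Simultaneous labellings of all legs. -/
abbrev Lab : Type := (e : E) → Fin (w e) → Fin D

/-- The amplitude of a labelling before the inner legs are contracted. -/
def amplitude [Fintype V] (T : Tensors inc w D out) (a : Lab w D) : ℂ :=
  open Classical in ∏ x : {x : V // x ∉ out}, T x (legsAt inc w D x.1 a)

/-- The labels at the boundary legs in a region. -/
def boundaryLabels (p : out → Prop) (a : Lab w D) : BoundaryIndex inc w D out p :=
  fun b => legsAt inc w D b.1.1 a

variable [Fintype V] [Fintype E] (A : Set out) (T : Tensors inc w D out)

open Classical in
theorem boundaryMatrix_eq_fibreMatrix : boundaryMatrix inc w D out A T =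
    fibreMatrix (boundaryLabels inc w D out (· ∈ A)) (boundaryLabels inc w D out (· ∉ A))
      (amplitude inc w D out T) := by
  funext α α'
  unfold boundaryMatrix boundaryState fibreMatrix amplitude
  refine Finset.sum_congr rfl fun a _ => ?_
  have : (∀ b : out, legsAt inc w D b.1 a = if h : b ∈ A then α ⟨b, h⟩ else α' ⟨b, h⟩) ↔
      (boundaryLabels inc w D out (· ∈ A) a = α ∧ boundaryLabels inc w D out (· ∉ A) a = α') := by
    constructor
    · intro h
      constructor
      · funext b
        have := h b.1
        rw [dif_pos b.2] at this
        exact this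
      · funext b
        have := h b.1
        rw [dif_neg b.2] at this
        exact this
    · rintro ⟨rfl, rfl⟩ b
      split_ifs <;> rfl
  simp only [this]

open Classical in
theorem sum_normSq_boundaryState :
    ∑ β : (b : out) → LegIndex inc w D b.1, ‖boundaryState inc w D out T β‖ ^ 2 =
      normSqM (boundaryMatrix inc w D out A T) := by
  unfold normSqM boundaryMatrix
  rw [← Fintype.sum_prod_type']
  exact ((Equiv.piEquivPiSubtypeProd (· ∈ A) fun b : out => LegIndex inc w D b.1).symm.sum_comp
    fun β => ‖boundaryState inc w D out T β‖ ^ 2).symm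

/-- The edges that a cut crosses. -/
def crosses (X : Set V) (e : E) : Prop := (∃ x ∈ X, inc x e) ∧ ∃ y ∉ X, inc y e

/-- Labellings of the legs on the edges with a given property. -/
abbrev LabOn (p : E → Prop) : Type := (e : {e : E // p e}) → Fin (w e.1) → Fin D

/-- Labellings of the legs on the uncrossed edges with a given property. -/
abbrev LabOff (X : Set V) (p : E → Prop) : Type :=
  (e : {e : {e : E // ¬ crosses inc X e} // p e.1}) → Fin (w e.1.1) → Fin D

open Classical in
/-- A labelling, from labellings of the crossing edges, of the edges inside and of the others. -/
def glue (X : Set V) (k : LabOn w D (crosses inc X))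
    (b : LabOff inc w D X fun e => ∃ x ∈ X, inc x e)
    (c : LabOff inc w D X fun e => ¬ ∃ x ∈ X, inc x e) : Lab w D := fun e =>
  if h : crosses inc X e then k ⟨e, h⟩ else
    if h' : ∃ x ∈ X, inc x e then b ⟨⟨e, h⟩, h'⟩ else c ⟨⟨e, h⟩, h'⟩

open Classical in
theorem sum_glue (X : Set V) (F : Lab w D → ℂ) :
    ∑ a, F a = ∑ k, ∑ b, ∑ c, F (glue inc w D X k b c) := by
  rw [← (Equiv.piEquivPiSubtypeProd (crosses inc X) fun e : E => Fin (w e) → Fin D).symm.sum_comp,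
    Fintype.sum_prod_type]
  refine Finset.sum_congr rfl fun k _ => ?_
  rw [← (Equiv.piEquivPiSubtypeProd (fun e : {e : E // ¬ crosses inc X e} => ∃ x ∈ X, inc x e.1)
    fun e => Fin (w e.1) → Fin D).symm.sum_comp, Fintype.sum_prod_type]
  rfl

theorem legsAt_glue_of_mem {X : Set V} (k : LabOn w D (crosses inc X))
    (b : LabOff inc w D X fun e => ∃ x ∈ X, inc x e)
    (c c' : LabOff inc w D X fun e => ¬ ∃ x ∈ X, inc x e) {x : V} (hx : x ∈ X) :
    legsAt inc w D x (glue inc w D X k b c) = legsAt inc w D x (glue inc w D X k b c') := by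
  funext e
  have : ∃ x ∈ X, inc x e.1 := ⟨x, hx, e.2⟩
  simp [legsAt, glue, this]

theorem legsAt_glue_of_notMem {X : Set V} (k : LabOn w D (crosses inc X))
    (b b' : LabOff inc w D X fun e => ∃ x ∈ X, inc x e)
    (c : LabOff inc w D X fun e => ¬ ∃ x ∈ X, inc x e) {x : V} (hx : x ∉ X) :
    legsAt inc w D x (glue inc w D X k b c) = legsAt inc w D x (glue inc w D X k b' c) := by
  funext e
  have h1 : ∃ x ∉ X, inc x e.1 := ⟨x, hx, e.2⟩
  by_cases h : ∃ x ∈ X, inc x e.1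
  · have : crosses inc X e.1 := ⟨h, h1⟩
    simp [legsAt, glue, this]
  · simp [legsAt, glue, h]

open Classical in
theorem card_labOn_crosses (X : Set V) :
    Fintype.card (LabOn w D (crosses inc X)) = D ^ cutLegs inc w X := by
  rw [Fintype.card_pi]
  simp only [Fintype.card_fun, Fintype.card_fin]
  rw [Finset.prod_pow_eq_pow_sum, cutLegs]
  congr 1
  rw [← Finset.sum_subtype (Finset.univ.filter (crosses inc X)) (by simp) w, Finset.sum_filter]
  refine Finset.sum_congr rfl fun e _ => ?_
  by_cases h : crosses inc X e
  · rw [if_pos h]; exact (if_pos h).symm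
  · rw [if_neg h]; exact (if_neg h).symm

open Classical in
/-- The rank of the boundary state is at most the dimension of the legs that a cut crosses. -/
theorem rank_boundaryMatrix_le [NeZero D] {X : Set V} (hX : IsCut out A X) :
    (boundaryMatrix inc w D out A T).rank ≤ D ^ cutLegs inc w X := by
  rw [← card_labOn_crosses inc w D X]
  -- The state factors through the labels of the crossed legs: `B` contracts the inside of the cut
  -- and `C` the outside. The default labels fill the legs that the respective factor does not see.
  set b₀ : LabOff inc w D X fun e => ∃ x ∈ X, inc x e := fun _ _ => 0
  set c₀ : LabOff inc w D X fun e => ¬ ∃ x ∈ X, inc x e := fun _ _ => 0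
  set B : Matrix (BoundaryIndex inc w D out (· ∈ A)) (LabOn w D (crosses inc X)) ℂ :=
    fun α k => ∑ b, if boundaryLabels inc w D out (· ∈ A) (glue inc w D X k b c₀) = α then
      ∏ x : {x : V // x ∉ out},
        if x.1 ∈ X then T x (legsAt inc w D x.1 (glue inc w D X k b c₀)) else 1 else 0 with hB
  set C : Matrix (LabOn w D (crosses inc X)) (BoundaryIndex inc w D out (· ∉ A)) ℂ :=
    fun k α' => ∑ c, if boundaryLabels inc w D out (· ∉ A) (glue inc w D X k b₀ c) = α' then
      ∏ x : {x : V // x ∉ out},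
        if x.1 ∈ X then 1 else T x (legsAt inc w D x.1 (glue inc w D X k b₀ c)) else 0 with hC
  have hBC : boundaryMatrix inc w D out A T = B * C := by
    rw [boundaryMatrix_eq_fibreMatrix]
    funext α α'
    rw [Matrix.mul_apply]
    unfold fibreMatrix
    rw [sum_glue inc w D X]
    refine Finset.sum_congr rfl fun k _ => ?_
    rw [hB, hC, Finset.sum_mul_sum]
    refine Finset.sum_congr rfl fun b _ => Finset.sum_congr rfl fun c _ => ?_
    have h1 : boundaryLabels inc w D out (· ∈ A) (glue inc w D X k b c) =
        boundaryLabels inc w D out (· ∈ A) (glue inc w D X k b c₀) := by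
      funext x
      exact legsAt_glue_of_mem inc w D k b c c₀ ((hX x.1).2 x.2)
    have h2 : boundaryLabels inc w D out (· ∉ A) (glue inc w D X k b c) =
        boundaryLabels inc w D out (· ∉ A) (glue inc w D X k b₀ c) := by
      funext x
      exact legsAt_glue_of_notMem inc w D k b b₀ c fun h => x.2 ((hX x.1).1 h)
    have h3 : amplitude inc w D out T (glue inc w D X k b c) =
        (∏ x : {x : V // x ∉ out},
          if x.1 ∈ X then T x (legsAt inc w D x.1 (glue inc w D X k b c₀)) else 1) *
        ∏ x : {x : V // x ∉ out},
          if x.1 ∈ X then 1 else T x (legsAt inc w D x.1 (glue inc w D X k b₀ c)) := by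
      rw [amplitude, ← Finset.prod_mul_distrib]
      refine Finset.prod_congr rfl fun x _ => ?_
      split_ifs with hx
      · rw [legsAt_glue_of_mem inc w D k b c c₀ hx, mul_one]
      · rw [legsAt_glue_of_notMem inc w D k b b₀ c hx, one_mul]
    rw [h1, h2, h3, ite_zero_mul_ite_zero]
  rw [hBC]
  exact (Matrix.rank_mul_le_left B C).trans (Matrix.rank_le_card_width B)

theorem exists_isCut : ∃ X : Set V, IsCut out A X :=
  ⟨(↑) '' A, fun b => by simp⟩

theorem exists_minCut : ∃ X : Set V, IsCut out A X ∧ cutLegs inc w X = minCutLegs inc w out A := by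
  obtain ⟨X, hX⟩ := exists_isCut out A
  exact Nat.sInf_mem (s := {n | ∃ X : Set V, IsCut out A X ∧ cutLegs inc w X = n}) ⟨_, X, hX, rfl⟩

theorem minCutLegs_le {X : Set V} (hX : IsCut out A X) :
    minCutLegs inc w out A ≤ cutLegs inc w X :=
  Nat.sInf_le ⟨X, hX, rfl⟩

open Classical in
theorem reducedDensity_eq : reducedDensity inc w D out A T =
    ((normSqM (boundaryMatrix inc w D out A T))⁻¹ : ℝ) •
      (boundaryMatrix inc w D out A T * (boundaryMatrix inc w D out A T).conjTranspose) := by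
  rw [reducedDensity, ← sum_normSq_boundaryState inc w D out A T]

open Classical in
theorem entropy_eq_zero (hZ : normSqM (boundaryMatrix inc w D out A T) = 0) :
    entropy inc w D out A T = 0 := by
  refine entropy_zero _ ?_
  rw [reducedDensity_eq, hZ]; simp

open Classical in
/-- Bounds for the entropy of a boundary state in terms of a minimal cut, the norm and the
purity. -/
theorem entropy_mem_bounds [NeZero D] (hZ : normSqM (boundaryMatrix inc w D out A T) ≠ 0) :
    0 ≤ entropy inc w D out A T ∧
    entropy inc w D out A T ≤ minCutLegs inc w out A * Real.log D ∧
    -Real.log (purityM (boundaryMatrix inc w D out A T) /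
      normSqM (boundaryMatrix inc w D out A T) ^ 2) ≤ entropy inc w D out A T ∧
    normSqM (boundaryMatrix inc w D out A T) ^ 2 ≤
      (D : ℝ) ^ minCutLegs inc w out A * purityM (boundaryMatrix inc w D out A T) := by
  obtain ⟨X, hX, hc⟩ := exists_minCut inc w out A
  have := entropy_bounds (boundaryMatrix inc w D out A T)
    (reducedDensity_isHermitian inc w D out A T) (reducedDensity_eq inc w D out A T)
    (hc ▸ rank_boundaryMatrix_le inc w D out A T hX) hZ
  push_cast at this
  rw [Real.log_pow] at this
  exact this

end Rank

end

section

/-! ### Moments of a Haar random column -/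

section HaarMoments

variable {n : Type} [Fintype n] [DecidableEq n]

instance : MeasureTheory.Measure.IsHaarMeasure (haarUnitary n) :=
  inferInstanceAs (MeasureTheory.Measure.haarMeasure _).IsHaarMeasure

instance : MeasureTheory.IsProbabilityMeasure (haarUnitary n) :=
  ⟨MeasureTheory.Measure.haarMeasure_self⟩

theorem continuous_entry (k o : n) : Continuous fun U : Matrix.unitaryGroup n ℂ => U.1 k o :=
  (continuous_apply_apply k o).comp continuous_subtype_val

theorem measurePreserving_mul_left (V : Matrix.unitaryGroup n ℂ) :
    MeasureTheory.MeasurePreserving (fun U => V * U) (haarUnitary n) (haarUnitary n) :=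
  MeasureTheory.measurePreserving_mul_left _ V

theorem integral_haar_mul_left (V : Matrix.unitaryGroup n ℂ) (f : Matrix.unitaryGroup n ℂ → ℂ) :
    ∫ U, f (V * U) ∂haarUnitary n = ∫ U, f U ∂haarUnitary n :=
  MeasureTheory.integral_mul_left_eq_self f V

theorem integrable_haar {f : Matrix.unitaryGroup n ℂ → ℂ} (hf : Continuous f) :
    MeasureTheory.Integrable f (haarUnitary n) :=
  hf.integrable_of_hasCompactSupport (HasCompactSupport.of_compactSpace f)

/-- The diagonal unitary with given phases. -/
def phase (z : n → ℂ) (hz : ∀ i, ‖z i‖ = 1) : Matrix.unitaryGroup n ℂ :=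
  ⟨Matrix.diagonal z, by
    rw [Matrix.mem_unitaryGroup_iff, Matrix.star_eq_conjTranspose, Matrix.diagonal_conjTranspose,
      Matrix.diagonal_mul_diagonal, ← Matrix.diagonal_one]
    congr 1
    funext i
    simp [Complex.mul_conj', hz]⟩

theorem phase_mul_apply (z : n → ℂ) (hz : ∀ i, ‖z i‖ = 1) (U : Matrix.unitaryGroup n ℂ) (k o : n) :
    (phase z hz * U).1 k o = z k * U.1 k o := by
  simp [phase, Matrix.diagonal_mul]

/-- The reflection in the hyperplane orthogonal to a real vector. -/
def reflectionAlong (v : n → ℝ) (hv : ∑ i, v i ^ 2 ≠ 0) : Matrix.unitaryGroup n ℂ :=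
  ⟨Matrix.of fun i j => (if i = j then 1 else 0) - ((2 / (∑ i, v i ^ 2) * v i * v j : ℝ) : ℂ), by
    rw [Matrix.mem_unitaryGroup_iff, Matrix.star_eq_conjTranspose]
    ext i j
    set s := ∑ i, v i ^ 2 with hs
    simp only [Matrix.mul_apply, Matrix.conjTranspose_apply, Matrix.one_apply, star_sub, Matrix.of_apply]
    have : ∀ k, (((if i = k then (1 : ℂ) else 0) - ((2 / s * v i * v k : ℝ) : ℂ)) *
        (star (if j = k then (1 : ℂ) else 0) - star ((2 / s * v j * v k : ℝ) : ℂ))) =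
        (if i = k then (if j = k then 1 else 0) else 0) -
        (if i = k then ((2 / s * v j * v k : ℝ) : ℂ) else 0) -
        (if j = k then ((2 / s * v i * v k : ℝ) : ℂ) else 0) +
        ((4 / s ^ 2 * v i * v j : ℝ) : ℂ) * ((v k ^ 2 : ℝ) : ℂ) := by
      intro k
      rw [Complex.star_def, Complex.conj_ofReal]
      split_ifs <;> simp <;> ring
    simp only [this, Finset.sum_add_distrib, Finset.sum_sub_distrib, Finset.sum_ite_eq,
      Finset.mem_univ, if_true, ← Finset.mul_sum, ← Complex.ofReal_sum, ← hs]
    have h2 : ((4 / s ^ 2 * v i * v j : ℝ) : ℂ) * ((s : ℝ) : ℂ) =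
        ((2 / s * v j * v i : ℝ) : ℂ) + ((2 / s * v i * v j : ℝ) : ℂ) := by
      rw [← Complex.ofReal_mul, ← Complex.ofReal_add]
      congr 1
      field_simp
      ring
    rw [h2]
    simp only [eq_comm (a := j)]
    ring⟩

theorem reflectionAlong_mul_apply (v : n → ℝ) (hv : ∑ i, v i ^ 2 ≠ 0)
    (U : Matrix.unitaryGroup n ℂ) (k o : n) : (reflectionAlong v hv * U).1 k o =
      U.1 k o - ((2 / (∑ i, v i ^ 2) * v k : ℝ) : ℂ) * ∑ j, (v j : ℂ) * U.1 j o := by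
  change ∑ j, ((if k = j then (1 : ℂ) else 0) - ((2 / (∑ i, v i ^ 2) * v k * v j : ℝ) : ℂ)) *
    U.1 j o = _
  simp only [sub_mul, Finset.sum_sub_distrib, ite_mul, one_mul, zero_mul, Finset.sum_ite_eq,
    Finset.mem_univ, if_true, Finset.mul_sum]
  congr 1
  refine Finset.sum_congr rfl fun j _ => ?_
  push_cast; ring

theorem sum_normSq_column (U : Matrix.unitaryGroup n ℂ) (o : n) :
    ∑ k, U.1 k o * star (U.1 k o) = 1 := by
  have h := Matrix.mem_unitaryGroup_iff'.1 U.2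
  have := congrFun (congrFun h o) o
  rw [Matrix.mul_apply, Matrix.one_apply_eq] at this
  rw [← this]
  refine Finset.sum_congr rfl fun k _ => ?_
  rw [Matrix.star_apply, mul_comm]

/-- The fourth moment of the entries of a Haar random column. -/
def moment4 (o : n) (k : Fin 4 → n) : ℂ :=
  ∫ U, U.1 (k 0) o * star (U.1 (k 1) o) * U.1 (k 2) o * star (U.1 (k 3) o) ∂haarUnitary n

theorem moment4_phase (o : n) (k : Fin 4 → n) (z : n → ℂ) (hz : ∀ i, ‖z i‖ = 1) :
    moment4 o k = (z (k 0) * star (z (k 1)) * z (k 2) * star (z (k 3))) * moment4 o k := by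
  unfold moment4
  conv_lhs => rw [← integral_haar_mul_left (phase z hz)]
  rw [← MeasureTheory.integral_const_mul]
  congr 1
  funext U
  simp only [phase_mul_apply, star_mul']
  ring

/-- Multiplying row `j` by `Complex.I` multiplies the moment by a power of `Complex.I` with exponent
between -2 and 2, the surplus of plain over conjugate occurrences of `j`. A non-zero moment forces
balance, and testing `k 0` and `k 2` suffices. -/
theorem moment4_eq_zero (o : n) (k : Fin 4 → n)
    (h : ¬ ((k 0 = k 1 ∧ k 2 = k 3) ∨ (k 0 = k 3 ∧ k 2 = k 1))) : moment4 o k = 0 := by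
  have key : ∀ j : n, moment4 o k ≠ 0 →
      (if k 0 = j then Complex.I else 1) * (if k 1 = j then -Complex.I else 1) *
      (if k 2 = j then Complex.I else 1) * (if k 3 = j then -Complex.I else 1) = 1 := by
    intro j hne
    have := moment4_phase o k (fun i => if i = j then Complex.I else 1)
      (fun i => by split_ifs <;> simp)
    have h2 := mul_right_cancel₀ hne ((one_mul _).trans this)
    refine Eq.trans ?_ h2.symm
    simp only [apply_ite star, star_one, Complex.star_def, Complex.conj_I]
  by_contra hne
  have h0 := key (k 0) hne
  have h2 := key (k 2) hne
  have hI : Complex.I ≠ 1 := by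
    intro h; simpa using congrArg Complex.im h
  have hI' : -Complex.I ≠ 1 := by
    intro h; simpa using congrArg Complex.im h
  have hm : (-1 : ℂ) ≠ 1 := by norm_num
  have h20 : k 2 ≠ k 0 → k 0 ≠ k 2 := Ne.symm
  by_cases a : k 1 = k 0 <;> by_cases b : k 2 = k 0 <;> by_cases c : k 3 = k 0 <;>
    simp [a, b, c, hI, hI', hm] at h0
  · exact h (Or.inl ⟨a.symm, b.trans c.symm⟩)
  · have d : k 3 = k 2 := by
      by_contra d
      simp [a, d, h20 b, hI] at h2
    exact h (Or.inl ⟨a.symm, d.symm⟩)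
  · have d : k 1 = k 2 := by
      by_contra d
      simp [c, d, h20 b, hI] at h2
    exact h (Or.inr ⟨c.symm, d.symm⟩)

theorem continuous_moment4 (o a b c d : n) : Continuous fun U : Matrix.unitaryGroup n ℂ =>
    U.1 a o * star (U.1 b o) * U.1 c o * star (U.1 d o) :=
  (((continuous_entry a o).mul (continuous_entry b o).star).mul (continuous_entry c o)).mul
    (continuous_entry d o).star

/-- The fourth moments are symmetric in the two conjugate pairs. -/
theorem moment4_swap (o a b c d : n) :
    moment4 o ![a, b, c, d] = moment4 o ![a, d, c, b] ∧
    moment4 o ![a, b, c, d] = moment4 o ![c, b, a, d] := by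
  constructor <;> (unfold moment4; congr 1; funext U; simp only [Matrix.cons_val]; ring)

/-- The behaviour of the fourth moments under a reflection in a coordinate plane. -/
theorem moment4_reflection (o : n) {k l : n} (hkl : k ≠ l) :
    544 * moment4 o ![k, k, k, k] =
      256 * moment4 o ![l, l, l, l] + 576 * moment4 o ![k, k, l, l] := by
  -- The coordinates 1 and 2 give squared length 5, and the reflected entry is the rational
  -- combination with coefficients 3/5 and -4/5.
  set v : n → ℝ := fun i => if i = k then 1 else if i = l then 2 else 0 with hv
  have hs : ∑ i, v i ^ 2 = 5 := by
    rw [← Finset.sum_subset (Finset.subset_univ {k, l}), Finset.sum_pair hkl]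
    · simp [hv, hkl.symm]; norm_num
    · intro i _ hi
      simp only [Finset.mem_insert, Finset.mem_singleton, not_or] at hi
      simp [hv, hi.1, hi.2]
  have hs0 : ∑ i, v i ^ 2 ≠ 0 := by rw [hs]; norm_num
  have hrow : ∀ U : Matrix.unitaryGroup n ℂ, (reflectionAlong v hs0 * U).1 k o =
      (3 * U.1 k o - 4 * U.1 l o) / 5 := by
    intro U
    rw [reflectionAlong_mul_apply, hs, ← Finset.sum_subset (Finset.subset_univ {k, l}),
      Finset.sum_pair hkl]
    · simp [hv, hkl.symm]; ring
    · intro i _ hi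
      simp only [Finset.mem_insert, Finset.mem_singleton, not_or] at hi
      simp [hv, hi.1, hi.2]
  set g : Bool → n := fun s => if s then k else l with hg
  set c : Bool → ℂ := fun s => if s then 3 else -4 with hc
  have h1 : moment4 o ![k, k, k, k] = ∑ p : Bool × Bool × Bool × Bool,
      (c p.1 * c p.2.1 * c p.2.2.1 * c p.2.2.2 / 625) *
        moment4 o ![g p.1, g p.2.1, g p.2.2.1, g p.2.2.2] := by
    conv_lhs => rw [moment4, ← integral_haar_mul_left (reflectionAlong v hs0)]
    unfold moment4
    simp only [← MeasureTheory.integral_const_mul]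
    rw [← MeasureTheory.integral_finsetSum _ fun p _ =>
      (integrable_haar (continuous_moment4 o _ _ _ _)).const_mul _]
    congr 1
    funext U
    simp only [Matrix.cons_val, hrow, Fintype.sum_prod_type, Fintype.sum_bool, hg, hc]
    simp
    ring
  have z : ∀ a b c d : n, ¬ ((a = b ∧ c = d) ∨ (a = d ∧ c = b)) → moment4 o ![a, b, c, d] = 0 :=
    fun a b c d h => moment4_eq_zero o _ (by simpa using h)
  simp only [Fintype.sum_prod_type, Fintype.sum_bool, hg, hc] at h1
  simp only [if_true, if_false, Bool.false_eq_true] at h1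
  -- Ten of the sixteen terms vanish. What remains is 81 for all `k`, 256 for all `l`, and four
  -- equal mixed terms with coefficient 144.
  rw [z k k k l, z k k l k, z k l k k, z l k k k, z l l l k, z l l k l, z l k l l, z k l l l,
    z k l k l, z l k l k, ← (moment4_swap o k k l l).1, ← (moment4_swap o k k l l).2,
    (moment4_swap o l l k k).2, (moment4_swap o k l l k).1] at h1
  · linear_combination 625 * h1
  all_goals simp [hkl, hkl.symm]

/-- The reflection relation and the one with `k` and `l` exchanged differ by 800 times the
difference of the pure moments. These are thus equal, and the mixed moment is half of them. -/
theorem moment4_pair (o : n) {k l : n} (hkl : k ≠ l) :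
    2 * moment4 o ![k, k, l, l] = moment4 o ![o, o, o, o] ∧
      moment4 o ![k, k, k, k] = moment4 o ![o, o, o, o] := by
  have key : ∀ {k l : n}, k ≠ l → moment4 o ![k, k, k, k] = moment4 o ![l, l, l, l] ∧
      2 * moment4 o ![k, k, l, l] = moment4 o ![k, k, k, k] := by
    intro k l hkl
    have h1 := moment4_reflection o hkl
    have h2 := moment4_reflection o hkl.symm
    rw [(moment4_swap o l l k k).2, (moment4_swap o k l l k).1] at h2
    constructor
    · linear_combination (h1 - h2) / 800
    · linear_combination (-1 / 288 : ℂ) * h1 + (256 / 288 / 800 : ℂ) * (h1 - h2)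
  have h3 : ∀ k, moment4 o ![k, k, k, k] = moment4 o ![o, o, o, o] := by
    intro k
    rcases eq_or_ne k o with rfl | h
    · rfl
    · exact (key h).1
  exact ⟨(key hkl).2.trans (h3 k), h3 k⟩

theorem moment4_diag (o k l : n) : moment4 o ![k, k, l, l] =
    moment4 o ![o, o, o, o] / 2 * (1 + if k = l then 1 else 0) := by
  rcases eq_or_ne k l with rfl | h
  · rw [if_pos rfl]
    rcases eq_or_ne k o with rfl | h
    · ring
    · rw [(moment4_pair o h).2]; ring
  · rw [if_neg h, ← (moment4_pair o h).1]; ring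

/-- The normalization comes from the unit length of a column, squared and integrated. -/
theorem moment4_self (o : n) : moment4 o ![o, o, o, o] / 2 =
    1 / ((Fintype.card n : ℂ) * (Fintype.card n + 1)) := by
  have h1 : ∑ k, ∑ l, moment4 o ![k, k, l, l] = 1 := by
    unfold moment4
    simp only [Matrix.cons_val]
    have : ∀ k, ∑ l, ∫ U : Matrix.unitaryGroup n ℂ,
        U.1 k o * star (U.1 k o) * U.1 l o * star (U.1 l o) ∂haarUnitary n =
        ∫ U : Matrix.unitaryGroup n ℂ,
        ∑ l, U.1 k o * star (U.1 k o) * U.1 l o * star (U.1 l o) ∂haarUnitary n := fun k =>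
      (MeasureTheory.integral_finsetSum _ fun l _ => integrable_haar (continuous_moment4 o k k l l)).symm
    rw [Finset.sum_congr rfl fun k _ => this k, ← MeasureTheory.integral_finsetSum _ fun k _ =>
      integrable_haar (continuous_finsetSum _ fun l _ => continuous_moment4 o k k l l)]
    have h2 : ∀ U : Matrix.unitaryGroup n ℂ,
        ∑ k, ∑ l, U.1 k o * star (U.1 k o) * U.1 l o * star (U.1 l o) = 1 := by
      intro U
      simp only [mul_assoc, ← Finset.mul_sum, sum_normSq_column, mul_one]
    simp only [h2]
    simp
  rw [Finset.sum_congr rfl fun k _ => Finset.sum_congr rfl fun l _ => moment4_diag o k l] at h1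
  simp only [← Finset.mul_sum, Finset.sum_add_distrib, Finset.sum_const,
    Finset.sum_ite_eq, Finset.mem_univ, if_true, Finset.card_univ, nsmul_eq_mul, mul_one] at h1
  have hc : (Fintype.card n : ℂ) ≠ 0 := by
    have := Fintype.card_pos_iff.2 ⟨o⟩
    exact_mod_cast this.ne'
  have hc1 : (Fintype.card n : ℂ) + 1 ≠ 0 := Nat.cast_add_one_ne_zero _
  rw [eq_div_iff (mul_ne_zero hc hc1)]
  linear_combination h1

/-- The fourth moments of the entries of a Haar random column. -/
theorem moment4_eq (o : n) (k : Fin 4 → n) : moment4 o k =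
    1 / ((Fintype.card n : ℂ) * (Fintype.card n + 1)) *
      ((if k 0 = k 1 ∧ k 2 = k 3 then 1 else 0) + if k 0 = k 3 ∧ k 2 = k 1 then 1 else 0) := by
  have hk : moment4 o k = moment4 o ![k 0, k 1, k 2, k 3] := rfl
  by_cases h1 : k 0 = k 1 ∧ k 2 = k 3
  · rw [if_pos h1, hk]
    rw [← h1.1, ← h1.2, moment4_diag, moment4_self]
    simp [eq_comm]
  · rw [if_neg h1]
    by_cases h2 : k 0 = k 3 ∧ k 2 = k 1
    · rw [if_pos h2, hk]
      rw [← h2.1, ← h2.2, ← (moment4_swap o _ _ _ _).1, moment4_diag, moment4_self, if_neg]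
      · ring
      · intro h; exact h1 ⟨h.trans h2.2, h.symm.trans h2.1⟩
    · rw [if_neg h2, moment4_eq_zero o k (by tauto)]; simp

/-- The second moments of the entries of a Haar random column. -/
theorem moment2_eq (o : n) (k l : n) : ∫ U, U.1 k o * star (U.1 l o) ∂haarUnitary n =
    1 / (Fintype.card n : ℂ) * if k = l then 1 else 0 := by
  -- Inserting the unit length of the column reduces second moments to fourth moments.
  have h1 : ∀ U : Matrix.unitaryGroup n ℂ, U.1 k o * star (U.1 l o) =
      ∑ j, U.1 k o * star (U.1 l o) * U.1 j o * star (U.1 j o) := by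
    intro U
    simp only [mul_assoc, ← Finset.mul_sum, sum_normSq_column, mul_one]
  have h2 : ∀ j, ∫ U : Matrix.unitaryGroup n ℂ,
      U.1 k o * star (U.1 l o) * U.1 j o * star (U.1 j o) ∂haarUnitary n =
      moment4 o ![k, l, j, j] := fun j => by simp [moment4]
  rw [MeasureTheory.integral_congr_ae (.of_forall h1),
    MeasureTheory.integral_finsetSum _ fun j _ => integrable_haar (continuous_moment4 o k l j j)]
  simp only [h2, moment4_eq, Matrix.cons_val, ← Finset.mul_sum, and_true]
  have hc : (Fintype.card n : ℂ) ≠ 0 := by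
    have := Fintype.card_pos_iff.2 ⟨o⟩
    exact_mod_cast this.ne'
  have hc1 : (Fintype.card n : ℂ) + 1 ≠ 0 := Nat.cast_add_one_ne_zero _
  rw [Finset.sum_add_distrib]
  by_cases h : k = l
  · subst h
    have : ∀ j, (k = j ∧ j = k) ↔ k = j := fun j => ⟨And.left, fun h => ⟨h, h.symm⟩⟩
    simp only [this, Finset.sum_ite_eq, if_true, Finset.mem_univ, Finset.sum_const,
      Finset.card_univ, nsmul_eq_mul]
    field_simp
  · have : ∀ j, ¬ (k = j ∧ j = l) := fun j hj => h (hj.1.trans hj.2)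
    simp [h, this]

end HaarMoments

end

section

open MeasureTheory Polynomial

/-! ### Almost sure non-vanishing -/

section Nonvanishing

/-- A set is null if, for almost every point, its translates under a sequence of measure preserving
maps contain the point only at the roots of a polynomial of bounded degree. -/
theorem measure_eq_zero_of_polynomial {Ω : Type*} [MeasurableSpace Ω] {μ : Measure Ω}
    [IsProbabilityMeasure μ] {S : Set Ω} (hS : MeasurableSet S) {f : ℕ → Ω → Ω}
    (hf : ∀ t, MeasurePreserving (f t) μ μ) {z : ℕ → ℂ} (hz : Function.Injective z) (d : ℕ)
    {p : Ω → ℂ[X]} (hp : ∀ᵐ ω ∂μ, p ω ≠ 0) (hd : ∀ ω, (p ω).natDegree ≤ d)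
    (h : ∀ ω t, f t ω ∈ S → (p ω).eval (z t) = 0) : μ S = 0 := by
  classical
  by_contra hne
  -- Almost every point lies in at most `d` of the first `m` preimages of `S`, whose measures add up
  -- to `m` times that of `S`.
  have hm : ∀ m : ℕ, (m : ENNReal) * μ S ≤ d := by
    intro m
    have h1 : (m : ENNReal) * μ S = ∫⁻ ω, ∑ t ∈ Finset.range m, (f t ⁻¹' S).indicator 1 ω ∂μ := by
      rw [lintegral_finsetSum _ fun t _ => measurable_one.indicator ((hf t).measurable hS)]
      simp only [lintegral_indicator_one ((hf _).measurable hS),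
        (hf _).measure_preimage hS.nullMeasurableSet]
      simp
    rw [h1]
    calc _ ≤ ∫⁻ _, (d : ENNReal) ∂μ := by
          refine lintegral_mono_ae ?_
          filter_upwards [hp] with ω hω
          have h2 : ∑ t ∈ Finset.range m, (f t ⁻¹' S).indicator (1 : Ω → ENNReal) ω =
              ((Finset.range m).filter fun t => f t ω ∈ S).card := by
            rw [Finset.card_filter]
            push_cast
            refine Finset.sum_congr rfl fun t _ => ?_
            simp [Set.indicator_apply]
          rw [h2]
          have h3 : (((Finset.range m).filter fun t => f t ω ∈ S).image z).card ≤
              (p ω).natDegree := by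
            refine Polynomial.card_le_degree_of_subset_roots fun x hx => ?_
            obtain ⟨t, ht, rfl⟩ := Finset.mem_image.1 (Finset.mem_def.2 hx)
            exact (Polynomial.mem_roots hω).2 (h ω t (Finset.mem_filter.1 ht).2)
          rw [Finset.card_image_of_injective _ hz] at h3
          exact_mod_cast h3.trans (hd ω)
      _ = d := by simp
  obtain ⟨m, hlt⟩ := ENNReal.exists_nat_mul_gt hne (ENNReal.natCast_ne_top d)
  exact (hm m).not_gt hlt

/-- A sequence of distinct complex numbers of modulus one. -/
def unitSeq (t : ℕ) : ℂ := (1 + t * Complex.I) / (1 - t * Complex.I)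

theorem one_sub_mul_I_ne_zero (t : ℕ) : (1 : ℂ) - t * Complex.I ≠ 0 := by
  intro h
  have := congrArg Complex.re h
  simp at this

theorem norm_unitSeq (t : ℕ) : ‖unitSeq t‖ = 1 := by
  have : (starRingEnd ℂ) (1 - t * Complex.I) = 1 + t * Complex.I := by simp
  rw [unitSeq, norm_div, ← this, RCLike.norm_conj]
  exact div_self (norm_ne_zero_iff.2 (one_sub_mul_I_ne_zero t))

theorem unitSeq_injective : Function.Injective unitSeq := by
  intro s t h
  rw [unitSeq, unitSeq, div_eq_div_iff (one_sub_mul_I_ne_zero s) (one_sub_mul_I_ne_zero t)] at h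
  have h2 : ((s : ℂ) - t) * (2 * Complex.I) = 0 := by linear_combination h
  have h3 : (2 : ℂ) * Complex.I ≠ 0 := by simp
  exact_mod_cast sub_eq_zero.1 ((mul_eq_zero.1 h2).resolve_right h3)

variable {n : Type} [Fintype n]

/-- A numbering of a finite type. -/
def index (k : n) : ℕ := Fintype.equivFin n k

theorem index_injective : Function.Injective (index : n → ℕ) := fun _ _ h =>
  (Fintype.equivFin n).injective (Fin.ext h)

/-- The polynomial with given coefficients. -/
def coeffPoly (c : n → ℂ) : ℂ[X] := ∑ k, C (c k) * X ^ index k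

theorem coeffPoly_eval (c : n → ℂ) (z : ℂ) : (coeffPoly c).eval z = ∑ k, c k * z ^ index k := by
  simp [coeffPoly, eval_finsetSum]

theorem coeffPoly_ne_zero (c : n → ℂ) {k : n} (hk : c k ≠ 0) : coeffPoly c ≠ 0 := by
  intro h
  apply hk
  have := congrArg (fun p => p.coeff (index k)) h
  simp only [coeffPoly, finsetSum_coeff, coeff_C_mul, coeff_X_pow, coeff_zero] at this
  rw [Finset.sum_eq_single k] at this
  · simpa using this
  · intro j _ hj
    rw [if_neg fun h => hj (index_injective h).symm, mul_zero]
  · simp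

theorem natDegree_coeffPoly_le (c : n → ℂ) : (coeffPoly c).natDegree ≤ Fintype.card n := by
  refine natDegree_sum_le_of_forall_le _ _ fun k _ => ?_
  refine (natDegree_C_mul_X_pow_le _ _).trans ?_
  exact (Fintype.equivFin n k).2.le

variable [DecidableEq n]

/-- The diagonal unitaries whose phases are powers of a given phase. -/
def phaseSeq (n : Type) [Fintype n] [DecidableEq n] (t : ℕ) : Matrix.unitaryGroup n ℂ :=
  phase (fun k => unitSeq t ^ index k) fun k => by rw [norm_pow, norm_unitSeq, one_pow]

theorem measurable_entry (k o : n) :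
    Measurable fun U : Matrix.unitaryGroup n ℂ => U.1 k o :=
  (continuous_entry k o).measurable

/-- The entries of a Haar random unitary are almost surely non-zero. -/
theorem haar_entry_ne_zero (k o : n) : ∀ᵐ U ∂haarUnitary n, U.1 k o ≠ 0 := by
  set d : ℝ := ((Fintype.card n : ℕ) : ℝ) with hd
  have hd1 : 1 ≤ d := by
    have : 1 ≤ Fintype.card n := Fintype.card_pos_iff.2 ⟨k⟩
    rw [hd]; exact_mod_cast this
  -- This vector is chosen so that row `k` of the reflection has no zero entry. After multiplication
  -- by phases and this reflection, the entry is a non-zero polynomial in the phase.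
  set v : n → ℝ := fun i => if i = k then d else 1 with hv
  have hs : ∑ i, v i ^ 2 = d ^ 2 + (d - 1) := by
    have : ∀ i, v i ^ 2 = (if i = k then d ^ 2 - 1 else 0) + 1 := fun i => by
      simp only [hv]; split_ifs <;> ring
    simp only [this, Finset.sum_add_distrib, Finset.sum_ite_eq', Finset.mem_univ, if_true,
      Finset.sum_const, Finset.card_univ, nsmul_eq_mul, mul_one, ← hd]
    ring
  have hs0 : ∑ i, v i ^ 2 ≠ 0 := by rw [hs]; nlinarith
  set a : n → ℂ := fun j => (if j = k then 1 else 0) - ((2 / (∑ i, v i ^ 2) * d * v j : ℝ) : ℂ)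
    with ha
  have ha0 : ∀ j, a j ≠ 0 := by
    intro j hj
    have hp : 0 < d ^ 2 + (d - 1) := by nlinarith
    by_cases hjk : j = k
    · have : (1 : ℝ) - 2 / (d ^ 2 + (d - 1)) * d * d = 0 := by
        rw [← hs]
        simp only [ha, hjk, hv, if_true] at hj ⊢
        exact_mod_cast hj
      field_simp at this
      nlinarith
    · have : 2 / (d ^ 2 + (d - 1)) * d * 1 = 0 := by
        rw [← hs]
        simp only [ha, hjk, hv, if_false, zero_sub, neg_eq_zero] at hj ⊢
        exact_mod_cast hj
      have : 0 < 2 / (d ^ 2 + (d - 1)) * d * 1 := by positivity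
      linarith
  refine measure_eq_zero_of_polynomial (S := {U : Matrix.unitaryGroup n ℂ | ¬ U.1 k o ≠ 0})
    (f := fun t U => reflectionAlong v hs0 * (phaseSeq n t * U))
    ?_ (fun t => (measurePreserving_mul_left _).comp (measurePreserving_mul_left _))
    unitSeq_injective (Fintype.card n) (p := fun U => coeffPoly fun j => a j * U.1 j o) ?_
    (fun U => natDegree_coeffPoly_le _) ?_
  · simp only [ne_eq, not_not]
    exact measurable_entry k o (measurableSet_singleton 0)
  · refine .of_forall fun U => ?_
    obtain ⟨j, hj⟩ : ∃ j, U.1 j o ≠ 0 := by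
      by_contra! h
      have := sum_normSq_column U o
      simp [h] at this
    exact coeffPoly_ne_zero _ (mul_ne_zero (ha0 j) hj)
  · intro U t h
    rw [coeffPoly_eval]
    have h1 := not_not.1 h
    rw [reflectionAlong_mul_apply] at h1
    rw [← h1]
    simp only [phaseSeq, phase_mul_apply, ha, sub_mul, Finset.sum_sub_distrib, ite_mul, one_mul,
      zero_mul, Finset.sum_ite_eq', Finset.mem_univ, if_true, Finset.mul_sum]
    congr 1
    · ring
    · refine Finset.sum_congr rfl fun j _ => ?_
      simp only [hv, if_true]
      push_cast; ring

end Nonvanishing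

/-! ### Parts of the network without outgoing legs -/

section ClosedParts

variable {V E : Type} (inc : V → E → Prop) (w : E → ℕ) (D : ℕ) (out : Set V)
  [Fintype V] [Fintype E] [NeZero D]

/-- The reference label of the legs at a vertex. -/
def zeroLabel (x : V) : LegIndex inc w D x := fun _ _ => 0

open Classical in
/-- The tensors that are replaced by the reference basis state on a set of vertices. -/
def truncate (R : Set V) (T : Tensors inc w D out) : Tensors inc w D out :=
  fun x k => if x.1 ∈ R then if k = zeroLabel inc w D x.1 then 1 else 0 else T x k

open Classical in
/-- The contraction of the tensors on a set of vertices from which no legs lead out. -/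
def closedFactor (R : Set V) (T : Tensors inc w D out) : ℂ :=
  ∑ b, ∏ x : {x : V // x ∉ out}, if x.1 ∈ R then
    T x (legsAt inc w D x.1 (glue inc w D R (fun _ _ => 0) b fun _ _ => 0)) else 1

variable {inc w D out}

-- Each leg inside `R` ends at a vertex with the reference state, so only the zero labelling
-- contributes.
open Classical in
theorem closedFactor_truncate (R : Set V) (hout : Disjoint R out) (T : Tensors inc w D out) :
    closedFactor inc w D out R (truncate inc w D out R T) = 1 := by
  unfold closedFactor truncate
  rw [Finset.sum_eq_single fun _ _ => 0]
  · refine Finset.prod_eq_one fun x _ => ?_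
    split_ifs with h1 h2
    · rfl
    · refine absurd ?_ h2
      funext e
      simp only [legsAt, glue]
      split_ifs <;> rfl
    · rfl
  · intro b _ hb
    obtain ⟨e, he⟩ : ∃ e, b e ≠ fun _ => 0 := Function.ne_iff.1 hb
    obtain ⟨x, hx, hxe⟩ := e.2
    refine Finset.prod_eq_zero (Finset.mem_univ ⟨x, Set.disjoint_left.1 hout hx⟩) ?_
    rw [if_pos hx, if_pos hx, if_neg]
    intro h
    apply he
    have := congrFun h ⟨e.1.1, hxe⟩
    simp only [legsAt, glue] at this
    rwa [dif_neg e.1.2, dif_pos e.2] at this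
  · simp

/-- No legs lead out of a set of vertices. -/
def IsClosedPart (inc : V → E → Prop) (w : E → ℕ) (R : Set V) : Prop :=
  ∀ e, crosses inc R e → w e = 0

-- If no leg joins `R` to the rest, the sum over labellings is the product of a sum over the labels
-- at `R` and one over the others.
open Classical in
theorem boundaryState_eq_closedFactor_mul (R : Set V) (hR : IsClosedPart inc w R)
    (hout : Disjoint R out) (T : Tensors inc w D out) (β : (b : out) → LegIndex inc w D b.1) :
    boundaryState inc w D out T β = closedFactor inc w D out R T *
      ∑ c, if ∀ b : out, legsAt inc w D b.1
          (glue inc w D R (fun _ _ => 0) (fun _ _ => 0) c) = β b then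
        ∏ x : {x : V // x ∉ out}, if x.1 ∈ R then 1 else
          T x (legsAt inc w D x.1 (glue inc w D R (fun _ _ => 0) (fun _ _ => 0) c)) else 0 := by
  unfold boundaryState closedFactor
  rw [sum_glue inc w D R, Finset.sum_mul_sum, Finset.sum_eq_single fun _ _ => 0]
  · refine Finset.sum_congr rfl fun b _ => Finset.sum_congr rfl fun c _ => ?_
    have h1 : ∀ y : out, legsAt inc w D y.1 (glue inc w D R (fun _ _ => 0) b c) =
        legsAt inc w D y.1 (glue inc w D R (fun _ _ => 0) (fun _ _ => 0) c) := fun y =>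
      legsAt_glue_of_notMem inc w D _ _ _ _ fun h => Set.disjoint_left.1 hout h y.2
    simp only [h1]
    split_ifs
    · rw [← Finset.prod_mul_distrib]
      refine Finset.prod_congr rfl fun x _ => ?_
      split_ifs with hx
      · rw [mul_one]
        exact congrArg (T x) (legsAt_glue_of_mem inc w D _ _ _ _ hx)
      · rw [one_mul]
        exact congrArg (T x) (legsAt_glue_of_notMem inc w D _ _ _ _ hx)
    · rw [mul_zero]
  · intro k _ hk
    refine absurd ?_ hk
    funext e i
    exact absurd (i.2.trans_eq (hR e.1 e.2)) (Nat.not_lt_zero _)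
  · simp

theorem boundaryState_eq_truncate (R : Set V) (hR : IsClosedPart inc w R)
    (hout : Disjoint R out) (T : Tensors inc w D out) (β : (b : out) → LegIndex inc w D b.1) :
    boundaryState inc w D out T β = closedFactor inc w D out R T *
      boundaryState inc w D out (truncate inc w D out R T) β := by
  classical
  rw [boundaryState_eq_closedFactor_mul R hR hout, boundaryState_eq_closedFactor_mul R hR hout,
    closedFactor_truncate R hout, one_mul]
  congr 1
  refine Finset.sum_congr rfl fun c _ => ?_
  split_ifs
  · refine Finset.prod_congr rfl fun x _ => ?_
    split_ifs with hx
    · rfl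
    · simp [truncate, hx]
  · rfl

/-- The tensors on `R` only multiply the state by a scalar, which the normalization cancels. -/
theorem reducedDensity_truncate (R : Set V) (hR : IsClosedPart inc w R) (hout : Disjoint R out)
    (A : Set out) (T : Tensors inc w D out) (h0 : closedFactor inc w D out R T ≠ 0) :
    reducedDensity inc w D out A T =
      reducedDensity inc w D out A (truncate inc w D out R T) := by
  classical
  set l := closedFactor inc w D out R T with hl
  have h1 : boundaryMatrix inc w D out A T =
      l • boundaryMatrix inc w D out A (truncate inc w D out R T) := by
    funext α α'
    simp only [boundaryMatrix, Matrix.smul_apply, smul_eq_mul]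
    exact boundaryState_eq_truncate R hR hout T _
  unfold reducedDensity
  simp only [boundaryState_eq_truncate R hR hout T, h1, norm_mul, mul_pow, ← Finset.mul_sum, ← hl]
  rw [Matrix.conjTranspose_smul, Matrix.smul_mul, Matrix.mul_smul, smul_smul, ← Complex.coe_smul,
    smul_smul, ← Complex.coe_smul]
  congr 1
  push_cast
  rw [Complex.star_def, Complex.mul_conj', mul_inv, mul_right_comm, mul_comm (_⁻¹),
    mul_inv_cancel₀, one_mul]
  exact pow_ne_zero 2 (Complex.ofReal_ne_zero.2 (norm_ne_zero_iff.2 h0))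

theorem entropy_congr {A : Set out} {T T' : Tensors inc w D out}
    (h : reducedDensity inc w D out A T = reducedDensity inc w D out A T') :
    entropy inc w D out A T = entropy inc w D out A T' := by
  classical
  have key : ∀ (ρ ρ' : Matrix (BoundaryIndex inc w D out (· ∈ A))
      (BoundaryIndex inc w D out (· ∈ A)) ℂ) (hρ : ρ.IsHermitian) (hρ' : ρ'.IsHermitian),
      ρ = ρ' → hρ.eigenvalues = hρ'.eigenvalues := by
    rintro ρ _ _ _ rfl; rfl
  unfold entropy
  rw [key _ _ _ _ h]

-- The contraction is linear in the tensor at each vertex, which will make it a polynomial in a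
-- phase applied there.
open Classical in
theorem closedFactor_eq_sum (R : Set V) (T : Tensors inc w D out) (x : {x : V // x ∉ out})
    (hx : x.1 ∈ R) : closedFactor inc w D out R T =
      ∑ k, T x k * closedFactor inc w D out R (Function.update T x (Pi.single k 1)) := by
  simp only [closedFactor, Finset.mul_sum]
  rw [Finset.sum_comm]
  refine Finset.sum_congr rfl fun b _ => ?_
  set a : Lab w D := glue inc w D R (fun _ _ => 0) b fun _ _ => 0 with ha
  rw [Finset.sum_eq_single (legsAt inc w D x.1 a)]
  · rw [← Finset.mul_prod_erase _ _ (Finset.mem_univ x), if_pos hx]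
    congr 1
    rw [← Finset.mul_prod_erase _ _ (Finset.mem_univ x), if_pos hx, Function.update_self,
      Pi.single_eq_same, one_mul]
    refine Finset.prod_congr rfl fun y hy => ?_
    rw [Function.update_of_ne (Finset.ne_of_mem_erase hy)]
  · intro k _ hk
    rw [Finset.prod_eq_zero (Finset.mem_univ x), mul_zero]
    rw [if_pos hx, Function.update_self, Pi.single_eq_of_ne (Ne.symm hk)]
  · simp

theorem closedFactor_congr (R : Set V) {T T' : Tensors inc w D out}
    (h : ∀ x : {x : V // x ∉ out}, x.1 ∈ R → T x = T' x) :
    closedFactor inc w D out R T = closedFactor inc w D out R T' := by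
  unfold closedFactor
  refine Finset.sum_congr rfl fun b _ => Finset.prod_congr rfl fun x _ => ?_
  split_ifs with hx
  · rw [h x hx]
  · rfl

variable (inc w D out) in
open Classical in
/-- Random tensors on a set of vertices, the reference basis state at the others. -/
def mixedTensors (s : Finset {x : V // x ∉ out}) (U : Unitaries inc w D out) :
    Tensors inc w D out :=
  fun x k => if x ∈ s then tensorsOf inc w D out U x k else
    if k = zeroLabel inc w D x.1 then 1 else 0

theorem measurable_tensorsOf (x : {x : V // x ∉ out}) (k : LegIndex inc w D x.1) :
    Measurable fun U : Unitaries inc w D out => tensorsOf inc w D out U x k :=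
  (measurable_entry k _).comp (measurable_pi_apply x)

theorem measurable_closedFactor_mixedTensors (R : Set V) (s : Finset {x : V // x ∉ out}) :
    Measurable fun U => closedFactor inc w D out R (mixedTensors inc w D out s U) := by
  classical
  unfold closedFactor
  refine Finset.measurable_sum _ fun b _ => Finset.measurable_prod _ fun x _ => ?_
  split_ifs
  · unfold mixedTensors
    by_cases h : x ∈ s
    · simp only [h, if_true]
      exact measurable_tensorsOf x _
    · simp only [h, if_false]
      exact measurable_const
  · exact measurable_const

instance : IsProbabilityMeasure (randomLaw inc w D out) := by
  classical
  unfold randomLaw; infer_instance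

theorem measurePreserving_mul_left_randomLaw (W : Unitaries inc w D out) :
    MeasurePreserving (fun U => W * U) (randomLaw inc w D out) (randomLaw inc w D out) := by
  classical
  exact measurePreserving_pi _ _ fun x => measurePreserving_mul_left (W x)

theorem ae_tensorsOf_ne_zero (x : {x : V // x ∉ out}) (k : LegIndex inc w D x.1) :
    ∀ᵐ U ∂randomLaw inc w D out, tensorsOf inc w D out U x k ≠ 0 := by
  classical
  exact (measurePreserving_eval (fun x : {x : V // x ∉ out} =>
    haarUnitary (LegIndex inc w D x.1)) x).quasiMeasurePreserving.ae (haar_entry_ne_zero k _)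

/-- The contraction of random tensors on a part without outgoing legs is almost surely non-zero. -/
theorem ae_closedFactor_mixedTensors_ne_zero (R : Set V) (hout : Disjoint R out)
    (s : Finset {x : V // x ∉ out}) : ∀ᵐ U ∂randomLaw inc w D out,
      closedFactor inc w D out R (mixedTensors inc w D out s U) ≠ 0 := by
  classical
  -- Randomness is switched on one vertex at a time, starting from basis states, where the factor is
  -- one.
  induction s using Finset.induction_on with
  | empty =>
    refine .of_forall fun U => ?_
    rw [closedFactor_congr (T' := truncate inc w D out R (tensorsOf inc w D out U)) R,
      closedFactor_truncate R hout]
    · exact one_ne_zero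
    · intro x hx
      funext k
      simp [mixedTensors, truncate, hx]
  | insert x s hxs ih =>
    by_cases hx : x.1 ∈ R
    swap
    · filter_upwards [ih] with U hU
      rwa [closedFactor_congr (T' := mixedTensors inc w D out s U) R]
      intro y hy
      have : y ≠ x := fun h => hx (h ▸ hy)
      funext k
      simp [mixedTensors, this]
    set c : LegIndex inc w D x.1 → Unitaries inc w D out → ℂ := fun k U =>
      closedFactor inc w D out R (Function.update (mixedTensors inc w D out s U) x (Pi.single k 1))
      with hc
    have hsum : ∀ U, closedFactor inc w D out R (mixedTensors inc w D out (insert x s) U) =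
        ∑ k, tensorsOf inc w D out U x k * c k U := by
      intro U
      rw [closedFactor_eq_sum R _ x hx]
      refine Finset.sum_congr rfl fun k _ => ?_
      congr 1
      · simp [mixedTensors]
      · simp only [hc]
        congr 1
        funext y
        rcases eq_or_ne y x with rfl | h
        · simp
        · rw [Function.update_of_ne h, Function.update_of_ne h]
          funext j
          simp [mixedTensors, h]
    -- Phases at the vertex `x` alone preserve the law and leave the coefficients `c` unchanged.
    set W : ℕ → Unitaries inc w D out := fun t =>
      Function.update 1 x (phaseSeq (LegIndex inc w D x.1) t) with hW
    have hcW : ∀ k t U, c k (W t * U) = c k U := by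
      intro k t U
      simp only [hc]
      congr 1
      funext y
      rcases eq_or_ne y x with rfl | h
      · simp
      · rw [Function.update_of_ne h, Function.update_of_ne h]
        funext j
        simp [mixedTensors, tensorsOf, hW, Function.update_of_ne h]
    -- The coefficient of the reference label is the factor of the previous stage, so almost surely
    -- the polynomial does not vanish identically.
    have hc0 : ∀ U, c (zeroLabel inc w D x.1) U =
        closedFactor inc w D out R (mixedTensors inc w D out s U) := by
      intro U
      simp only [hc]
      congr 1
      rw [Function.update_eq_self_iff]
      funext k
      simp [mixedTensors, hxs, Pi.single_apply]
    refine measure_eq_zero_of_polynomial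
      (S := {U | ¬ closedFactor inc w D out R (mixedTensors inc w D out (insert x s) U) ≠ 0})
      (f := fun t U => W t * U) ?_ (fun t => measurePreserving_mul_left_randomLaw (W t))
      unitSeq_injective (Fintype.card (LegIndex inc w D x.1))
      (p := fun U => coeffPoly fun k => tensorsOf inc w D out U x k * c k U) ?_
      (fun U => natDegree_coeffPoly_le _) ?_
    · simp only [ne_eq, not_not]
      exact measurable_closedFactor_mixedTensors R _ (measurableSet_singleton 0)
    · filter_upwards [ih, ae_tensorsOf_ne_zero x (zeroLabel inc w D x.1)] with U h1 h2
      exact coeffPoly_ne_zero _ (k := zeroLabel inc w D x.1)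
        (mul_ne_zero h2 (by rw [hc0]; exact h1))
    · intro U t h
      have h1 := not_not.1 h
      rw [hsum] at h1
      rw [coeffPoly_eval, ← h1]
      refine Finset.sum_congr rfl fun k _ => ?_
      rw [hcW]
      have : tensorsOf inc w D out (W t * U) x k =
          unitSeq t ^ index k * tensorsOf inc w D out U x k := by
        simp only [tensorsOf, hW, Pi.mul_apply, Function.update_self]
        exact phase_mul_apply _ _ _ _ _
      rw [this]; ring

/-- Replacing the tensors on a part without outgoing legs by basis states almost surely does not
change the entropy. -/
theorem ae_entropy_truncate (R : Set V) (hR : IsClosedPart inc w R) (hout : Disjoint R out)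
    (A : Set out) : ∀ᵐ U ∂randomLaw inc w D out,
      entropy inc w D out A (tensorsOf inc w D out U) =
        entropy inc w D out A (truncate inc w D out R (tensorsOf inc w D out U)) := by
  classical
  filter_upwards [ae_closedFactor_mixedTensors_ne_zero R hout Finset.univ] with U hU
  refine entropy_congr (reducedDensity_truncate R hR hout A _ ?_)
  have : mixedTensors inc w D out Finset.univ U = tensorsOf inc w D out U := by
    funext x k; simp [mixedTensors]
  rwa [this] at hU

end ClosedParts

end

section

open MeasureTheory

/-! ### Moments of the norm and of the purity of a random state -/

section Counting

variable {V E : Type} (inc : V → E → Prop) (w : E → ℕ) (D : ℕ) [Fintype V] [Fintype E]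

open Classical in
/-- A sum over several labellings of a product over the vertices of sums of indicators of local
conditions is a sum of products over the edges. -/
theorem sum_prod_eq_sum_prod_card {O ι : Type} [Fintype ι] [DecidableEq ι] (c : V → ℝ) (t : V → Finset O)
    (κV : ∀ x, O → (ι → LegIndex inc w D x) → Prop)
    (κE : ∀ e, O → (ι → Fin (w e) → Fin D) → Prop)
    (h : ∀ x o k, κV x o k ↔ ∀ e : {e : E // inc x e}, κE e.1 o fun i => k i e) :
    ∑ a : ι → Lab w D, ∏ x, (c x * ∑ o ∈ t x,
        if κV x o fun i => legsAt inc w D x (a i) then (1 : ℝ) else 0) =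
      (∏ x, c x) * ∑ σ ∈ Fintype.piFinset t, ∏ e,
        (Fintype.card {l : ι → Fin (w e) → Fin D // ∀ x, inc x e → κE e (σ x) l} : ℝ) := by
  simp only [Finset.prod_mul_distrib, ← Finset.mul_sum]
  congr 1
  simp only [Finset.prod_univ_sum]
  rw [Finset.sum_comm]
  refine Finset.sum_congr rfl fun σ _ => ?_
  have h1 : ∀ a : ι → Lab w D,
      (∏ x, if κV x (σ x) fun i => legsAt inc w D x (a i) then (1 : ℝ) else 0) =
      ∏ e, if ∀ x, inc x e → κE e (σ x) fun i => a i e then (1 : ℝ) else 0 := by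
    intro a
    rw [Fintype.prod_boole, Fintype.prod_boole]
    congr 1
    refine propext ⟨fun H e x hx => (h x _ _).1 (H x) ⟨e, hx⟩, fun H x => (h x _ _).2 fun e =>
      H e.1 x e.2⟩
  simp only [h1]
  have h2 : ∀ e : E, (Fintype.card {l : ι → Fin (w e) → Fin D // ∀ x, inc x e → κE e (σ x) l} : ℝ) =
      ∑ l : ι → Fin (w e) → Fin D, if ∀ x, inc x e → κE e (σ x) l then (1 : ℝ) else 0 := by
    intro e
    rw [Fintype.card_subtype, Finset.card_filter]
    push_cast; rfl
  simp only [h2, Fintype.prod_sum]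
  exact (Equiv.piComm fun (_ : ι) (e : E) => Fin (w e) → Fin D).sum_comp fun b =>
    ∏ e, if ∀ x, inc x e → κE e (σ x) (b e) then (1 : ℝ) else 0

/-- The conditions on two copies of a label. -/
def PairTwo {B : Type} (z : B) (o : Bool) (l : Fin 2 → B) : Prop :=
  match o with
  | true => ∀ i, l i = z
  | false => l 0 = l 1

/-- The conditions on four copies of a label: all are the reference label, or they agree in pairs in
one of two ways. -/
def PairFour {B : Type} (z : B) (o : Option Bool) (l : Fin 4 → B) : Prop :=
  match o with
  | none => ∀ i, l i = z
  | some false => l 0 = l 1 ∧ l 2 = l 3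
  | some true => l 0 = l 3 ∧ l 2 = l 1

theorem pairTwo_iff [NeZero D] (x : V) (o : Bool) (k : Fin 2 → LegIndex inc w D x) :
    PairTwo (zeroLabel inc w D x) o k ↔
      ∀ e : {e : E // inc x e}, PairTwo (fun _ => (0 : Fin D)) o fun i => k i e := by
  cases o
  · exact ⟨fun h e => congrFun h e, fun h => funext h⟩
  · exact ⟨fun h e i => congrFun (h i) e, fun h i => funext fun e => h e i⟩

theorem pairFour_iff [NeZero D] (x : V) (o : Option Bool) (k : Fin 4 → LegIndex inc w D x) :
    PairFour (zeroLabel inc w D x) o k ↔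
      ∀ e : {e : E // inc x e}, PairFour (fun _ => (0 : Fin D)) o fun i => k i e := by
  rcases o with _ | _ | _
  · exact ⟨fun h e i => congrFun (h i) e, fun h i => funext fun e => h e i⟩
  · exact ⟨fun h e => ⟨congrFun h.1 e, congrFun h.2 e⟩, fun h =>
      ⟨funext fun e => (h e).1, funext fun e => (h e).2⟩⟩
  · exact ⟨fun h e => ⟨congrFun h.1 e, congrFun h.2 e⟩, fun h =>
      ⟨funext fun e => (h e).1, funext fun e => (h e).2⟩⟩

open Classical in
/-- The dimension of the legs on an edge, or `1` if it meets a set of vertices. -/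
def edgeDim (R : Set V) (e : E) : ℕ := if ∃ x ∈ R, inc x e then 1 else D ^ w e

-- An edge at `R` is frozen at the reference label; any other edge carries one free label, common to
-- both copies.
open Classical in
theorem card_pairTwo [NeZero D] {R : Set V} (e : E)
    (he : ∃ x, inc x e) (σ : V → Bool) (hσ : ∀ x, σ x = true ↔ x ∈ R) :
    Fintype.card {l : Fin 2 → Fin (w e) → Fin D //
      ∀ x, inc x e → PairTwo (fun _ => (0 : Fin D)) (σ x) l} = edgeDim inc w D R e := by
  unfold edgeDim
  split_ifs with h
  · obtain ⟨x, hx, hxe⟩ := h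
    rw [Fintype.card_eq_one_iff]
    refine ⟨⟨fun _ _ => 0, fun y _ => ?_⟩, ?_⟩
    · cases h : σ y
      · exact rfl
      · exact fun _ => rfl
    · rintro ⟨l, hl⟩
      have := hl x hxe
      rw [(hσ x).2 hx] at this
      exact Subtype.ext (funext this)
  · have h1 : ∀ x, inc x e → σ x = false := by
      intro x hx
      by_contra hc
      exact h ⟨x, (hσ x).1 (by simpa using hc), hx⟩
    obtain ⟨x, hx⟩ := he
    rw [show D ^ w e = Fintype.card (Fin (w e) → Fin D) by simp]
    refine Fintype.card_congr ⟨fun l => l.1 0, fun l => ⟨fun _ => l, fun y hy => ?_⟩, ?_, ?_⟩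
    · rw [h1 y hy]; exact rfl
    · rintro ⟨l, hl⟩
      have := hl x hx
      rw [h1 x hx] at this
      refine Subtype.ext (funext fun i => ?_)
      fin_cases i
      · rfl
      · exact this
    · intro l; rfl

-- Away from `R`, an edge has two free labels if its ends choose the same pairing, but only one if
-- they choose different pairings; this is the loss of a factor `D ^ w e`. An edge at `R` is frozen,
-- and there the factor is one: either the edge leaves `R` and has no legs, or all its vertices are
-- in `R`.
open Classical in
theorem card_pairFour_le [NeZero D] {R : Set V} (hR : IsClosedPart inc w R) (e : E)
    (he : ∃ x, inc x e) (σ : V → Option Bool) (hσ : ∀ x, σ x = none ↔ x ∈ R) :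
    Fintype.card {l : Fin 4 → Fin (w e) → Fin D //
      ∀ x, inc x e → PairFour (fun _ => (0 : Fin D)) (σ x) l} *
        (if crosses inc {x | σ x = some true} e then D ^ w e else 1) ≤
      edgeDim inc w D R e ^ 2 := by
  have hB : Fintype.card (Fin (w e) → Fin D) = D ^ w e := by simp
  by_cases h : ∃ x ∈ R, inc x e
  · have hone : (if crosses inc {x | σ x = some true} e then D ^ w e else 1) = 1 := by
      split_ifs with hc
      · by_cases hc2 : crosses inc R e
        · rw [hR e hc2, pow_zero]
        · obtain ⟨⟨y, hy, hye⟩, -⟩ := hc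
          have : y ∈ R := by
            by_contra hy'
            exact hc2 ⟨h, y, hy', hye⟩
          rw [← hσ] at this
          rw [Set.mem_ofPred_eq, this] at hy
          simp at hy
      · rfl
    rw [hone, mul_one, edgeDim, if_pos h, one_pow]
    obtain ⟨x, hx, hxe⟩ := h
    rw [Fintype.card_le_one_iff]
    rintro ⟨l, hl⟩ ⟨l', hl'⟩
    have h1 := hl x hxe
    have h2 := hl' x hxe
    rw [(hσ x).2 hx] at h1 h2
    exact Subtype.ext (funext fun i => (h1 i).trans (h2 i).symm)
  · rw [edgeDim, if_neg h]
    have hs : ∀ x, inc x e → σ x = some true ∨ σ x = some false := by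
      intro x hx
      rcases hx' : σ x with _ | _ | _
      · exact absurd ⟨x, (hσ x).1 hx', hx⟩ h
      · exact Or.inr rfl
      · exact Or.inl rfl
    split_ifs with hc
    · rw [sq]
      refine Nat.mul_le_mul_right _ ?_
      obtain ⟨⟨x, hx, hxe⟩, y, hy, hye⟩ := hc
      have hy' := (hs y hye).resolve_left hy
      rw [← hB]
      refine Fintype.card_le_of_injective (fun l => l.1 0) ?_
      rintro ⟨l, hl⟩ ⟨l', hl'⟩ (hll : l 0 = l' 0)
      have h1 := hl x hxe
      have h2 := hl y hye
      have h3 := hl' x hxe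
      have h4 := hl' y hye
      rw [hx] at h1 h3
      rw [hy'] at h2 h4
      obtain ⟨a1, a2⟩ := h1
      obtain ⟨b1, b2⟩ := h2
      obtain ⟨c1, c2⟩ := h3
      obtain ⟨d1, d2⟩ := h4
      refine Subtype.ext (funext fun i => ?_)
      fin_cases i
      · exact hll
      · exact b1.symm.trans (hll.trans d1)
      · exact a2.trans (b1.symm.trans (hll.trans (d1.trans c2.symm)))
      · exact a1.symm.trans (hll.trans c1)
    · rw [mul_one, sq, ← hB, ← Fintype.card_prod]
      refine Fintype.card_le_of_injective (fun l => (l.1 0, l.1 2)) ?_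
      rintro ⟨l, hl⟩ ⟨l', hl'⟩ hll
      obtain ⟨e1, e2⟩ : l 0 = l' 0 ∧ l 2 = l' 2 := by simpa using hll
      obtain ⟨x, hxe⟩ := he
      have h1 := hl x hxe
      have h3 := hl' x hxe
      refine Subtype.ext (funext fun i => ?_)
      rcases hs x hxe with hx | hx <;> rw [hx] at h1 h3 <;> obtain ⟨a1, a2⟩ := h1 <;>
        obtain ⟨c1, c2⟩ := h3 <;> fin_cases i
      · exact e1
      · exact a2.symm.trans (e2.trans c2)
      · exact e2
      · exact a1.symm.trans (e1.trans c1)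
      · exact e1
      · exact a1.symm.trans (e1.trans c1)
      · exact e2
      · exact a2.symm.trans (e2.trans c2)

end Counting

end

/-! ### Haar averages, vertex by vertex -/

section

open MeasureTheory

section Moments

theorem sum_fin_two {L : Type*} [Fintype L] {M : Type*} [AddCommMonoid M] (F : (Fin 2 → L) → M) :
    ∑ a, F a = ∑ a, ∑ b, F ![a, b] := by
  rw [← (finTwoArrowEquiv L).symm.sum_comp, Fintype.sum_prod_type]
  rfl

theorem sum_fin_four {L : Type*} [Fintype L] {M : Type*} [AddCommMonoid M]
    (F : (Fin 4 → L) → M) : ∑ a, F a = ∑ a, ∑ b, ∑ c, ∑ d, F ![a, b, c, d] := by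
  let e : L × L × L × L ≃ (Fin 4 → L) :=
    ⟨fun q => ![q.1, q.2.1, q.2.2.1, q.2.2.2], fun f => (f 0, f 1, f 2, f 3), fun _ => rfl,
      fun f => by funext i; fin_cases i <;> rfl⟩
  rw [← e.sum_comp]
  simp only [Fintype.sum_prod_type]
  rfl

variable {V E : Type} (inc : V → E → Prop) (w : E → ℕ) (D : ℕ) (out : Set V) (R : Set V)
  [Fintype E] [NeZero D]

open Classical in
/-- The components of a random tensor that is replaced by the reference state on `R`. -/
def column (x : V) (k : LegIndex inc w D x) (u : Matrix.unitaryGroup (LegIndex inc w D x) ℂ) : ℂ :=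
  if x ∈ R then if k = zeroLabel inc w D x then 1 else 0 else u.1 k (zeroLabel inc w D x)

theorem continuous_column (x : V) (k : LegIndex inc w D x) :
    Continuous (column inc w D R x k) := by
  unfold column
  split_ifs
  · exact continuous_const
  · exact continuous_const
  · exact continuous_entry _ _

theorem truncate_tensorsOf (U : Unitaries inc w D out) (x : {x : V // x ∉ out})
    (k : LegIndex inc w D x.1) : truncate inc w D out R (tensorsOf inc w D out U) x k =
      column inc w D R x.1 k (U x) := rfl

open Classical in
/-- The weight of a vertex in the mean norm. -/
def siteWeight (x : V) : ℝ :=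
  if x ∈ out ∨ x ∈ R then 1 else 1 / (Fintype.card (LegIndex inc w D x) : ℝ)

open Classical in
/-- The weight of a vertex in the mean purity. -/
def siteWeight' (x : V) : ℝ :=
  if x ∈ out ∨ x ∈ R then 1 else
    1 / ((Fintype.card (LegIndex inc w D x) : ℝ) * (Fintype.card (LegIndex inc w D x) + 1))

theorem card_legIndex_pos (x : V) : 0 < Fintype.card (LegIndex inc w D x) :=
  Fintype.card_pos_iff.2 ⟨zeroLabel inc w D x⟩

theorem siteWeight_pos (x : V) : 0 < siteWeight inc w D out R x := by
  have : (0 : ℝ) < Fintype.card (LegIndex inc w D x) := by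
    exact_mod_cast card_legIndex_pos inc w D x
  unfold siteWeight
  split_ifs <;> positivity

theorem siteWeight'_nonneg (x : V) : 0 ≤ siteWeight' inc w D out R x := by
  unfold siteWeight'
  split_ifs <;> positivity

/-- The inequality d² ≤ d(d + 1) lets the square of the mean norm be taken out of the mean purity.
-/
theorem siteWeight'_le (x : V) : siteWeight' inc w D out R x ≤ siteWeight inc w D out R x ^ 2 := by
  have : (0 : ℝ) < Fintype.card (LegIndex inc w D x) := by
    exact_mod_cast card_legIndex_pos inc w D x
  unfold siteWeight siteWeight'
  split_ifs
  · simp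
  · rw [div_pow, one_pow, sq]
    exact one_div_le_one_div_of_le (by positivity) (by nlinarith)

open Classical in
/-- The choices at a vertex in the mean norm. -/
def choicesTwo (x : V) : Finset Bool := {decide (x ∈ R)}

open Classical in
/-- The choices at a vertex in the mean purity. -/
def choicesFour (A : Set out) (x : V) : Finset (Option Bool) :=
  if h : x ∈ out then {some (decide (⟨x, h⟩ ∈ A))} else
    if x ∈ R then {none} else {some false, some true}

open Classical in
/-- The factor of a vertex in the mean norm. -/
def siteTwo (x : V) (k : Fin 2 → LegIndex inc w D x) : ℝ :=
  siteWeight inc w D out R x *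
    ∑ o ∈ choicesTwo R x, if PairTwo (zeroLabel inc w D x) o k then (1 : ℝ) else 0

open Classical in
/-- The factor of a vertex in the mean purity. -/
def siteFour (A : Set out) (x : V) (k : Fin 4 → LegIndex inc w D x) : ℝ :=
  siteWeight' inc w D out R x *
    ∑ o ∈ choicesFour out R A x, if PairFour (zeroLabel inc w D x) o k then (1 : ℝ) else 0

theorem integral_column_two (x : V) (hx : x ∉ out) (k : Fin 2 → LegIndex inc w D x) :
    ∫ u, column inc w D R x (k 0) u * star (column inc w D R x (k 1) u) ∂haarUnitary _ =
      (siteTwo inc w D out R x k : ℂ) := by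
  classical
  unfold siteTwo choicesTwo siteWeight
  rw [Finset.sum_singleton]
  by_cases hR : x ∈ R
  · have : PairTwo (zeroLabel inc w D x) true k ↔
        (k 0 = zeroLabel inc w D x ∧ k 1 = zeroLabel inc w D x) := Fin.forall_fin_two
    simp only [column, hR, if_true, or_true, decide_true, this]
    by_cases h0 : k 0 = zeroLabel inc w D x <;> by_cases h1 : k 1 = zeroLabel inc w D x <;>
      simp [h0, h1]
  · have : PairTwo (zeroLabel inc w D x) false k ↔ k 0 = k 1 := Iff.rfl
    simp only [column, hR, hx, if_false, or_self, decide_false, this]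
    rw [moment2_eq]
    push_cast
    congr 1
    split_ifs <;> simp

/-- The two pairings in the fourth moment become the two choices at a random vertex; a frozen vertex
has the single choice `none`. -/
theorem integral_column_four (A : Set out) (x : V) (hx : x ∉ out)
    (k : Fin 4 → LegIndex inc w D x) :
    ∫ u, column inc w D R x (k 0) u * star (column inc w D R x (k 1) u) *
      column inc w D R x (k 2) u * star (column inc w D R x (k 3) u) ∂haarUnitary _ =
      (siteFour inc w D out R A x k : ℂ) := by
  classical
  unfold siteFour choicesFour siteWeight'
  rw [dif_neg hx]
  by_cases hR : x ∈ R
  · rw [if_pos hR, Finset.sum_singleton]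
    have : PairFour (zeroLabel inc w D x) none k ↔
        (k 0 = zeroLabel inc w D x ∧ k 1 = zeroLabel inc w D x ∧ k 2 = zeroLabel inc w D x ∧
          k 3 = zeroLabel inc w D x) := by
      refine ⟨fun h => ⟨h 0, h 1, h 2, h 3⟩, fun h i => ?_⟩
      fin_cases i
      · exact h.1
      · exact h.2.1
      · exact h.2.2.1
      · exact h.2.2.2
    simp only [column, hR, if_true, or_true, this]
    by_cases h0 : k 0 = zeroLabel inc w D x <;> by_cases h1 : k 1 = zeroLabel inc w D x <;>
      by_cases h2 : k 2 = zeroLabel inc w D x <;> by_cases h3 : k 3 = zeroLabel inc w D x <;>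
      simp [h0, h1, h2, h3]
  · rw [if_neg hR, Finset.sum_pair (by simp)]
    have h1 : PairFour (zeroLabel inc w D x) (some false) k ↔ (k 0 = k 1 ∧ k 2 = k 3) := Iff.rfl
    have h2 : PairFour (zeroLabel inc w D x) (some true) k ↔ (k 0 = k 3 ∧ k 2 = k 1) := Iff.rfl
    simp only [column, hR, hx, if_false, or_self, h1, h2]
    refine (moment4_eq (zeroLabel inc w D x) k).trans ?_
    push_cast
    congr 2
    · split_ifs <;> simp
    · split_ifs <;> simp

variable [Fintype V]

open Classical in
theorem integral_prod_randomLaw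
    (g : ∀ x : {x : V // x ∉ out}, Matrix.unitaryGroup (LegIndex inc w D x.1) ℂ → ℂ) :
    ∫ U, ∏ x, g x (U x) ∂randomLaw inc w D out = ∏ x, ∫ u, g x u ∂haarUnitary _ :=
  integral_fintype_prod_eq_prod g

open Classical in
theorem integrable_prod_randomLaw
    (g : ∀ x : {x : V // x ∉ out}, Matrix.unitaryGroup (LegIndex inc w D x.1) ℂ → ℂ)
    (hg : ∀ x, Continuous (g x)) :
    Integrable (fun U => ∏ x, g x (U x)) (randomLaw inc w D out) :=
  Integrable.fintype_prod_dep fun x => integrable_haar (hg x)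

/-- The mean norm. -/
def meanNorm : ℝ := (∏ x, siteWeight inc w D out R x) * ∏ e, (edgeDim inc w D R e : ℝ)

theorem edgeDim_pos (e : E) : 0 < edgeDim inc w D R e := by
  unfold edgeDim
  split_ifs
  · exact one_pos
  · exact pow_pos (NeZero.pos D) _

theorem meanNorm_pos : 0 < meanNorm inc w D out R :=
  mul_pos (Finset.prod_pos fun x _ => siteWeight_pos inc w D out R x)
    (Finset.prod_pos fun e _ => by exact_mod_cast edgeDim_pos inc w D R e)

open Classical in
theorem normSqM_truncate (A : Set out) (U : Unitaries inc w D out) :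
    (normSqM (boundaryMatrix inc w D out A (truncate inc w D out R (tensorsOf inc w D out U))) : ℂ) =
      ∑ a : Fin 2 → Lab w D,
        if ∀ b : out, legsAt inc w D b.1 (a 0) = legsAt inc w D b.1 (a 1) then
          ∏ x : {x : V // x ∉ out}, column inc w D R x.1 (legsAt inc w D x.1 (a 0)) (U x) *
            star (column inc w D R x.1 (legsAt inc w D x.1 (a 1)) (U x)) else 0 := by
  rw [boundaryMatrix_eq_fibreMatrix, normSqM_fibreMatrix, sum_fin_two]
  refine Finset.sum_congr rfl fun a _ => Finset.sum_congr rfl fun b _ => ?_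
  have h1 : (boundaryLabels inc w D out (· ∈ A) a = boundaryLabels inc w D out (· ∈ A) b ∧
      boundaryLabels inc w D out (· ∉ A) a = boundaryLabels inc w D out (· ∉ A) b) ↔
      ∀ y : out, legsAt inc w D y.1 a = legsAt inc w D y.1 b := by
    refine ⟨fun h y => ?_, fun h => ⟨funext fun y => h y.1, funext fun y => h y.1⟩⟩
    by_cases hy : y ∈ A
    · exact congrFun h.1 ⟨y, hy⟩
    · exact congrFun h.2 ⟨y, hy⟩
  simp only [h1, Matrix.cons_val, Finset.prod_mul_distrib, amplitude, truncate_tensorsOf, star_prod]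

-- The gluing of the four copies at the boundary has the form of the Haar pairings: `some true` on
-- `A`, `some false` off `A`. The region thus acts as a boundary condition.
open Classical in
theorem purityM_truncate (A : Set out) (U : Unitaries inc w D out) :
    (purityM (boundaryMatrix inc w D out A (truncate inc w D out R (tensorsOf inc w D out U))) : ℂ) =
      ∑ a : Fin 4 → Lab w D,
        if ∀ b : out, PairFour (zeroLabel inc w D b.1) (some (decide (b ∈ A)))
            (fun i => legsAt inc w D b.1 (a i)) then
          ∏ x : {x : V // x ∉ out}, column inc w D R x.1 (legsAt inc w D x.1 (a 0)) (U x) *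
            star (column inc w D R x.1 (legsAt inc w D x.1 (a 1)) (U x)) *
            column inc w D R x.1 (legsAt inc w D x.1 (a 2)) (U x) *
            star (column inc w D R x.1 (legsAt inc w D x.1 (a 3)) (U x)) else 0 := by
  rw [boundaryMatrix_eq_fibreMatrix, purityM_fibreMatrix, sum_fin_four]
  refine Finset.sum_congr rfl fun a _ => Finset.sum_congr rfl fun b _ =>
    Finset.sum_congr rfl fun c _ => Finset.sum_congr rfl fun d _ => ?_
  have h1 : (boundaryLabels inc w D out (· ∈ A) a = boundaryLabels inc w D out (· ∈ A) d ∧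
      boundaryLabels inc w D out (· ∈ A) c = boundaryLabels inc w D out (· ∈ A) b ∧
      boundaryLabels inc w D out (· ∉ A) a = boundaryLabels inc w D out (· ∉ A) b ∧
      boundaryLabels inc w D out (· ∉ A) c = boundaryLabels inc w D out (· ∉ A) d) ↔
      ∀ y : out, PairFour (zeroLabel inc w D y.1) (some (decide (y ∈ A)))
        (fun i => legsAt inc w D y.1 ((![a, b, c, d] : Fin 4 → Lab w D) i)) := by
    constructor
    · rintro ⟨ha, hb, hc, hd⟩ y
      by_cases hy : y ∈ A
      · rw [decide_eq_true hy]
        exact ⟨congrFun ha ⟨y, hy⟩, congrFun hb ⟨y, hy⟩⟩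
      · rw [decide_eq_false hy]
        exact ⟨congrFun hc ⟨y, hy⟩, congrFun hd ⟨y, hy⟩⟩
    · intro h
      have hA : ∀ y : {y : out // y ∈ A}, legsAt inc w D y.1.1 a = legsAt inc w D y.1.1 d ∧
          legsAt inc w D y.1.1 c = legsAt inc w D y.1.1 b := by
        intro y
        have := h y.1
        rw [decide_eq_true y.2] at this
        exact this
      have hA' : ∀ y : {y : out // y ∉ A}, legsAt inc w D y.1.1 a = legsAt inc w D y.1.1 b ∧
          legsAt inc w D y.1.1 c = legsAt inc w D y.1.1 d := by
        intro y
        have := h y.1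
        rw [decide_eq_false y.2] at this
        exact this
      exact ⟨funext fun y => (hA y).1, funext fun y => (hA y).2, funext fun y => (hA' y).1,
        funext fun y => (hA' y).2⟩
  simp only [h1, Matrix.cons_val, Finset.prod_mul_distrib, amplitude, truncate_tensorsOf, star_prod]

theorem continuous_column_two (x : V) (k l : LegIndex inc w D x) : Continuous fun u =>
    column inc w D R x k u * star (column inc w D R x l u) :=
  (continuous_column inc w D R x k).mul (continuous_column inc w D R x l).star

theorem continuous_column_four (x : V) (k l k' l' : LegIndex inc w D x) : Continuous fun u =>
    column inc w D R x k u * star (column inc w D R x l u) * column inc w D R x k' u *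
      star (column inc w D R x l' u) :=
  ((continuous_column_two inc w D R x k l).mul (continuous_column inc w D R x k')).mul
    (continuous_column inc w D R x l').star

theorem integrable_ofReal_iff {Ω : Type*} [MeasurableSpace Ω] {μ : Measure Ω} {f : Ω → ℝ}
    (h : Integrable (fun ω => (f ω : ℂ)) μ) : Integrable f μ := by
  simpa using h.re

open Classical in
theorem integrable_normSqM (A : Set out) : Integrable (fun U => normSqM (boundaryMatrix inc w D out A
    (truncate inc w D out R (tensorsOf inc w D out U)))) (randomLaw inc w D out) := by
  refine integrable_ofReal_iff ?_
  simp only [normSqM_truncate]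
  refine integrable_finsetSum _ fun a _ => ?_
  split_ifs
  · exact integrable_prod_randomLaw inc w D out (fun x u => column inc w D R x.1 _ u *
      star (column inc w D R x.1 _ u)) fun x => continuous_column_two inc w D R x.1 _ _
  · exact integrable_zero _ _ _

open Classical in
theorem integrable_purityM (A : Set out) : Integrable (fun U => purityM (boundaryMatrix inc w D out A
    (truncate inc w D out R (tensorsOf inc w D out U)))) (randomLaw inc w D out) := by
  refine integrable_ofReal_iff ?_
  simp only [purityM_truncate]
  refine integrable_finsetSum _ fun a _ => ?_
  split_ifs
  · exact integrable_prod_randomLaw inc w D out (fun x u => column inc w D R x.1 _ u *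
      star (column inc w D R x.1 _ u) * column inc w D R x.1 _ u *
      star (column inc w D R x.1 _ u)) fun x => continuous_column_four inc w D R x.1 _ _ _ _
  · exact integrable_zero _ _ _

open Classical in
theorem integral_normSqM (hout : Disjoint R out) (hinc : ∀ e, ∃ x, inc x e) (A : Set out) :
    ∫ U, normSqM (boundaryMatrix inc w D out A
      (truncate inc w D out R (tensorsOf inc w D out U))) ∂randomLaw inc w D out =
      meanNorm inc w D out R := by
  apply Complex.ofReal_injective
  rw [← integral_complex_ofReal]
  simp only [normSqM_truncate]
  rw [integral_finsetSum]
  swap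
  · intro a _
    split_ifs
    · exact integrable_prod_randomLaw inc w D out (fun x u => column inc w D R x.1 _ u *
        star (column inc w D R x.1 _ u)) fun x => continuous_column_two inc w D R x.1 _ _
    · exact integrable_zero _ _ _
  have h1 : ∀ a : Fin 2 → Lab w D, (∫ U,
      (if ∀ b : out, legsAt inc w D b.1 (a 0) = legsAt inc w D b.1 (a 1) then
          ∏ x : {x : V // x ∉ out}, column inc w D R x.1 (legsAt inc w D x.1 (a 0)) (U x) *
            star (column inc w D R x.1 (legsAt inc w D x.1 (a 1)) (U x)) else 0)
        ∂randomLaw inc w D out) =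
      ((∏ x, siteTwo inc w D out R x (fun i => legsAt inc w D x (a i)) : ℝ) : ℂ) := by
    intro a
    rw [← Fintype.prod_subtype_mul_prod_subtype (· ∈ out)]
    have h2 : ∏ b : {x // x ∈ out}, siteTwo inc w D out R b.1 (fun i => legsAt inc w D b.1 (a i)) =
        if ∀ b : out, legsAt inc w D b.1 (a 0) = legsAt inc w D b.1 (a 1) then (1 : ℝ) else 0 := by
      rw [← Fintype.prod_boole]
      refine Finset.prod_congr rfl fun b _ => ?_
      have hb : b.1 ∉ R := fun h => Set.disjoint_left.1 hout h b.2
      rw [siteTwo, siteWeight, if_pos (Or.inl b.2), one_mul, choicesTwo, Finset.sum_singleton,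
        decide_eq_false hb]
      rfl
    rw [h2]
    split_ifs
    · rw [integral_prod_randomLaw inc w D out fun x u =>
        column inc w D R x.1 (legsAt inc w D x.1 (a 0)) u *
          star (column inc w D R x.1 (legsAt inc w D x.1 (a 1)) u), one_mul]
      push_cast
      exact Finset.prod_congr rfl fun x _ => integral_column_two inc w D out R x.1 x.2
        fun i => legsAt inc w D x.1 (a i)
    · simp
  rw [Finset.sum_congr rfl fun a _ => h1 a, ← Complex.ofReal_sum]
  congr 1
  unfold siteTwo
  rw [sum_prod_eq_sum_prod_card inc w D _ _ (fun x => PairTwo (zeroLabel inc w D x))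
    (fun e => PairTwo fun _ => (0 : Fin D)) fun x o k => pairTwo_iff inc w D x o k, meanNorm]
  congr 1
  unfold choicesTwo
  rw [Fintype.piFinset_singleton, Finset.sum_singleton]
  refine Finset.prod_congr rfl fun e _ => ?_
  rw [card_pairTwo inc w D e (hinc e) (fun x => decide (x ∈ R)) fun x => decide_eq_true_iff]

-- This is the partition function of a model with one pairing per random vertex, the outer vertices
-- being fixed by `A` and those of `R` frozen.
open Classical in
theorem integral_purityM (A : Set out) :
    ∫ U, purityM (boundaryMatrix inc w D out A
      (truncate inc w D out R (tensorsOf inc w D out U))) ∂randomLaw inc w D out =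
      (∏ x, siteWeight' inc w D out R x) * ∑ σ ∈ Fintype.piFinset (choicesFour out R A), ∏ e,
        (Fintype.card {l : Fin 4 → Fin (w e) → Fin D //
          ∀ x, inc x e → PairFour (fun _ => (0 : Fin D)) (σ x) l} : ℝ) := by
  apply Complex.ofReal_injective
  rw [← integral_complex_ofReal]
  simp only [purityM_truncate]
  rw [integral_finsetSum]
  swap
  · intro a _
    split_ifs
    · exact integrable_prod_randomLaw inc w D out (fun x u => column inc w D R x.1 _ u *
        star (column inc w D R x.1 _ u) * column inc w D R x.1 _ u *
        star (column inc w D R x.1 _ u)) fun x => continuous_column_four inc w D R x.1 _ _ _ _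
    · exact integrable_zero _ _ _
  have h1 : ∀ a : Fin 4 → Lab w D, (∫ U,
      (if ∀ b : out, PairFour (zeroLabel inc w D b.1) (some (decide (b ∈ A)))
            (fun i => legsAt inc w D b.1 (a i)) then
          ∏ x : {x : V // x ∉ out}, column inc w D R x.1 (legsAt inc w D x.1 (a 0)) (U x) *
            star (column inc w D R x.1 (legsAt inc w D x.1 (a 1)) (U x)) *
            column inc w D R x.1 (legsAt inc w D x.1 (a 2)) (U x) *
            star (column inc w D R x.1 (legsAt inc w D x.1 (a 3)) (U x)) else 0)
        ∂randomLaw inc w D out) =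
      ((∏ x, siteFour inc w D out R A x (fun i => legsAt inc w D x (a i)) : ℝ) : ℂ) := by
    intro a
    rw [← Fintype.prod_subtype_mul_prod_subtype (· ∈ out)]
    have h2 : ∏ b : {x // x ∈ out},
        siteFour inc w D out R A b.1 (fun i => legsAt inc w D b.1 (a i)) =
        if ∀ b : out, PairFour (zeroLabel inc w D b.1) (some (decide (b ∈ A)))
            (fun i => legsAt inc w D b.1 (a i)) then (1 : ℝ) else 0 := by
      rw [← Fintype.prod_boole]
      refine Finset.prod_congr rfl fun b _ => ?_
      rw [siteFour, siteWeight', if_pos (Or.inl b.2), one_mul, choicesFour, dif_pos b.2,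
        Finset.sum_singleton]
    rw [h2]
    split_ifs
    · rw [integral_prod_randomLaw inc w D out fun x u =>
        column inc w D R x.1 (legsAt inc w D x.1 (a 0)) u *
          star (column inc w D R x.1 (legsAt inc w D x.1 (a 1)) u) *
          column inc w D R x.1 (legsAt inc w D x.1 (a 2)) u *
          star (column inc w D R x.1 (legsAt inc w D x.1 (a 3)) u), one_mul]
      push_cast
      exact Finset.prod_congr rfl fun x _ => integral_column_four inc w D out R A x.1 x.2
        fun i => legsAt inc w D x.1 (a i)
    · simp
  rw [Finset.sum_congr rfl fun a _ => h1 a, ← Complex.ofReal_sum]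
  congr 1
  unfold siteFour
  exact sum_prod_eq_sum_prod_card inc w D _ _ (fun x => PairFour (zeroLabel inc w D x))
    (fun e => PairFour fun _ => (0 : Fin D)) fun x o k => pairFour_iff inc w D x o k

open Classical in
theorem eq_none_iff_of_mem_choicesFour (hout : Disjoint R out) {A : Set out} {σ : V → Option Bool}
    (hσ : σ ∈ Fintype.piFinset (choicesFour out R A)) (x : V) : σ x = none ↔ x ∈ R := by
  have h := Fintype.mem_piFinset.1 hσ x
  unfold choicesFour at h
  split_ifs at h with h1 h2
  · rw [Finset.mem_singleton] at h
    rw [h]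
    simpa using fun hR => Set.disjoint_left.1 hout hR h1
  · simpa [h2] using h
  · simp only [Finset.mem_insert, Finset.mem_singleton] at h
    rcases h with h | h <;> simp [h, h2]

-- The boundary condition says precisely that the vertices with the second pairing form a cut for
-- `A`.
open Classical in
theorem isCut_of_mem_choicesFour {A : Set out} {σ : V → Option Bool}
    (hσ : σ ∈ Fintype.piFinset (choicesFour out R A)) : IsCut out A {x | σ x = some true} := by
  intro b
  have h := Fintype.mem_piFinset.1 hσ b.1
  unfold choicesFour at h
  rw [dif_pos b.2, Finset.mem_singleton] at h
  rw [Set.mem_ofPred_eq, h]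
  simp

open Classical in
theorem pow_cutLegs (X : Set V) : (D : ℝ) ^ cutLegs inc w X =
    ∏ e, ((if crosses inc X e then D ^ w e else 1 : ℕ) : ℝ) := by
  rw [cutLegs, ← Finset.prod_pow_eq_pow_sum]
  refine Finset.prod_congr rfl fun e _ => ?_
  by_cases hc : crosses inc X e
  · rw [if_pos hc, Nat.cast_pow]
    congr 1
    exact if_pos hc
  · rw [if_neg hc, Nat.cast_one, ← pow_zero (D : ℝ)]
    congr 1
    exact if_neg hc

open Classical in
/-- The mean purity is at most a sum over cuts. -/
theorem integral_purityM_le (hR : IsClosedPart inc w R) (hout : Disjoint R out)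
    (hinc : ∀ e, ∃ x, inc x e) (A : Set out) :
    ∫ U, purityM (boundaryMatrix inc w D out A
      (truncate inc w D out R (tensorsOf inc w D out U))) ∂randomLaw inc w D out ≤
      meanNorm inc w D out R ^ 2 * ∑ σ ∈ Fintype.piFinset (choicesFour out R A),
        ((D : ℝ) ^ cutLegs inc w {x | σ x = some true})⁻¹ := by
  rw [integral_purityM, meanNorm, mul_pow, mul_assoc, ← Finset.prod_pow,
    Finset.mul_sum _ _ ((∏ e, (edgeDim inc w D R e : ℝ)) ^ 2)]
  have hD : (0 : ℝ) < D := by exact_mod_cast NeZero.pos D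
  -- The weights of the vertices are compared by `siteWeight'_le`, those of the edges by
  -- `card_pairFour_le`.
  refine mul_le_mul ?_ ?_ ?_ ?_
  · exact Finset.prod_le_prod (fun x _ => siteWeight'_nonneg inc w D out R x)
      fun x _ => siteWeight'_le inc w D out R x
  · refine Finset.sum_le_sum fun σ hσ => ?_
    rw [le_mul_inv_iff₀ (by positivity), pow_cutLegs,
      ← Finset.prod_mul_distrib, ← Finset.prod_pow]
    refine Finset.prod_le_prod (fun e _ => by positivity) fun e _ => ?_
    have := card_pairFour_le inc w D hR e (hinc e) σ
      (eq_none_iff_of_mem_choicesFour out R hout hσ)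
    exact_mod_cast this
  · positivity
  · positivity

end Moments

end

section

open MeasureTheory

/-! ### The Ryu-Takayanagi formula -/

section RyuTakayanagi

theorem sum_inv_pow_le {S : Type*} (s : Finset S) (c : S → ℕ) {D : ℝ} (hD : 1 ≤ D) {γ : ℕ}
    (hγ : ∀ σ ∈ s, γ ≤ c σ) : ∑ σ ∈ s, (D ^ c σ)⁻¹ ≤ s.card * (D ^ γ)⁻¹ := by
  rw [← nsmul_eq_mul]
  refine Finset.sum_le_card_nsmul _ _ _ fun σ hσ => ?_
  exact inv_anti₀ (by positivity) (pow_le_pow_right₀ hD (hγ σ hσ))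

/-- At most one term has the minimal exponent, and each of the others is smaller by a factor `D` at
least. -/
theorem sum_inv_pow_le_of_unique {S : Type*} (s : Finset S) (c : S → ℕ) {D : ℝ} (hD : 1 ≤ D)
    {γ : ℕ} (hγ : ∀ σ ∈ s, γ ≤ c σ)
    (hu : ∀ σ ∈ s, ∀ τ ∈ s, c σ = γ → c τ = γ → σ = τ) :
    ∑ σ ∈ s, (D ^ c σ)⁻¹ ≤ (D ^ γ)⁻¹ * (1 + s.card / D) := by
  classical
  have hD0 : 0 < D := by linarith
  rw [← Finset.sum_filter_add_sum_filter_not s fun σ => c σ = γ, mul_add, mul_one]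
  refine add_le_add ?_ ?_
  · have h1 : (s.filter fun σ => c σ = γ).card ≤ 1 := Finset.card_le_one.2 fun σ hσ τ hτ =>
      hu σ (Finset.mem_filter.1 hσ).1 τ (Finset.mem_filter.1 hτ).1 (Finset.mem_filter.1 hσ).2
        (Finset.mem_filter.1 hτ).2
    refine (Finset.sum_le_card_nsmul _ _ ((D ^ γ)⁻¹) fun σ hσ => ?_).trans ?_
    · rw [(Finset.mem_filter.1 hσ).2]
    · rw [nsmul_eq_mul]
      have h2 : ((s.filter fun σ => c σ = γ).card : ℝ) ≤ 1 := by exact_mod_cast h1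
      exact mul_le_of_le_one_left (by positivity) h2
  · refine (sum_inv_pow_le (s.filter fun σ => ¬ c σ = γ) c hD (γ := γ + 1) fun σ hσ => ?_).trans ?_
    · exact Nat.succ_le_of_lt (lt_of_le_of_ne (hγ σ (Finset.mem_filter.1 hσ).1)
        (Ne.symm (Finset.mem_filter.1 hσ).2))
    · have h2 : ((s.filter fun σ => ¬ c σ = γ).card : ℝ) ≤ s.card := by
        exact_mod_cast Finset.card_filter_le _ _
      have h3 : (D ^ γ)⁻¹ * (s.card / D) = s.card * (D ^ (γ + 1))⁻¹ := by
        rw [pow_succ, mul_inv]; ring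
      rw [h3]
      exact mul_le_mul_of_nonneg_right h2 (by positivity)

/-- Markov's inequality. -/
theorem measure_ge_le_ofReal {Ω : Type*} [MeasurableSpace Ω] {μ : Measure Ω}
    [IsProbabilityMeasure μ] {f : Ω → ℝ} (hf : Integrable f μ) (h0 : ∀ ω, 0 ≤ f ω) {ε p : ℝ}
    (hε : 0 < ε) (h : ∫ ω, f ω ∂μ ≤ ε * p) : μ {ω | ε ≤ f ω} ≤ ENNReal.ofReal p := by
  have h1 := mul_meas_ge_le_integral_of_nonneg (.of_forall h0) hf ε
  have h2 : μ.real {ω | ε ≤ f ω} ≤ p := le_of_mul_le_mul_left (h1.trans h) hε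
  rw [← ofReal_measureReal]
  exact ENNReal.ofReal_le_ofReal h2

variable {V E : Type} (inc : V → E → Prop) (w : E → ℕ) (out : Set V) [Fintype V] [Fintype E]

/-- The part of the network that can be cut off without crossing any leg. -/
def isolatedPart : Set V := ⋃₀ {X | IsCut out ∅ X ∧ cutLegs inc w X = 0}

theorem subset_isolatedPart {X : Set V} (h : IsCut out ∅ X) (h0 : cutLegs inc w X = 0) :
    X ⊆ isolatedPart inc w out := Set.subset_sUnion_of_mem ⟨h, h0⟩

theorem isClosedPart_of_cutLegs_eq_zero {X : Set V} (h : cutLegs inc w X = 0) :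
    IsClosedPart inc w X := by
  intro e he
  have := Finset.sum_eq_zero_iff.1 h e (Finset.mem_univ e)
  rwa [if_pos (show (∃ x ∈ X, inc x e) ∧ ∃ y ∉ X, inc y e from he)] at this

/-- An edge that crosses a union crosses one of its members. -/
theorem isClosedPart_isolatedPart : IsClosedPart inc w (isolatedPart inc w out) := by
  rintro e ⟨⟨x, ⟨X, hX, hx⟩, hxe⟩, y, hy, hye⟩
  exact isClosedPart_of_cutLegs_eq_zero inc w hX.2 e
    ⟨⟨x, hx, hxe⟩, y, fun h => hy ⟨X, hX, h⟩, hye⟩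

theorem disjoint_isolatedPart : Disjoint (isolatedPart inc w out) out := by
  rw [Set.disjoint_left]
  rintro x ⟨X, hX, hx⟩ hout
  exact (hX.1 ⟨x, hout⟩).1 hx

theorem eq_of_cut_eq {R : Set V} (hout : Disjoint R out) {A : Set out} {σ τ : V → Option Bool}
    (hσ : open Classical in σ ∈ Fintype.piFinset (choicesFour out R A))
    (hτ : open Classical in τ ∈ Fintype.piFinset (choicesFour out R A))
    (h : {x | σ x = some true} = {x | τ x = some true}) : σ = τ := by
  funext x
  have h1 := eq_none_iff_of_mem_choicesFour out R hout hσ x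
  have h2 := eq_none_iff_of_mem_choicesFour out R hout hτ x
  have h3 : σ x = some true ↔ τ x = some true := Set.ext_iff.1 h x
  rcases hs : σ x with _ | _ | _ <;> rcases ht : τ x with _ | _ | _ <;> simp_all

variable (D : ℕ) [NeZero D] (A : Set out)

/-- The number of configurations of a vertex model on the network. -/
def configCount (V : Type) [Fintype V] : ℕ := open Classical in Fintype.card (V → Option Bool)

theorem configCount_pos (V : Type) [Fintype V] : 0 < configCount V := by
  classical
  exact Fintype.card_pos

open Classical in
/-- The norm of the truncated random state. -/
def randNorm (U : Unitaries inc w D out) : ℝ :=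
  normSqM (boundaryMatrix inc w D out A
    (truncate inc w D out (isolatedPart inc w out) (tensorsOf inc w D out U)))

open Classical in
/-- The purity of the truncated random state. -/
def randPurity (U : Unitaries inc w D out) : ℝ :=
  purityM (boundaryMatrix inc w D out A
    (truncate inc w D out (isolatedPart inc w out) (tensorsOf inc w D out U)))

-- For the empty region the matrix has a single row, and its purity is the squared norm. The second
-- moment of the norm is therefore a mean purity.
open Classical in
theorem purityM_boundaryMatrix_empty (T : Tensors inc w D out) {B : Set out} (hB : B = ∅) :
    purityM (boundaryMatrix inc w D out B T) = normSqM (boundaryMatrix inc w D out A T) ^ 2 := by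
  rw [← sum_normSq_boundaryState inc w D out A T, sum_normSq_boundaryState inc w D out B T]
  have : IsEmpty {b : out // b ∈ B} := ⟨fun b => by simpa [hB] using b.2⟩
  have htr := trace_mul_conjTranspose' (boundaryMatrix inc w D out B T)
  rw [Matrix.trace, Fintype.sum_unique] at htr
  rw [purityM, Fintype.sum_unique, Fintype.sum_unique]
  rw [Matrix.diag_apply] at htr
  rw [htr, Complex.norm_real, Real.norm_of_nonneg (normSqM_nonneg _)]

theorem randNorm_sq (U : Unitaries inc w D out) :
    randNorm inc w out D A U ^ 2 = randPurity inc w out D ∅ U :=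
  (purityM_boundaryMatrix_empty inc w out D A _ rfl).symm

variable {inc w out} in
theorem integral_randPurity_le (hinc : ∀ e, ∃ x, inc x e) :
    ∫ U, randPurity inc w out D A U ∂randomLaw inc w D out ≤
      meanNorm inc w D out (isolatedPart inc w out) ^ 2 *
        (configCount V * ((D : ℝ) ^ minCutLegs inc w out A)⁻¹) := by
  classical
  refine (integral_purityM_le inc w D out _ (isClosedPart_isolatedPart inc w out)
    (disjoint_isolatedPart inc w out) hinc A).trans ?_
  refine mul_le_mul_of_nonneg_left ?_ (sq_nonneg _)
  refine (sum_inv_pow_le _ _ (by exact_mod_cast NeZero.one_le) fun σ hσ =>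
    minCutLegs_le inc w out A (isCut_of_mem_choicesFour out _ hσ)).trans ?_
  refine mul_le_mul_of_nonneg_right ?_ (by positivity)
  unfold configCount
  exact_mod_cast Finset.card_le_univ _

-- Only cuts disjoint from the isolated part occur in the sum, so uniqueness is needed among these
-- only. This weaker hypothesis can be met by the empty region.
variable {inc w out} in
theorem integral_randPurity_le_of_unique (hinc : ∀ e, ∃ x, inc x e)
    (hu : ∀ X Y, IsCut out A X → IsCut out A Y → Disjoint (isolatedPart inc w out) X →
      Disjoint (isolatedPart inc w out) Y →
      cutLegs inc w X = minCutLegs inc w out A → cutLegs inc w Y = minCutLegs inc w out A →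
      X = Y) :
    ∫ U, randPurity inc w out D A U ∂randomLaw inc w D out ≤
      meanNorm inc w D out (isolatedPart inc w out) ^ 2 *
        (((D : ℝ) ^ minCutLegs inc w out A)⁻¹ * (1 + configCount V / D)) := by
  classical
  have hdis := disjoint_isolatedPart inc w out
  refine (integral_purityM_le inc w D out _ (isClosedPart_isolatedPart inc w out) hdis
    hinc A).trans ?_
  refine mul_le_mul_of_nonneg_left ?_ (sq_nonneg _)
  have hR : ∀ σ ∈ Fintype.piFinset (choicesFour out (isolatedPart inc w out) A),
      Disjoint (isolatedPart inc w out) {x | σ x = some true} := by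
    intro σ hσ
    rw [Set.disjoint_left]
    intro x hx hx'
    rw [Set.mem_ofPred_eq, (eq_none_iff_of_mem_choicesFour out _ hdis hσ x).2 hx] at hx'
    simp at hx'
  refine (sum_inv_pow_le_of_unique _ _ (by exact_mod_cast NeZero.one_le) (fun σ hσ =>
    minCutLegs_le inc w out A (isCut_of_mem_choicesFour out _ hσ)) fun σ hσ τ hτ h1 h2 =>
    eq_of_cut_eq out hdis hσ hτ (hu _ _ (isCut_of_mem_choicesFour out _ hσ)
      (isCut_of_mem_choicesFour out _ hτ) (hR σ hσ) (hR τ hτ) h1 h2)).trans ?_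
  have : ((Fintype.piFinset (choicesFour out (isolatedPart inc w out) A)).card : ℝ) ≤
      configCount V := by
    unfold configCount
    exact_mod_cast Finset.card_le_univ _
  gcongr

theorem minCutLegs_empty : minCutLegs inc w out ∅ = 0 := by
  have h : IsCut out ∅ (∅ : Set V) := fun b => by simp
  refine Nat.le_zero.1 ((minCutLegs_le inc w out ∅ h).trans ?_)
  simp [cutLegs]

-- A cut for the empty region that crosses no leg lies in the isolated part. If it is disjoint from
-- that part it is empty, so the minimal cut is unique in the sense required.
variable {inc w out} in
theorem integral_randNorm_sq_le (hinc : ∀ e, ∃ x, inc x e) :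
    ∫ U, randNorm inc w out D A U ^ 2 ∂randomLaw inc w D out ≤
      meanNorm inc w D out (isolatedPart inc w out) ^ 2 * (1 + configCount V / D) := by
  simp only [randNorm_sq]
  refine (integral_randPurity_le_of_unique D ∅ hinc ?_).trans ?_
  · rw [minCutLegs_empty]
    have key : ∀ X, IsCut out ∅ X → Disjoint (isolatedPart inc w out) X → cutLegs inc w X = 0 →
        X = ∅ := fun X h1 h2 h3 =>
      (disjoint_self.1 (h2.mono_left (subset_isolatedPart inc w out h1 h3)) : X = ⊥)
    intro X Y h1 h2 h3 h4 h5 h6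
    rw [key X h1 h3 h5, key Y h2 h4 h6]
  · rw [minCutLegs_empty, pow_zero, inv_one, one_mul]

theorem integrable_randNorm : Integrable (randNorm inc w out D A) (randomLaw inc w D out) :=
  integrable_normSqM inc w D out _ A

theorem integrable_randPurity : Integrable (randPurity inc w out D A) (randomLaw inc w D out) :=
  integrable_purityM inc w D out _ A

theorem integrable_randNorm_sq :
    Integrable (fun U => randNorm inc w out D A U ^ 2) (randomLaw inc w D out) := by
  simp only [randNorm_sq]
  exact integrable_randPurity inc w out D ∅

variable {inc w out} in
theorem integral_randNorm (hinc : ∀ e, ∃ x, inc x e) :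
    ∫ U, randNorm inc w out D A U ∂randomLaw inc w D out =
      meanNorm inc w D out (isolatedPart inc w out) :=
  integral_normSqM inc w D out _ (disjoint_isolatedPart inc w out) hinc A

theorem sub_meanNorm_sq_eq (U : Unitaries inc w D out) (n : ℝ) :
    (randNorm inc w out D A U - n) ^ 2 =
      randNorm inc w out D A U ^ 2 - 2 * n * randNorm inc w out D A U + n ^ 2 := by ring

theorem integrable_sub_meanNorm_sq (n : ℝ) :
    Integrable (fun U => (randNorm inc w out D A U - n) ^ 2) (randomLaw inc w D out) := by
  simp only [sub_meanNorm_sq_eq]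
  exact ((integrable_randNorm_sq inc w out D A).sub
    ((integrable_randNorm inc w out D A).const_mul _)).add (integrable_const _)

variable {inc w out} in
theorem integral_variance_eq (hinc : ∀ e, ∃ x, inc x e) :
    ∫ U, (randNorm inc w out D A U - meanNorm inc w D out (isolatedPart inc w out)) ^ 2
      ∂randomLaw inc w D out = ∫ U, randNorm inc w out D A U ^ 2 ∂randomLaw inc w D out -
      meanNorm inc w D out (isolatedPart inc w out) ^ 2 := by
  set n := meanNorm inc w D out (isolatedPart inc w out) with hn
  simp only [sub_meanNorm_sq_eq]
  rw [integral_add, integral_sub, integral_const_mul, integral_randNorm D A hinc, ← hn]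
  · simp only [integral_const, probReal_univ, one_smul]
    ring
  · exact integrable_randNorm_sq inc w out D A
  · exact (integrable_randNorm inc w out D A).const_mul _
  · exact (integrable_randNorm_sq inc w out D A).sub
      ((integrable_randNorm inc w out D A).const_mul _)
  · exact integrable_const _

variable {inc w out} in
/-- The norm is concentrated. -/
theorem measure_norm_deviation_le (hinc : ∀ e, ∃ x, inc x e) : randomLaw inc w D out
    {U | meanNorm inc w D out (isolatedPart inc w out) ^ 2 / 4 ≤
      (randNorm inc w out D A U - meanNorm inc w D out (isolatedPart inc w out)) ^ 2} ≤
      ENNReal.ofReal (4 * configCount V / D) := by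
  have hn := meanNorm_pos inc w D out (isolatedPart inc w out)
  -- Chebyshev's inequality at half the mean; the variance is at most the squared mean times
  -- `configCount V / D`.
  refine measure_ge_le_ofReal (integrable_sub_meanNorm_sq inc w out D A _)
    (fun U => sq_nonneg _) (by positivity) ?_
  have := integral_randNorm_sq_le (w := w) D A hinc
  rw [integral_variance_eq D A hinc]
  have h2 : meanNorm inc w D out (isolatedPart inc w out) ^ 2 / 4 * (4 * configCount V / D) =
      meanNorm inc w D out (isolatedPart inc w out) ^ 2 * (configCount V / D) := by ring
  rw [h2]
  linarith

variable {inc w out} in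
/-- Almost surely the entropy is that of the truncated state, to which the bounds apply. -/
theorem ae_entropy_bounds : ∀ᵐ U ∂randomLaw inc w D out, randNorm inc w out D A U ≠ 0 →
    entropy inc w D out A (tensorsOf inc w D out U) ≤ minCutLegs inc w out A * Real.log D ∧
    -Real.log (randPurity inc w out D A U / randNorm inc w out D A U ^ 2) ≤
      entropy inc w D out A (tensorsOf inc w D out U) ∧
    randNorm inc w out D A U ^ 2 ≤
      (D : ℝ) ^ minCutLegs inc w out A * randPurity inc w out D A U := by
  filter_upwards [ae_entropy_truncate (inc := inc) (w := w) (D := D)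
    (isolatedPart inc w out) (isClosedPart_isolatedPart inc w out)
    (disjoint_isolatedPart inc w out) A] with U hU h0
  rw [hU]
  exact (entropy_mem_bounds inc w D out A _ h0).2

-- A deterministic bound, which disposes of small `D`; for the zero state the entropy is zero by
-- convention.
variable {inc w out} in
theorem abs_entropy_sub_le (T : Tensors inc w D out) :
    |entropy inc w D out A T - minCutLegs inc w out A * Real.log D| ≤
      minCutLegs inc w out A * Real.log D := by
  classical
  have h1 : 0 ≤ minCutLegs inc w out A * Real.log D :=
    mul_nonneg (Nat.cast_nonneg _) (Real.log_natCast_nonneg _)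
  by_cases hZ : normSqM (boundaryMatrix inc w D out A T) = 0
  · rw [entropy_eq_zero inc w D out A T hZ, zero_sub, abs_neg, abs_of_nonneg h1]
  · have := entropy_mem_bounds inc w D out A T hZ
    rw [abs_le]
    constructor <;> linarith [this.1, this.2.1]

theorem randPurity_nonneg (U : Unitaries inc w D out) : 0 ≤ randPurity inc w out D A U := by
  classical
  exact purityM_nonneg _

/-- A normalized purity is at least the reciprocal of the rank. Holding for every `U`, this makes
the difference of the two sides accessible to Markov's inequality. -/
theorem randNorm_sq_le (U : Unitaries inc w D out) : randNorm inc w out D A U ^ 2 ≤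
    (D : ℝ) ^ minCutLegs inc w out A * randPurity inc w out D A U := by
  classical
  by_cases h0 : randNorm inc w out D A U = 0
  · rw [h0, zero_pow two_ne_zero]
    exact mul_nonneg (by positivity) (randPurity_nonneg inc w out D A U)
  · exact (entropy_mem_bounds inc w D out A _ h0).2.2.2

theorem half_lt_of_sq_lt {n z : ℝ} (hn : 0 < n) (h : (z - n) ^ 2 < n ^ 2 / 4) : n / 2 < z := by
  by_contra hc
  nlinarith [not_lt.1 hc]

variable {inc w out} in
/-- The entropy differs from its upper bound by a bounded amount with high probability. -/
theorem exists_entropy_deviation_le (hinc : ∀ e, ∃ x, inc x e) {η : ℝ} (hη : 0 < η) :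
    ∃ C : ℝ, ∀ (D : ℕ) [NeZero D], randomLaw inc w D out
      {U | C < |entropy inc w D out A (tensorsOf inc w D out U) -
        minCutLegs inc w out A * Real.log D|} ≤ ENNReal.ofReal η := by
  set K : ℝ := ((configCount V : ℕ) : ℝ) with hK
  set γ := minCutLegs inc w out A with hγ
  have hKpos : 0 < K := by
    rw [hK]; exact_mod_cast configCount_pos V
  -- The first term covers `D` up to the ceiling of `8 * K / η` by the deterministic bound, the
  -- second all larger `D` by the purity estimate.
  refine ⟨max (γ * Real.log ⌈8 * K / η⌉₊) (Real.log (8 * K / η)), fun D _ => ?_⟩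
  have hD : (0 : ℝ) < D := by exact_mod_cast NeZero.pos D
  rcases le_or_gt D ⌈8 * K / η⌉₊ with hsmall | hlarge
  · have : {U : Unitaries inc w D out | max (γ * Real.log ⌈8 * K / η⌉₊) (Real.log (8 * K / η)) <
        |entropy inc w D out A (tensorsOf inc w D out U) - γ * Real.log D|} = ∅ := by
      ext U
      simp only [Set.mem_ofPred_eq, Set.mem_empty_iff_false, iff_false, not_lt]
      refine (abs_entropy_sub_le D A _).trans (le_max_of_le_left ?_)
      refine mul_le_mul_of_nonneg_left ?_ (Nat.cast_nonneg _)
      exact Real.log_le_log hD (by exact_mod_cast hsmall)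
    rw [this, measure_empty]
    exact bot_le
  have hDK : 8 * K / η ≤ D := (Nat.le_ceil _).trans (by exact_mod_cast hlarge.le)
  set n := meanNorm inc w D out (isolatedPart inc w out) with hn
  have hnpos : 0 < n := meanNorm_pos inc w D out _
  have hDγ : (0 : ℝ) < (D : ℝ) ^ γ := by positivity
  -- The bound on the mean purity times `2 / η`, so that Markov's inequality fails with probability
  -- at most `η / 2`.
  set ε : ℝ := 2 / η * (n ^ 2 * (K * ((D : ℝ) ^ γ)⁻¹)) with hε
  have hB1 := measure_norm_deviation_le (inc := inc) (w := w) (out := out) D A hinc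
  have hB2 : randomLaw inc w D out {U | ε ≤ randPurity inc w out D A U} ≤
      ENNReal.ofReal (η / 2) := by
    refine measure_ge_le_ofReal (integrable_randPurity inc w out D A)
      (randPurity_nonneg inc w out D A) (by positivity) ?_
    refine (integral_randPurity_le D A hinc).trans (le_of_eq ?_)
    rw [hε, ← hn, ← hK, ← hγ]; field_simp
  have hp : 4 * K / D ≤ η / 2 := by
    rw [div_le_iff₀ hη] at hDK
    rw [div_le_iff₀ hD]
    linarith
  refine (measure_mono_ae (t := {U | n ^ 2 / 4 ≤ (randNorm inc w out D A U - n) ^ 2} ∪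
    {U | ε ≤ randPurity inc w out D A U}) ?_).trans ((measure_union_le _ _).trans ?_)
  · filter_upwards [ae_entropy_bounds (inc := inc) (w := w) D A] with U hU hbad
    by_contra hc
    have h1 := half_lt_of_sq_lt hnpos (not_le.1 fun h => hc (Or.inl h))
    have h2 : randPurity inc w out D A U < ε := not_le.1 fun h => hc (Or.inr h)
    have hz : 0 < randNorm inc w out D A U := by linarith
    obtain ⟨h3, h4, h5⟩ := hU hz.ne'
    have hF : 0 < randPurity inc w out D A U := by
      by_contra hF
      nlinarith [pow_pos hz 2, mul_nonneg hDγ.le (neg_nonneg.2 (not_lt.1 hF))]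
    -- Off the two bad events the norm exceeds `n / 2` and the purity is below `ε`; the quotient is
    -- at most `4 * ε / n ^ 2`.
    have h6 : randPurity inc w out D A U / randNorm inc w out D A U ^ 2 ≤
        8 * K / η / (D : ℝ) ^ γ := by
      rw [div_le_div_iff₀ (pow_pos hz 2) hDγ]
      have h7 : randPurity inc w out D A U * (D : ℝ) ^ γ ≤ ε * (D : ℝ) ^ γ :=
        mul_le_mul_of_nonneg_right h2.le hDγ.le
      have h8 : ε * (D : ℝ) ^ γ = 8 * K / η * (n / 2) ^ 2 := by
        rw [hε]; field_simp; ring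
      rw [h8] at h7
      refine h7.trans (mul_le_mul_of_nonneg_left ?_ (by positivity))
      exact pow_le_pow_left₀ (by positivity) h1.le 2
    have h9 := Real.log_le_log (div_pos hF (pow_pos hz 2)) h6
    rw [Real.log_div (by positivity) hDγ.ne', Real.log_pow] at h9
    have h10 : |entropy inc w D out A (tensorsOf inc w D out U) - γ * Real.log D| ≤
        Real.log (8 * K / η) := by
      rw [abs_of_nonpos (by linarith)]
      linarith
    have hb : max (γ * Real.log ⌈8 * K / η⌉₊) (Real.log (8 * K / η)) <
        |entropy inc w D out A (tensorsOf inc w D out U) - γ * Real.log D| := hbad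
    exact not_lt.2 (le_max_right _ _) (hb.trans_le h10)
  · calc _ ≤ ENNReal.ofReal (η / 2) + ENNReal.ofReal (η / 2) :=
          add_le_add (hB1.trans (ENNReal.ofReal_le_ofReal hp)) hB2
      _ = ENNReal.ofReal η := by
          rw [← ENNReal.ofReal_add (by positivity) (by positivity), add_halves]

variable {inc w out} in
/-- If the minimal cut is unique, the entropy converges to its upper bound in probability. -/
theorem exists_entropy_deviation_le_of_unique (hinc : ∀ e, ∃ x, inc x e)
    (hu : ∃! X, IsMinCut inc w out A X) {η : ℝ} (hη : 0 < η) :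
    ∃ D₀ : ℕ, ∀ (D : ℕ) [NeZero D], D₀ ≤ D → randomLaw inc w D out
      {U | η < |entropy inc w D out A (tensorsOf inc w D out U) -
        minCutLegs inc w out A * Real.log D|} ≤ ENNReal.ofReal η := by
  set K : ℝ := ((configCount V : ℕ) : ℝ) with hK
  set γ := minCutLegs inc w out A with hγ
  have hKpos : 0 < K := by
    rw [hK]; exact_mod_cast configCount_pos V
  -- From here on the two failure probabilities `4 * K / D` and `4 * K / (D * η)` add up to at most
  -- `η`.
  refine ⟨⌈(4 * K + 4 * K / η) / η⌉₊, fun D _ hlarge => ?_⟩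
  have hD : (0 : ℝ) < D := by exact_mod_cast NeZero.pos D
  have hDK : (4 * K + 4 * K / η) / η ≤ D := (Nat.le_ceil _).trans (by exact_mod_cast hlarge)
  set n := meanNorm inc w D out (isolatedPart inc w out) with hn
  have hnpos : 0 < n := meanNorm_pos inc w D out _
  have hDγ : (0 : ℝ) < (D : ℝ) ^ γ := by positivity
  have hB1 := measure_norm_deviation_le (inc := inc) (w := w) (out := out) D A hinc
  -- Markov's inequality for the non-negative excess. Its mean is at most `n ^ 2 * (K / D)`, because
  -- the second moment of the norm is at least `n ^ 2`.
  have hB2 : randomLaw inc w D out {U | η / 4 * n ^ 2 ≤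
      (D : ℝ) ^ γ * randPurity inc w out D A U - randNorm inc w out D A U ^ 2} ≤
      ENNReal.ofReal (4 * K / (D * η)) := by
    have hint : Integrable (fun U => (D : ℝ) ^ γ * randPurity inc w out D A U -
        randNorm inc w out D A U ^ 2) (randomLaw inc w D out) :=
      ((integrable_randPurity inc w out D A).const_mul _).sub
        (integrable_randNorm_sq inc w out D A)
    refine measure_ge_le_ofReal hint (fun U => sub_nonneg.2 (randNorm_sq_le inc w out D A U)) (by positivity) ?_
    rw [integral_sub ((integrable_randPurity inc w out D A).const_mul _)
      (integrable_randNorm_sq inc w out D A), integral_const_mul]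
    have h1 := integral_randPurity_le_of_unique D A hinc fun X Y hX hY _ _ h1 h2 =>
      hu.unique ⟨hX, fun Z hZ => h1.trans_le (minCutLegs_le inc w out A hZ)⟩
        ⟨hY, fun Z hZ => h2.trans_le (minCutLegs_le inc w out A hZ)⟩
    have h2 : (0 : ℝ) ≤ ∫ U, (randNorm inc w out D A U - n) ^ 2 ∂randomLaw inc w D out :=
      integral_nonneg fun U => sq_nonneg _
    rw [integral_variance_eq D A hinc] at h2
    have h3 := mul_le_mul_of_nonneg_left h1 hDγ.le
    have h4 : (D : ℝ) ^ γ * (n ^ 2 * (((D : ℝ) ^ γ)⁻¹ * (1 + K / D))) = n ^ 2 * (1 + K / D) := by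
      field_simp
    rw [h4] at h3
    have h5 : η / 4 * n ^ 2 * (4 * K / (D * η)) = n ^ 2 * (K / D) := by field_simp
    rw [h5]
    linarith
  have hp : 4 * K / D + 4 * K / (D * η) ≤ η := by
    rw [div_le_iff₀ hη] at hDK
    have : 4 * K / D + 4 * K / (D * η) = (4 * K + 4 * K / η) / D := by field_simp
    rw [this, div_le_iff₀ hD]
    linarith
  refine (measure_mono_ae (t := {U | n ^ 2 / 4 ≤ (randNorm inc w out D A U - n) ^ 2} ∪
    {U | η / 4 * n ^ 2 ≤ (D : ℝ) ^ γ * randPurity inc w out D A U -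
      randNorm inc w out D A U ^ 2}) ?_).trans ((measure_union_le _ _).trans ?_)
  · filter_upwards [ae_entropy_bounds (inc := inc) (w := w) D A] with U hU hbad
    by_contra hc
    have h1 := half_lt_of_sq_lt hnpos (not_le.1 fun h => hc (Or.inl h))
    have h2 : (D : ℝ) ^ γ * randPurity inc w out D A U - randNorm inc w out D A U ^ 2 <
        η / 4 * n ^ 2 := not_le.1 fun h => hc (Or.inr h)
    have hz : 0 < randNorm inc w out D A U := by linarith
    have hz2 := pow_pos hz 2
    obtain ⟨h3, h4, h5⟩ := hU hz.ne'
    have hF : 0 < randPurity inc w out D A U := by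
      by_contra hF
      nlinarith [mul_nonneg hDγ.le (neg_nonneg.2 (not_lt.1 hF))]
    -- The norm exceeds `n / 2`, so an excess below `η / 4 * n ^ 2` is below `η` times the squared
    -- norm. The entropy then misses its upper bound by at most the logarithm of `1 + η`.
    have h6 : randPurity inc w out D A U / randNorm inc w out D A U ^ 2 ≤
        (1 + η) / (D : ℝ) ^ γ := by
      rw [div_le_div_iff₀ hz2 hDγ]
      have : (n / 2) ^ 2 ≤ randNorm inc w out D A U ^ 2 := pow_le_pow_left₀ (by positivity) h1.le 2
      nlinarith
    have h9 := Real.log_le_log (div_pos hF (pow_pos hz 2)) h6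
    rw [Real.log_div (by positivity) hDγ.ne', Real.log_pow] at h9
    have h10 := Real.log_le_sub_one_of_pos (show (0 : ℝ) < 1 + η by positivity)
    have h11 : |entropy inc w D out A (tensorsOf inc w D out U) - γ * Real.log D| ≤ η := by
      rw [abs_of_nonpos (by linarith)]
      linarith
    have hb : η < |entropy inc w D out A (tensorsOf inc w D out U) - γ * Real.log D| := hbad
    exact not_lt.2 h11 hb
  · calc _ ≤ ENNReal.ofReal (4 * K / D) + ENNReal.ofReal (4 * K / (D * η)) := add_le_add hB1 hB2
      _ = ENNReal.ofReal (4 * K / D + 4 * K / (D * η)) :=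
          (ENNReal.ofReal_add (by positivity) (by positivity)).symm
      _ ≤ ENNReal.ofReal η := ENNReal.ofReal_le_ofReal hp

end RyuTakayanagi

end

end FlatNetwork

end

theorem mainTheorem6 (N : ℕ) (hN : 2 ≤ N) (P : FlatNetwork.BoundaryPoints N) :
    -- the number of segments on a chord
    (FlatNetwork.maxSegments P : ℝ) ≤ (((N : ℝ) - 2) / 2) ^ 2 + 1 ∧
    -- a minimal cut of the network for an interval is a minimal path in the chord graph
    (∀ δ : ℝ, 0 < δ → ∀ i j : Fin N, i ≠ j →
      FlatNetwork.netMinCut P δ (FlatNetwork.interval P i j) =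
        FlatNetwork.pathLegs P δ (P.pt i) (P.pt j)) ∧
    -- the error is at most `δ` for every segment of a minimal path
    (∀ δ : ℝ, 0 < δ → ∀ D : ℕ, 2 ≤ D → ∀ i j : Fin N, i ≠ j →
      ∀ u ∈ FlatNetwork.vertices P ∩ FlatNetwork.chord P i j,
      ∀ v ∈ FlatNetwork.vertices P ∩ FlatNetwork.chord P i j,
      ∀ p : (FlatNetwork.chordGraph P).Walk u v, FlatNetwork.IsMinWalk P δ p →
        |dist u v - δ / Real.log D * FlatNetwork.graphLength P δ D u v| ≤ p.length * δ) ∧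
    -- the choice of `δ` for a given resolution `ε`
    (∃ ε₀ : ℝ, 0 < ε₀ ∧ ∀ ε δ : ℝ, 0 < δ → δ ≤ min ε ε₀ / FlatNetwork.maxSegments P →
      ∀ i j : Fin N, i ≠ j →
        FlatNetwork.HasUniqueMinCut P δ (FlatNetwork.interval P i j) ∧
        ∀ u ∈ FlatNetwork.vertices P ∩ FlatNetwork.chord P i j,
        ∀ v ∈ FlatNetwork.vertices P ∩ FlatNetwork.chord P i j,
          (∀ p : (FlatNetwork.chordGraph P).Walk u v, FlatNetwork.IsMinWalk P δ p →
            p.length ≤ FlatNetwork.maxSegments P) ∧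
          ∀ D : ℕ, 2 ≤ D →
            |dist u v - δ / Real.log D * FlatNetwork.graphLength P δ D u v| ≤ ε) ∧
    -- the Ryu-Takayanagi formula for random tensors of large bond dimension
    (∀ δ : ℝ, 0 < δ → ∀ A : Set (FlatNetwork.outerCells P), ∀ η : ℝ, 0 < η →
      (∃ C : ℝ, ∀ (D : ℕ) [NeZero D], 2 ≤ D →
        FlatNetwork.netLaw P δ D {U | C < |FlatNetwork.netEntropy P δ D A U -
          FlatNetwork.netMinCut P δ A * Real.log D|} ≤ ENNReal.ofReal η) ∧
      (FlatNetwork.HasUniqueMinCut P δ A → ∃ D₀ : ℕ, ∀ (D : ℕ) [NeZero D], D₀ ≤ D →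
        FlatNetwork.netLaw P δ D {U | η < |FlatNetwork.netEntropy P δ D A U -
          FlatNetwork.netMinCut P δ A * Real.log D|} ≤ ENNReal.ofReal η)) := by
  refine ⟨FlatNetwork.maxSegments_le P hN, fun δ _ i j hij =>
    FlatNetwork.netMinCut_eq_pathLegs P δ hij, fun δ hδ D hD i j hij u hu v hv p hp =>
    FlatNetwork.abs_dist_sub_graphLength_le P hij hδ hD hu hv hp,
    FlatNetwork.fine_resolution P hN, fun δ _ A η hη => ⟨?_, fun hu => ?_⟩⟩
  · obtain ⟨C, hC⟩ := FlatNetwork.exists_entropy_deviation_le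
      (w := FlatNetwork.netLegs P δ) A (FlatNetwork.exists_incident P) hη
    exact ⟨C, fun D _ _ => hC D⟩
  · exact FlatNetwork.exists_entropy_deviation_le_of_unique A (FlatNetwork.exists_incident P) hu hη
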